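/- Let $\varphi_1,\varphi_2:[0,b]\to\mathbb R$ satisfy condition (C1) on $[0,b]$: both functions are increasing, Lipschitz and $C^1$ on $[0,b]$, $\varphi_1+\varphi_2$ is strictly increasing on $[0,b]$, and $\varphi_1'(x)+\varphi_2'(x)>0$ for all $x\in(0,b]$. For $n\in\mathbb N$ let $M_n[0,b]$ be the set of complex $n\times n$ matrices $X$ such that the spectrum of $|X|=(X^*X)^{1/2}$ is contained in $[0,b]$, and for $X\in M_n[0,b]$ put $$\varphi(X)=\varphi_1(|X|)-\varphi_2(|X^*|).$$ Let $T\in M_n[0,b]$, let $m^a$ be the algebraic multiplicity of $0$ as an eigenvalue of $T$ (the multiplicity of $0$ as a root of the characteristic polynomial of $T$), and let $m^g=\dim\ker T$ be its geometric multiplicity (both are $0$ if $T$ is invertible). Assume one of the following: (1) $m^a=m^g$ and $\varphi_1,\varphi_2\in C^{\,n-1-m^g}[0,b]$; or (2) $m^a=m^g+1$, $\varphi_2=0$ on $[0,b]$, and $\varphi_1\in C^{\,n-1-m^g}[0,b]$. (If $n-1-m^g<0$, the condition $C^{\,n-1-m^g}$ is read as $C^0$ and imposes nothing further.) Then the flow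 of $T$ is well defined, that is, there is a unique $X:[0,\infty)\to M_n[0,b]$ with $$\frac{dX(t)}{dt}=[\varphi(X(t)),X(t)]=\varphi(X(t))X(t)-X(t)\varphi(X(t)),\qquad X(0)=T,$$ and $X(t)$ converges to a normal matrix as $t\to\infty$. -/

import Mathlib

open scoped MatrixOrder ComplexOrder Topology

noncomputable section

namespace MatrixFlow

/-- `M_n[a,b]`: the complex `n × n` matrices `X` such that the spectrum of
`|X| = (X^* X)^{1/2}` lies in `[a,b]`. -/
def matricesIn (n : ℕ) (a b : ℝ) : Set (Matrix (Fin n) (Fin n) ℂ) :=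
  {X | spectrum ℝ (CFC.abs X) ⊆ Set.Icc a b}

/-- `φ(X) = φ₁(|X|) - φ₂(|X^*|)`, where `φ₁`, `φ₂` are applied by functional calculus. -/
def phi {n : ℕ} (φ₁ φ₂ : ℝ → ℝ) (X : Matrix (Fin n) (Fin n) ℂ) : Matrix (Fin n) (Fin n) ℂ :=
  cfc φ₁ (CFC.abs X) - cfc φ₂ (CFC.abs (star X))

/-- Condition (C0) on `[a,b]`: continuous and increasing, with strictly increasing sum. -/
structure CondC0 (a b : ℝ) (φ₁ φ₂ : ℝ → ℝ) : Prop where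
  continuousOn₁ : ContinuousOn φ₁ (Set.Icc a b)
  continuousOn₂ : ContinuousOn φ₂ (Set.Icc a b)
  monotoneOn₁ : MonotoneOn φ₁ (Set.Icc a b)
  monotoneOn₂ : MonotoneOn φ₂ (Set.Icc a b)
  strictMonoOn_add : StrictMonoOn (fun x => φ₁ x + φ₂ x) (Set.Icc a b)

/-- Condition (CL): (C0), and both functions are Lipschitz on `[a,b]`. -/
structure CondCL (a b : ℝ) (φ₁ φ₂ : ℝ → ℝ) : Prop extends CondC0 a b φ₁ φ₂ where
  lipschitz₁ : ∃ K, LipschitzOnWith K φ₁ (Set.Icc a b)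
  lipschitz₂ : ∃ K, LipschitzOnWith K φ₂ (Set.Icc a b)

/-- Condition (C1): (CL), both functions are `C¹` on `[a,b]` (one-sided derivatives at the
end points), and `φ₁'(x) + φ₂'(x) > 0` for all `x ∈ [a,b] \ {0}`. -/
structure CondC1 (a b : ℝ) (φ₁ φ₂ : ℝ → ℝ) : Prop extends CondCL a b φ₁ φ₂ where
  contDiffOn₁ : ContDiffOn ℝ 1 φ₁ (Set.Icc a b)
  contDiffOn₂ : ContDiffOn ℝ 1 φ₂ (Set.Icc a b)
  deriv_pos : ∀ x ∈ Set.Icc a b \ {0},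
    0 < derivWithin φ₁ (Set.Icc a b) x + derivWithin φ₂ (Set.Icc a b) x

/-- `X` is a solution on `[0,∞)`, with values in `M_n[a,b]`, of
`dX/dt = [φ(X(t)), X(t)]`, `X(0) = T`. Only the values of `X` on `[0,∞)` matter. -/
structure IsGlobalSolution {n : ℕ} (a b : ℝ) (φ₁ φ₂ : ℝ → ℝ) (T : Matrix (Fin n) (Fin n) ℂ)
    (X : ℝ → Matrix (Fin n) (Fin n) ℂ) : Prop where
  initial : X 0 = T
  mem : ∀ t, 0 ≤ t → X t ∈ matricesIn n a b
  deriv : ∀ t, 0 ≤ t →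
    HasDerivWithinAt X (phi φ₁ φ₂ (X t) * X t - X t * phi φ₁ φ₂ (X t)) (Set.Ici 0) t

/-- The algebraic multiplicity of `0` as an eigenvalue of `T` (it is `0` if `T` is invertible). -/
def algMult {n : ℕ} (T : Matrix (Fin n) (Fin n) ℂ) : ℕ :=
  T.charpoly.rootMultiplicity 0

/-- The geometric multiplicity `dim ker T` of `0` as an eigenvalue of `T`. -/
def geomMult {n : ℕ} (T : Matrix (Fin n) (Fin n) ℂ) : ℕ :=
  Module.finrank ℂ (LinearMap.ker (Matrix.toLin' T))

end MatrixFlow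

end

/-! The squared Frobenius norm of X is a Lyapunov function: its derivative is 2 Re tr(φ(X)(XX* -
X*X)). A Klein-type inequality makes this nonpositive (`trace_phi_mul_sub_nonpos`), and it vanishes
only at normal matrices (`isStarNormal_of_trace_phi_mul_sub_eq_zero`). The same inequality for all
powers of X*X keeps the singular values in [0,b]. Since `phi` is Lipschitz in the Frobenius norm
(`norm_phi_sub_le`), the flow exists globally and is unique (`exists_flow`). The Lax form preserves
polynomial identities q(X) = 0, so by compactness and Barbalat's argument every limit point is a
normal matrix annihilated by q (`tendsto_of_forall_normal`).

These limit points may form a continuum, so convergence needs a rate. Let P_j(t) be the Riesz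
idempotents of X(t): polynomials in X(t) with fixed coefficients, satisfying P_j' = [φ(X), P_j].
Since X - Σ λ_j P_j tends to 0, it suffices that each P_j converges. The defect K = Σ P_j* P_j - 1
vanishes when X is normal, hence tends to 0 along the flow. To first order in K, [φ(X), P_j] is a
block multiplier applied to K, with coefficients given by slopes of φ₁ and φ₂ against squared moduli
(`phi_commutator_near`). The slopes of φ₁ + φ₂ are positive, so W = Re tr K satisfies W' ≤ -c‖K‖²
(`exists_trace_phi_le`). Moreover W = O(‖K‖²) and P_j' = O(‖K‖). Such estimates force each P_j to
have finite length (`exists_tendsto_of_lyapunov`).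

The delicate point is the singular value 0, where φ∘√ need not be differentiable. If λ_j ≠ 0, the
spectral projection of |X| for small singular values annihilates P_j up to O(‖K‖), so functions of
|X| may be replaced there by Hermite interpolants in X*X (`commutator_remainder`). The single
idempotent with λ_j = 0 is recovered from Σ P_j = 1. -/

open scoped MatrixOrder ComplexOrder Topology

noncomputable section

namespace MatrixFlow

/-! ### Frobenius norm estimates in eigenbases of Hermitian matrices. -/

section Frobenius

open Matrix
open scoped Matrix.Norms.Frobenius

variable {m : Type*} [Fintype m] [DecidableEq m]

lemma frobenius_norm_sq (M : Matrix m m ℂ) : ‖M‖ ^ 2 = ∑ i, ∑ j, ‖M i j‖ ^ 2 := by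
  rw [frobenius_norm_def, ← Real.sqrt_eq_rpow, Real.sq_sqrt (by positivity)]
  simp

lemma trace_star_mul_self (M : Matrix m m ℂ) : (star M * M).trace = ((‖M‖ ^ 2 : ℝ) : ℂ) := by
  rw [frobenius_norm_sq, Finset.sum_comm]
  simp only [Matrix.trace, Matrix.diag, Matrix.mul_apply, Matrix.star_apply, Complex.ofReal_sum]
  refine Finset.sum_congr rfl fun i _ => Finset.sum_congr rfl fun j _ => ?_
  rw [Complex.star_def, ← Complex.normSq_eq_conj_mul_self, Complex.normSq_eq_norm_sq]

lemma norm_le_of_entry_le {M N : Matrix m m ℂ} {L : ℝ} (hL : 0 ≤ L)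
    (h : ∀ i j, ‖M i j‖ ≤ L * ‖N i j‖) : ‖M‖ ≤ L * ‖N‖ := by
  have : ‖M‖ ^ 2 ≤ (L * ‖N‖) ^ 2 := by
    rw [mul_pow, frobenius_norm_sq, frobenius_norm_sq, Finset.mul_sum]
    refine Finset.sum_le_sum fun i _ => ?_
    rw [Finset.mul_sum]
    refine Finset.sum_le_sum fun j _ => ?_
    rw [← mul_pow]
    exact pow_le_pow_left₀ (norm_nonneg _) (h i j) 2
  exact le_of_sq_le_sq this (by positivity)

lemma entry_norm_le (M : Matrix m m ℂ) (i j : m) : ‖M i j‖ ≤ ‖M‖ := by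
  refine le_of_sq_le_sq ?_ (norm_nonneg _)
  rw [frobenius_norm_sq]
  exact (Finset.single_le_sum (f := fun j => ‖M i j‖ ^ 2) (fun _ _ => by positivity)
    (Finset.mem_univ j)).trans (Finset.single_le_sum (f := fun i => ∑ j, ‖M i j‖ ^ 2)
    (fun _ _ => by positivity) (Finset.mem_univ i))

lemma norm_le_card_mul_of_entry_le {M : Matrix m m ℂ} {c : ℝ} (hc : 0 ≤ c)
    (h : ∀ i j, ‖M i j‖ ≤ c) : ‖M‖ ≤ Fintype.card m * c := by
  refine le_of_sq_le_sq ?_ (by positivity)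
  rw [frobenius_norm_sq]
  calc ∑ i, ∑ j, ‖M i j‖ ^ 2 ≤ ∑ _i : m, ∑ _j : m, c ^ 2 :=
        Finset.sum_le_sum fun i _ => Finset.sum_le_sum fun j _ =>
          pow_le_pow_left₀ (norm_nonneg _) (h i j) 2
    _ = (Fintype.card m * c) ^ 2 := by simp; ring

lemma norm_unitary_conj (U V : unitary (Matrix m m ℂ)) (M : Matrix m m ℂ) :
    ‖star (U : Matrix m m ℂ) * M * V‖ = ‖M‖ := by
  have h : ((‖star (U : Matrix m m ℂ) * M * V‖ ^ 2 : ℝ) : ℂ) = ((‖M‖ ^ 2 : ℝ) : ℂ) := by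
    rw [← trace_star_mul_self, ← trace_star_mul_self]
    calc (star (star (U : Matrix m m ℂ) * M * V) * (star (U : Matrix m m ℂ) * M * V)).trace
        = (star (V : Matrix m m ℂ) * (star M * (U * star (U : Matrix m m ℂ)) * M * V)).trace := by
          simp only [star_mul, star_star, mul_assoc]
      _ = (star M * M).trace := by
          rw [Unitary.mul_star_self_of_mem U.2, mul_one, Matrix.trace_mul_comm, mul_assoc,
            Unitary.mul_star_self_of_mem V.2, mul_one]
  have h' := Complex.ofReal_injective h
  exact (pow_left_inj₀ (norm_nonneg _) (norm_nonneg _) two_ne_zero).1 h'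

variable {A B : Matrix m m ℂ} (hA : A.IsHermitian) (hB : B.IsHermitian)

lemma star_eigenvectorUnitary_mul_cfc (f : ℝ → ℝ) :
    star (hA.eigenvectorUnitary : Matrix m m ℂ) * cfc f A =
      diagonal (fun i => (f (hA.eigenvalues i) : ℂ)) *
        star (hA.eigenvectorUnitary : Matrix m m ℂ) := by
  rw [hA.cfc_eq, IsHermitian.cfc, Unitary.conjStarAlgAut_apply, ← mul_assoc, ← mul_assoc,
    Unitary.coe_star_mul_self, one_mul]
  rfl

lemma cfc_mul_eigenvectorUnitary (f : ℝ → ℝ) :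
    cfc f A * (hA.eigenvectorUnitary : Matrix m m ℂ) =
      (hA.eigenvectorUnitary : Matrix m m ℂ) * diagonal (fun i => (f (hA.eigenvalues i) : ℂ)) := by
  rw [hA.cfc_eq, IsHermitian.cfc, Unitary.conjStarAlgAut_apply, mul_assoc,
    Unitary.coe_star_mul_self, mul_one]
  rfl

/-- The matrix of `M` with respect to eigenbases of two Hermitian matrices. -/
def inEigenbases (M : Matrix m m ℂ) : Matrix m m ℂ :=
  star (hA.eigenvectorUnitary : Matrix m m ℂ) * M * hB.eigenvectorUnitary

lemma norm_inEigenbases (M : Matrix m m ℂ) : ‖inEigenbases hA hB M‖ = ‖M‖ :=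
  norm_unitary_conj _ _ _

lemma inEigenbases_sub (M N : Matrix m m ℂ) :
    inEigenbases hA hB (M - N) = inEigenbases hA hB M - inEigenbases hA hB N := by
  simp [inEigenbases, mul_sub, sub_mul]

lemma inEigenbases_cfc_mul (f : ℝ → ℝ) (M : Matrix m m ℂ) (i j : m) :
    inEigenbases hA hB (cfc f A * M) i j =
      (f (hA.eigenvalues i) : ℂ) * inEigenbases hA hB M i j := by
  rw [inEigenbases, ← mul_assoc, star_eigenvectorUnitary_mul_cfc hA, mul_assoc, mul_assoc,
    diagonal_mul, ← mul_assoc]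
  rfl

lemma inEigenbases_mul_cfc (f : ℝ → ℝ) (M : Matrix m m ℂ) (i j : m) :
    inEigenbases hA hB (M * cfc f B) i j =
      inEigenbases hA hB M i j * (f (hB.eigenvalues j) : ℂ) := by
  rw [inEigenbases, mul_assoc, mul_assoc, cfc_mul_eigenvectorUnitary hB, ← mul_assoc,
    ← mul_assoc, mul_diagonal]
  rfl

lemma inEigenbases_commutator (f : ℝ → ℝ) (M : Matrix m m ℂ) (i j : m) :
    inEigenbases hA hB (cfc f A * M - M * cfc f B) i j =
      ((f (hA.eigenvalues i) - f (hB.eigenvalues j) : ℝ) : ℂ) * inEigenbases hA hB M i j := by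
  rw [inEigenbases_sub, Matrix.sub_apply, inEigenbases_cfc_mul, inEigenbases_mul_cfc]
  push_cast
  ring

/-- In eigenbases of A and B, the map M ↦ f(A)M - M f(B) multiplies entry (i,j) by f(a_i) - f(b_j),
and the Frobenius norm is unitarily invariant and entrywise. A scalar Lipschitz bound therefore
passes to matrices with the same constant. -/
theorem norm_cfc_mul_sub_mul_cfc_le {A B : Matrix m m ℂ} (hA : A.IsHermitian)
    (hB : B.IsHermitian) (f g : ℝ → ℝ) {L : ℝ} (hL : 0 ≤ L)
    (h : ∀ x ∈ spectrum ℝ A, ∀ y ∈ spectrum ℝ B, |f x - f y| ≤ L * |g x - g y|)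
    (M : Matrix m m ℂ) :
    ‖cfc f A * M - M * cfc f B‖ ≤ L * ‖cfc g A * M - M * cfc g B‖ := by
  rw [← norm_inEigenbases hA hB, ← norm_inEigenbases hA hB (cfc g A * M - M * cfc g B)]
  refine norm_le_of_entry_le hL fun i j => ?_
  rw [inEigenbases_commutator, inEigenbases_commutator, norm_mul, norm_mul, ← mul_assoc,
    Complex.norm_real, Complex.norm_real, Real.norm_eq_abs, Real.norm_eq_abs]
  exact mul_le_mul_of_nonneg_right (h _ (hA.eigenvalues_mem_spectrum_real i) _
    (hB.eigenvalues_mem_spectrum_real j)) (norm_nonneg _)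

lemma norm_cfc_le {A : Matrix m m ℂ} (hA : A.IsHermitian) (f : ℝ → ℝ) {c : ℝ} (hc : 0 ≤ c)
    (h : ∀ x ∈ spectrum ℝ A, |f x| ≤ c) :
    ‖cfc f A‖ ≤ c * ‖(1 : Matrix m m ℂ)‖ := by
  rw [← norm_inEigenbases hA hA, ← norm_inEigenbases hA hA (1 : Matrix m m ℂ)]
  refine norm_le_of_entry_le hc fun i j => ?_
  have := inEigenbases_cfc_mul hA hA f 1 i j
  rw [mul_one] at this
  rw [this, norm_mul, Complex.norm_real]
  exact mul_le_mul_of_nonneg_right (h _ (hA.eigenvalues_mem_spectrum_real i)) (norm_nonneg _)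

end Frobenius

/-! ### Lipschitz dependence of functions of |X| and |X*| on X. -/

section AbsoluteValue

open Matrix

variable {n : ℕ}

lemma isHermitian_abs (X : Matrix (Fin n) (Fin n) ℂ) : (CFC.abs X).IsHermitian :=
  (CFC.abs_nonneg X).posSemidef.isHermitian

lemma spectrum_abs_nonneg (X : Matrix (Fin n) (Fin n) ℂ) {x : ℝ}
    (hx : x ∈ spectrum ℝ (CFC.abs X)) : 0 ≤ x :=
  spectrum_nonneg_of_nonneg (CFC.abs_nonneg X) hx

lemma cfc_eval_sq_abs (r : Polynomial ℝ) (X : Matrix (Fin n) (Fin n) ℂ) :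
    cfc (fun s => r.eval (s ^ 2)) (CFC.abs X) = Polynomial.aeval (star X * X) r := by
  have h := cfc_polynomial (r.comp (Polynomial.X ^ 2)) (CFC.abs X)
    (isHermitian_abs X).isSelfAdjoint
  rw [Polynomial.aeval_comp] at h
  simp only [map_pow, Polynomial.aeval_X, CFC.abs_sq] at h
  rw [← h]
  simp [Polynomial.eval_comp]

lemma finite_spectrum_real {m : Type*} [Fintype m] [DecidableEq m] {A : Matrix m m ℂ}
    (hA : A.IsHermitian) : (spectrum ℝ A).Finite := by
  rw [hA.spectrum_real_eq_range_eigenvalues]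
  exact Set.finite_range _

/-- Squaring is injective on nonnegative reals, so Lagrange interpolation at the squares applies.
Interpolating in x² turns a function of |X| into a polynomial in X*X, with no square root left. -/
lemma exists_polynomial_eval_sq (φ : ℝ → ℝ) {s : Set ℝ} (hs : s.Finite) (hpos : ∀ x ∈ s, 0 ≤ x) :
    ∃ r : Polynomial ℝ, ∀ x ∈ s, r.eval (x ^ 2) = φ x := by
  refine ⟨Lagrange.interpolate hs.toFinset (fun x => x ^ 2) φ, fun x hx => ?_⟩
  refine Lagrange.eval_interpolate_at_node (v := fun x => x ^ 2) φ ?_ (by simpa using hx)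
  intro x hx y hy hxy
  exact (pow_left_inj₀ (hpos x (by simpa using hx)) (hpos y (by simpa using hy)) two_ne_zero).1 hxy

/-- The Hermitian dilation of a matrix. -/
def dilation (X : Matrix (Fin n) (Fin n) ℂ) : Matrix (Fin n ⊕ Fin n) (Fin n ⊕ Fin n) ℂ :=
  fromBlocks 0 (star X) X 0

lemma isHermitian_dilation (X : Matrix (Fin n) (Fin n) ℂ) : (dilation X).IsHermitian := by
  rw [dilation, IsHermitian, fromBlocks_conjTranspose]
  simp [star_eq_conjTranspose]

lemma dilation_sq (X : Matrix (Fin n) (Fin n) ℂ) :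
    dilation X ^ 2 = fromBlocks (star X * X) 0 0 (X * star X) := by
  simp [dilation, sq, fromBlocks_multiply]

lemma aeval_fromBlocks_diagonal (A D : Matrix (Fin n) (Fin n) ℂ) (r : Polynomial ℝ) :
    Polynomial.aeval (fromBlocks A 0 0 D) r =
      fromBlocks (Polynomial.aeval A r) 0 0 (Polynomial.aeval D r) := by
  have hpow : ∀ k : ℕ, (fromBlocks A 0 0 D) ^ k = fromBlocks (A ^ k) 0 0 (D ^ k) := by
    intro k
    induction k with
    | zero => simp
    | succ k ih => simp [pow_succ, ih, fromBlocks_multiply]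
  induction r using Polynomial.induction_on' with
  | add p q hp hq => simp [hp, hq, fromBlocks_add]
  | monomial k a =>
    rw [Polynomial.aeval_monomial, Polynomial.aeval_monomial, Polynomial.aeval_monomial, hpow,
      ← Algebra.smul_def, ← Algebra.smul_def, ← Algebra.smul_def, fromBlocks_smul]
    simp

/-- The square of the dilation is diag(X*X, XX*). A single polynomial in squares, interpolating φ on
all the spectra involved, computes the three functional calculi at once. -/
lemma cfc_abs_dilation (φ : ℝ → ℝ) (X : Matrix (Fin n) (Fin n) ℂ) :
    cfc (fun t => φ |t|) (dilation X) =
      fromBlocks (cfc φ (CFC.abs X)) 0 0 (cfc φ (CFC.abs (star X))) := by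
  obtain ⟨r, hr⟩ := exists_polynomial_eval_sq φ
    (s := spectrum ℝ (CFC.abs X) ∪ spectrum ℝ (CFC.abs (star X)) ∪
      (fun t => |t|) '' spectrum ℝ (dilation X))
    (((finite_spectrum_real (isHermitian_abs _)).union
      (finite_spectrum_real (isHermitian_abs _))).union
      ((finite_spectrum_real (isHermitian_dilation X)).image _)) (by
      rintro x ((hx | hx) | ⟨t, -, rfl⟩)
      · exact spectrum_abs_nonneg _ hx
      · exact spectrum_abs_nonneg _ hx
      · exact abs_nonneg t)
  have h1 : cfc φ (CFC.abs X) = Polynomial.aeval (star X * X) r := by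
    rw [← cfc_eval_sq_abs]
    exact cfc_congr fun x hx => (hr x (Or.inl (Or.inl hx))).symm
  have h2 : cfc φ (CFC.abs (star X)) = Polynomial.aeval (X * star X) r := by
    have := cfc_eval_sq_abs r (star X)
    rw [star_star] at this
    rw [← this]
    exact cfc_congr fun x hx => (hr x (Or.inl (Or.inr hx))).symm
  rw [h1, h2, ← aeval_fromBlocks_diagonal, ← dilation_sq]
  have h3 := cfc_polynomial (r.comp (Polynomial.X ^ 2)) (dilation X)
    (isHermitian_dilation X).isSelfAdjoint
  rw [Polynomial.aeval_comp] at h3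
  simp only [map_pow, Polynomial.aeval_X] at h3
  rw [← h3]
  refine cfc_congr fun x hx => ?_
  have := hr |x| (Or.inr ⟨x, hx, rfl⟩)
  simp only [Polynomial.eval_comp, Polynomial.eval_pow, Polynomial.eval_X]
  rw [← this, sq_abs]

open scoped Matrix.Norms.Frobenius

lemma norm_fromBlocks_sq (A B C D : Matrix (Fin n) (Fin n) ℂ) :
    ‖fromBlocks A B C D‖ ^ 2 = ‖A‖ ^ 2 + ‖B‖ ^ 2 + ‖C‖ ^ 2 + ‖D‖ ^ 2 := by
  simp only [frobenius_norm_sq, Fintype.sum_sum_type, fromBlocks_apply₁₁, fromBlocks_apply₁₂,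
    fromBlocks_apply₂₁, fromBlocks_apply₂₂, Finset.sum_add_distrib]
  ring

/-- The dilation is additive in X and t ↦ φ|t| is Lipschitz, so the Hermitian estimate with M = 1
controls both diagonal blocks. The factor 2 appears because X and X* each occupy one block of the
dilation. -/
theorem norm_cfc_abs_sub_sq_add_le {φ : ℝ → ℝ} {L : ℝ} (hL : 0 ≤ L)
    (h : ∀ x y, |φ x - φ y| ≤ L * |x - y|) (X Y : Matrix (Fin n) (Fin n) ℂ) :
    ‖cfc φ (CFC.abs X) - cfc φ (CFC.abs Y)‖ ^ 2 +
      ‖cfc φ (CFC.abs (star X)) - cfc φ (CFC.abs (star Y))‖ ^ 2 ≤ 2 * (L * ‖X - Y‖) ^ 2 := by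
  have h1 := norm_cfc_mul_sub_mul_cfc_le (isHermitian_dilation X) (isHermitian_dilation Y)
    (fun t => φ |t|) (fun t => t) hL (fun x _ y _ => (h _ _).trans
      (mul_le_mul_of_nonneg_left (abs_abs_sub_abs_le_abs_sub x y) hL)) 1
  rw [cfc_id' ℝ (dilation X) (isHermitian_dilation X).isSelfAdjoint,
    cfc_id' ℝ (dilation Y) (isHermitian_dilation Y).isSelfAdjoint, cfc_abs_dilation,
    cfc_abs_dilation, dilation, dilation] at h1
  simp only [mul_one, one_mul, sub_eq_add_neg, fromBlocks_neg, fromBlocks_add, neg_zero,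
    add_zero] at h1
  simp only [← sub_eq_add_neg] at h1
  have h2 := pow_le_pow_left₀ (norm_nonneg _) h1 2
  rw [mul_pow, norm_fromBlocks_sq, norm_fromBlocks_sq, ← star_sub, norm_star] at h2
  simp only [norm_zero] at h2
  rw [mul_pow]
  linarith

theorem norm_cfc_abs_sub_le {φ : ℝ → ℝ} {L : ℝ} (hL : 0 ≤ L)
    (h : ∀ x y, |φ x - φ y| ≤ L * |x - y|) (X Y : Matrix (Fin n) (Fin n) ℂ) :
    ‖cfc φ (CFC.abs X) - cfc φ (CFC.abs Y)‖ ≤ 2 * L * ‖X - Y‖ := by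
  have h1 := norm_cfc_abs_sub_sq_add_le hL h X Y
  refine le_of_sq_le_sq ?_ (by positivity)
  nlinarith [sq_nonneg ‖cfc φ (CFC.abs (star X)) - cfc φ (CFC.abs (star Y))‖,
    sq_nonneg (L * ‖X - Y‖)]

theorem norm_phi_sub_le {φ₁ φ₂ : ℝ → ℝ} {L : ℝ} (hL : 0 ≤ L)
    (h₁ : ∀ x y, |φ₁ x - φ₁ y| ≤ L * |x - y|) (h₂ : ∀ x y, |φ₂ x - φ₂ y| ≤ L * |x - y|)
    (X Y : Matrix (Fin n) (Fin n) ℂ) :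
    ‖phi φ₁ φ₂ X - phi φ₁ φ₂ Y‖ ≤ 4 * L * ‖X - Y‖ := by
  have h3 := norm_cfc_abs_sub_le hL h₁ X Y
  have h4 := norm_cfc_abs_sub_le hL h₂ (star X) (star Y)
  rw [← star_sub, norm_star] at h4
  have : phi φ₁ φ₂ X - phi φ₁ φ₂ Y = (cfc φ₁ (CFC.abs X) - cfc φ₁ (CFC.abs Y)) -
      (cfc φ₂ (CFC.abs (star X)) - cfc φ₂ (CFC.abs (star Y))) := by
    simp only [phi]; abel
  rw [this]
  refine (norm_sub_le _ _).trans ?_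
  linarith

lemma isSelfAdjoint_phi (φ₁ φ₂ : ℝ → ℝ) (X : Matrix (Fin n) (Fin n) ℂ) :
    IsSelfAdjoint (phi φ₁ φ₂ X) :=
  IsSelfAdjoint.sub (cfc_predicate φ₁ _) (cfc_predicate φ₂ _)

lemma norm_phi_le {φ₁ φ₂ : ℝ → ℝ} {c : ℝ} (hc : 0 ≤ c)
    (h₁ : ∀ x, |φ₁ x| ≤ c) (h₂ : ∀ x, |φ₂ x| ≤ c) (X : Matrix (Fin n) (Fin n) ℂ) :
    ‖phi φ₁ φ₂ X‖ ≤ 2 * c * ‖(1 : Matrix (Fin n) (Fin n) ℂ)‖ := by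
  have h3 := norm_cfc_le (isHermitian_abs X) φ₁ hc fun x _ => h₁ x
  have h4 := norm_cfc_le (isHermitian_abs (star X)) φ₂ hc fun x _ => h₂ x
  refine (norm_sub_le _ _).trans ?_
  linarith

lemma phi_congr {φ₁ φ₂ ψ₁ ψ₂ : ℝ → ℝ} {X : Matrix (Fin n) (Fin n) ℂ}
    (h₁ : Set.EqOn φ₁ ψ₁ (spectrum ℝ (CFC.abs X)))
    (h₂ : Set.EqOn φ₂ ψ₂ (spectrum ℝ (CFC.abs (star X)))) : phi φ₁ φ₂ X = phi ψ₁ ψ₂ X := by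
  rw [phi, phi, cfc_congr h₁, cfc_congr h₂]

end AbsoluteValue

/-! ### A Klein-type trace inequality and its equality case. -/

section Klein

open Matrix
open scoped Matrix.Norms.Frobenius

/-- Take F to be the integral of f against d(u^m) on the half-line. As f is monotone, its value at
the endpoint x bounds the integrand on the side needed, whichever of x and y is larger. -/
lemma exists_potential {f : ℝ → ℝ} (hf : Continuous f) (hm : Monotone f) {m : ℕ} :
    ∃ F : ℝ → ℝ, ∀ x y, 0 ≤ x → 0 ≤ y → F x - F y ≤ f x * (x ^ m - y ^ m) := by
  have hc : Continuous fun u : ℝ => f u * (m * u ^ (m - 1)) := by fun_prop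
  have hint : ∀ a b : ℝ, IntervalIntegrable (fun u : ℝ => f u * (m * u ^ (m - 1)))
    MeasureTheory.volume a b := fun a b => hc.intervalIntegrable a b
  refine ⟨fun s => ∫ u in (0 : ℝ)..s, f u * (m * u ^ (m - 1)), fun x y hx hy => ?_⟩
  have hpow : ∀ a b : ℝ, ∫ u in a..b, f x * (m * u ^ (m - 1)) = f x * (b ^ m - a ^ m) := by
    intro a b
    rw [intervalIntegral.integral_const_mul]
    congr 1
    exact intervalIntegral.integral_eq_sub_of_hasDerivAt (f := fun u => u ^ m)
      (fun u _ => hasDerivAt_pow m u) ((by fun_prop : Continuous fun u : ℝ =>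
        (m : ℝ) * u ^ (m - 1)).intervalIntegrable a b)
  have hint' : ∀ a b : ℝ, IntervalIntegrable (fun u : ℝ => f x * (m * u ^ (m - 1)))
    MeasureTheory.volume a b := fun a b =>
      (by fun_prop : Continuous fun u : ℝ => f x * (m * u ^ (m - 1))).intervalIntegrable a b
  rw [intervalIntegral.integral_interval_sub_left (hint 0 x) (hint 0 y)]
  rcases le_total y x with h | h
  · rw [← hpow y x]
    refine intervalIntegral.integral_mono_on h (hint y x) (hint' y x) fun u hu => ?_
    have : (0 : ℝ) ≤ u := hy.trans hu.1
    exact mul_le_mul_of_nonneg_right (hm hu.2) (by positivity)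
  · rw [intervalIntegral.integral_symm, ← neg_sub, mul_neg, ← hpow x y, neg_le_neg_iff]
    refine intervalIntegral.integral_mono_on h (hint' x y) (hint x y) fun u hu => ?_
    have : (0 : ℝ) ≤ u := hx.trans hu.1
    exact mul_le_mul_of_nonneg_right (hm hu.1) (by positivity)

section Trace

variable {m : Type*} [Fintype m] [DecidableEq m]
variable {A B : Matrix m m ℂ} (hA : A.IsHermitian) (hB : B.IsHermitian)

/-- Squared moduli of the overlaps of the eigenvectors of two Hermitian matrices. -/
def overlap (i j : m) : ℝ := ‖inEigenbases hA hB 1 i j‖ ^ 2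

lemma overlap_nonneg (i j : m) : 0 ≤ overlap hA hB i j := by
  unfold overlap; positivity

lemma trace_cfc_mul_cfc (f g : ℝ → ℝ) : (cfc f A * cfc g B).trace =
    ((∑ i, ∑ j, overlap hA hB i j * (f (hA.eigenvalues i) * g (hB.eigenvalues j)) : ℝ) : ℂ) := by
  have h1 : (cfc f A * cfc g B).trace = (inEigenbases hA hB (cfc f A * cfc g B) *
      star (inEigenbases hA hB 1)).trace := by
    simp only [inEigenbases, mul_one, star_mul, star_star]
    have hU := hA.eigenvectorUnitary.2
    have hV := hB.eigenvectorUnitary.2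
    rw [mul_assoc, ← mul_assoc _ (star _) _, Unitary.mul_star_self_of_mem hV, one_mul]
    conv_rhs => rw [Matrix.trace_mul_comm, ← mul_assoc, Unitary.mul_star_self_of_mem hU, one_mul]
  rw [h1]
  simp only [Matrix.trace, Matrix.diag, Matrix.mul_apply, Matrix.star_apply, Complex.ofReal_sum]
  refine Finset.sum_congr rfl fun i _ => Finset.sum_congr rfl fun j _ => ?_
  have h2 := inEigenbases_mul_cfc hA hB g (cfc f A * 1) i j
  rw [inEigenbases_cfc_mul, mul_one] at h2
  rw [h2, overlap, ← Complex.normSq_eq_norm_sq]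
  push_cast
  rw [Complex.normSq_eq_conj_mul_self, Complex.star_def]
  ring

lemma overlap_symm (i j : m) : overlap hB hA j i = overlap hA hB i j := by
  have : inEigenbases hB hA 1 = star (inEigenbases hA hB 1) := by
    simp [inEigenbases]
  rw [overlap, overlap, this, Matrix.star_apply, norm_star]

lemma sum_overlap_right (i : m) : ∑ j, overlap hA hB i j = 1 := by
  have h : inEigenbases hA hB 1 * star (inEigenbases hA hB 1) = 1 := by
    simp only [inEigenbases, mul_one, star_mul, star_star]
    rw [mul_assoc, ← mul_assoc _ (star _) _, Unitary.mul_star_self_of_mem hB.eigenvectorUnitary.2,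
      one_mul, Unitary.star_mul_self_of_mem hA.eigenvectorUnitary.2]
  have h2 := congrFun (congrFun h i) i
  rw [Matrix.mul_apply, Matrix.one_apply_eq] at h2
  have h3 : ((∑ j, overlap hA hB i j : ℝ) : ℂ) = 1 := by
    rw [← h2, Complex.ofReal_sum]
    refine Finset.sum_congr rfl fun j _ => ?_
    rw [overlap, ← Complex.normSq_eq_norm_sq, Matrix.star_apply, Complex.star_def,
      ← Complex.mul_conj]
  exact_mod_cast h3

lemma sum_overlap_left (j : m) : ∑ i, overlap hA hB i j = 1 := by
  simp_rw [← overlap_symm hA hB]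
  exact sum_overlap_right hB hA j

/-- The overlap matrix is doubly stochastic, so a single trace can be spread over pairs of
eigenvectors and compared with a mixed trace term by term. -/
lemma sum_sum_overlap_mul_left (f : m → ℝ) :
    ∑ i, ∑ j, overlap hA hB i j * f i = ∑ i, f i := by
  simp_rw [← Finset.sum_mul, sum_overlap_right, one_mul]

lemma sum_sum_overlap_mul_right (f : m → ℝ) :
    ∑ i, ∑ j, overlap hA hB i j * f j = ∑ i, f i := by
  rw [Finset.sum_comm]
  simp_rw [← Finset.sum_mul, sum_overlap_left, one_mul]

lemma trace_cfc (f : ℝ → ℝ) :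
    (cfc f A).trace = ((∑ i, f (hA.eigenvalues i) : ℝ) : ℂ) := by
  have h := trace_cfc_mul_cfc hA hA f (fun _ => 1)
  rw [cfc_const_one ℝ A hA.isSelfAdjoint, mul_one] at h
  rw [h]
  simp_rw [mul_one]
  rw [sum_sum_overlap_mul_left hA hA fun i => f (hA.eigenvalues i)]

end Trace

variable {n : ℕ}

/-- X*X and XX* have the same characteristic polynomial, and the functional calculus by the square
root respects this. -/
lemma eigenvalues_abs_star (X : Matrix (Fin n) (Fin n) ℂ) :
    (isHermitian_abs (star X)).eigenvalues = (isHermitian_abs X).eigenvalues := by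
  rw [IsHermitian.eigenvalues_eq_eigenvalues_iff]
  have key : ∀ Y : Matrix (Fin n) (Fin n) ℂ, (CFC.abs Y) = cfc Real.sqrt (star Y * Y) := by
    intro Y
    rw [CFC.abs, CFC.sqrt_eq_real_sqrt _ (star_mul_self_nonneg Y), cfcₙ_eq_cfc]
  have hA : (star X * X).IsHermitian := isHermitian_conjTranspose_mul_self X
  have hB : (X * star X).IsHermitian := isHermitian_mul_conjTranspose_self X
  rw [key, key, star_star, hA.charpoly_cfc_eq, hB.charpoly_cfc_eq,
    (hB.eigenvalues_eq_eigenvalues_iff hA).2 (Matrix.charpoly_mul_comm X (star X))]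

variable (φ₁ φ₂ : ℝ → ℝ) (X : Matrix (Fin n) (Fin n) ℂ)

lemma abs_star_sq : CFC.abs (star X) ^ 2 = X * star X := by
  rw [CFC.abs_sq, star_star]

lemma trace_phi_mul_sub (p : ℕ) :
    (phi φ₁ φ₂ X * ((X * star X) ^ p - (star X * X) ^ p)).trace =
    ((∑ i, ∑ j, overlap (isHermitian_abs X) (isHermitian_abs (star X)) i j *
      ((φ₁ ((isHermitian_abs X).eigenvalues i) - φ₂ ((isHermitian_abs X).eigenvalues j)) *
      ((isHermitian_abs X).eigenvalues j ^ (2 * p) -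
        (isHermitian_abs X).eigenvalues i ^ (2 * p))) : ℝ) : ℂ) := by
  set s := (isHermitian_abs X).eigenvalues with hs
  set hS := isHermitian_abs X
  set hS' := isHermitian_abs (star X)
  have hs' : hS'.eigenvalues = s := eigenvalues_abs_star X
  have e1 : (X * star X) ^ p = cfc (fun x : ℝ => x ^ (2 * p)) (CFC.abs (star X)) := by
    rw [cfc_pow_id (R := ℝ) (CFC.abs (star X)) (2 * p) hS'.isSelfAdjoint, pow_mul, abs_star_sq]
  have e2 : (star X * X) ^ p = cfc (fun x : ℝ => x ^ (2 * p)) (CFC.abs X) := by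
    rw [cfc_pow_id (R := ℝ) (CFC.abs X) (2 * p) hS.isSelfAdjoint, pow_mul, CFC.abs_sq]
  rw [e1, e2, phi, sub_mul, mul_sub, mul_sub, trace_sub, trace_sub, trace_sub,
    trace_cfc_mul_cfc hS hS', Matrix.trace_mul_comm (cfc φ₂ _) (cfc _ (CFC.abs X)),
    trace_cfc_mul_cfc hS hS',
    ← cfc_mul φ₁ _ (CFC.abs X) ((finite_spectrum_real hS).continuousOn _)
      ((finite_spectrum_real hS).continuousOn _),
    ← cfc_mul φ₂ _ (CFC.abs (star X)) ((finite_spectrum_real hS').continuousOn _)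
      ((finite_spectrum_real hS').continuousOn _), trace_cfc hS, trace_cfc hS', hs',
    ← sum_sum_overlap_mul_left hS hS' (fun i => φ₁ (s i) * s i ^ (2 * p)),
    ← sum_sum_overlap_mul_right hS hS' (fun i => φ₂ (s i) * s i ^ (2 * p))]
  norm_cast
  simp only [← Finset.sum_sub_distrib]
  refine Finset.sum_congr rfl fun i _ => Finset.sum_congr rfl fun j _ => ?_
  ring

variable {φ₁ φ₂}

lemma eigenvalues_abs_nonneg (i : Fin n) : 0 ≤ (isHermitian_abs X).eigenvalues i :=
  spectrum_abs_nonneg X ((isHermitian_abs X).eigenvalues_mem_spectrum_real i)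

/-- The potentials show that the trace is a sum of nonpositive terms. -/
lemma trace_phi_mul_sub_eq (p : ℕ) (F₁ F₂ : ℝ → ℝ) :
    (phi φ₁ φ₂ X * ((X * star X) ^ p - (star X * X) ^ p)).trace.re =
    -∑ i, ∑ j, overlap (isHermitian_abs X) (isHermitian_abs (star X)) i j *
      ((φ₁ ((isHermitian_abs X).eigenvalues i) * ((isHermitian_abs X).eigenvalues i ^ (2 * p) -
        (isHermitian_abs X).eigenvalues j ^ (2 * p)) -
        (F₁ ((isHermitian_abs X).eigenvalues i) - F₁ ((isHermitian_abs X).eigenvalues j))) +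
      (φ₂ ((isHermitian_abs X).eigenvalues j) * ((isHermitian_abs X).eigenvalues j ^ (2 * p) -
        (isHermitian_abs X).eigenvalues i ^ (2 * p)) -
        (F₂ ((isHermitian_abs X).eigenvalues j) - F₂ ((isHermitian_abs X).eigenvalues i)))) := by
  rw [trace_phi_mul_sub, Complex.ofReal_re]
  set s := (isHermitian_abs X).eigenvalues
  set hS := isHermitian_abs X
  set hS' := isHermitian_abs (star X)
  -- Double stochasticity makes the potential terms cancel in the sum, so they may be inserted
  -- freely to give each summand a sign.
  have hzero : ∑ i, ∑ j, overlap hS hS' i j * (F₁ (s i) - F₂ (s i)) -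
      ∑ i, ∑ j, overlap hS hS' i j * (F₁ (s j) - F₂ (s j)) = 0 := by
    rw [sum_sum_overlap_mul_left hS hS' (fun i => F₁ (s i) - F₂ (s i)),
      sum_sum_overlap_mul_right hS hS' (fun i => F₁ (s i) - F₂ (s i)), sub_self]
  rw [← add_zero (Finset.sum _ _), ← hzero, ← Finset.sum_neg_distrib]
  simp only [← Finset.sum_add_distrib, ← Finset.sum_sub_distrib, ← Finset.sum_neg_distrib]
  refine Finset.sum_congr rfl fun i _ => Finset.sum_congr rfl fun j _ => ?_
  ring

theorem trace_phi_mul_sub_nonpos (h₁ : Continuous φ₁) (h₂ : Continuous φ₂) (m₁ : Monotone φ₁)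
    (m₂ : Monotone φ₂) (p : ℕ) :
    (phi φ₁ φ₂ X * ((X * star X) ^ p - (star X * X) ^ p)).trace.re ≤ 0 := by
  obtain ⟨F₁, hF₁⟩ := exists_potential h₁ m₁ (m := 2 * p)
  obtain ⟨F₂, hF₂⟩ := exists_potential h₂ m₂ (m := 2 * p)
  rw [trace_phi_mul_sub_eq X p F₁ F₂, neg_nonpos]
  refine Finset.sum_nonneg fun i _ => Finset.sum_nonneg fun j _ =>
    mul_nonneg (overlap_nonneg _ _ _ _) (add_nonneg ?_ ?_)
  · exact sub_nonneg.2 (hF₁ _ _ (eigenvalues_abs_nonneg X i) (eigenvalues_abs_nonneg X j))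
  · exact sub_nonneg.2 (hF₂ _ _ (eigenvalues_abs_nonneg X j) (eigenvalues_abs_nonneg X i))

/-- Insert z between x and y, add the potential inequalities for (x,z) and (z,y), and compare with
the assumed equality for (x,y). This leaves (f x - f z)(z² - y²) ≤ 0, which contradicts monotonicity
unless f z = f x. -/
lemma const_of_potential {f F : ℝ → ℝ} (hm : Monotone f)
    (hF : ∀ x y, 0 ≤ x → 0 ≤ y → F x - F y ≤ f x * (x ^ 2 - y ^ 2)) {x y z : ℝ}
    (hx : 0 ≤ x) (hy : 0 ≤ y) (h : f x * (x ^ 2 - y ^ 2) - (F x - F y) = 0)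
    (hz : (x < z ∧ z < y) ∨ (y < z ∧ z < x)) : f z = f x := by
  have hz0 : 0 ≤ z := by rcases hz with hz | hz <;> linarith
  have h1 := hF x z hx hz0
  have h2 := hF z y hz0 hy
  have h3 : (f x - f z) * (z ^ 2 - y ^ 2) ≤ 0 := by nlinarith
  rcases hz with ⟨ha, hb⟩ | ⟨ha, hb⟩
  · have : z ^ 2 - y ^ 2 < 0 := by nlinarith
    exact le_antisymm (by nlinarith) (hm ha.le)
  · have : 0 < z ^ 2 - y ^ 2 := by nlinarith
    exact le_antisymm (hm hb.le) (by nlinarith)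

/-- Every summand must vanish. If two singular values with nonzero overlap differed, both functions
would be constant strictly between them, against strict monotonicity of the sum. Overlaps thus occur
only between equal singular values, so |X| = |X*|. -/
theorem isStarNormal_of_trace_phi_mul_sub_eq_zero (h₁ : Continuous φ₁) (h₂ : Continuous φ₂)
    (m₁ : Monotone φ₁) (m₂ : Monotone φ₂) {b : ℝ}
    (hstrict : StrictMonoOn (fun x => φ₁ x + φ₂ x) (Set.Icc 0 b)) (hX : X ∈ matricesIn n 0 b)
    (h0 : (phi φ₁ φ₂ X * (X * star X - star X * X)).trace.re = 0) : IsStarNormal X := by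
  obtain ⟨F₁, hF₁⟩ := exists_potential h₁ m₁ (m := 2)
  obtain ⟨F₂, hF₂⟩ := exists_potential h₂ m₂ (m := 2)
  have h0' := trace_phi_mul_sub_eq (φ₁ := φ₁) (φ₂ := φ₂) X 1 F₁ F₂
  simp only [pow_one, h0, mul_one] at h0'
  set s := (isHermitian_abs X).eigenvalues with hs
  have hmem : ∀ i, s i ∈ Set.Icc 0 b := fun i =>
    hX ((isHermitian_abs X).eigenvalues_mem_spectrum_real i)
  have hnn : ∀ i j, 0 ≤ overlap (isHermitian_abs X) (isHermitian_abs (star X)) i j *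
      ((φ₁ (s i) * (s i ^ 2 - s j ^ 2) - (F₁ (s i) - F₁ (s j))) +
      (φ₂ (s j) * (s j ^ 2 - s i ^ 2) - (F₂ (s j) - F₂ (s i)))) := fun i j =>
    mul_nonneg (overlap_nonneg _ _ _ _) (add_nonneg
      (sub_nonneg.2 (hF₁ _ _ (hmem i).1 (hmem j).1))
      (sub_nonneg.2 (hF₂ _ _ (hmem j).1 (hmem i).1)))
  have hall : ∀ i j, s i = s j ∨ inEigenbases (isHermitian_abs X) (isHermitian_abs (star X)) 1 i j
      = 0 := by
    intro i j
    have hsum := neg_eq_zero.1 h0'.symm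
    have h3 := (Finset.sum_eq_zero_iff_of_nonneg
      fun i _ => Finset.sum_nonneg fun j _ => hnn i j).1 hsum i (Finset.mem_univ i)
    have h4 := (Finset.sum_eq_zero_iff_of_nonneg fun j _ => hnn i j).1 h3 j (Finset.mem_univ j)
    rcases mul_eq_zero.1 h4 with h5 | h5
    · right
      exact norm_eq_zero.1 (pow_eq_zero_iff two_ne_zero |>.1 h5)
    · left
      have h6 := sub_nonneg.2 (hF₁ _ _ (hmem i).1 (hmem j).1)
      have h7 := sub_nonneg.2 (hF₂ _ _ (hmem j).1 (hmem i).1)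
      have h8 : φ₁ (s i) * (s i ^ 2 - s j ^ 2) - (F₁ (s i) - F₁ (s j)) = 0 := by linarith
      have h9 : φ₂ (s j) * (s j ^ 2 - s i ^ 2) - (F₂ (s j) - F₂ (s i)) = 0 := by linarith
      have hconst : ∀ z w, ((s i < z ∧ z < s j) ∨ (s j < z ∧ z < s i)) →
          ((s i < w ∧ w < s j) ∨ (s j < w ∧ w < s i)) → φ₁ z + φ₂ z = φ₁ w + φ₂ w := by
        intro z w hz hw
        rw [const_of_potential m₁ hF₁ (hmem i).1 (hmem j).1 h8 hz,
          const_of_potential m₁ hF₁ (hmem i).1 (hmem j).1 h8 hw,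
          const_of_potential m₂ hF₂ (hmem j).1 (hmem i).1 h9 hz.symm,
          const_of_potential m₂ hF₂ (hmem j).1 (hmem i).1 h9 hw.symm]
      have hni := hmem i
      have hnj := hmem j
      by_contra hne
      rcases lt_or_gt_of_ne hne with hlt | hlt
      · obtain ⟨z, hz1, hz2⟩ := exists_between hlt
        obtain ⟨w, hw1, hw2⟩ := exists_between hz2
        have := hstrict (a := z) (b := w) ⟨by linarith [hni.1], by linarith [hnj.2]⟩
          ⟨by linarith [hni.1], by linarith [hnj.2]⟩ hw1
        exact this.ne (hconst z w (Or.inl ⟨hz1, hz2⟩) (Or.inl ⟨hz1.trans hw1, hw2⟩))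
      · obtain ⟨z, hz1, hz2⟩ := exists_between hlt
        obtain ⟨w, hw1, hw2⟩ := exists_between hz2
        have := hstrict (a := z) (b := w) ⟨by linarith [hnj.1], by linarith [hni.2]⟩
          ⟨by linarith [hnj.1], by linarith [hni.2]⟩ hw1
        exact this.ne (hconst z w (Or.inr ⟨hz1, hz2⟩) (Or.inr ⟨hz1.trans hw1, hw2⟩))
  have hzero : ∀ i j, inEigenbases (isHermitian_abs X) (isHermitian_abs (star X))
      (cfc (id : ℝ → ℝ) (CFC.abs X) * 1 - 1 * cfc (id : ℝ → ℝ) (CFC.abs (star X))) i j = 0 := by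
    intro i j
    rw [inEigenbases_commutator, eigenvalues_abs_star, ← hs]
    rcases hall i j with h | h
    · simp [h]
    · rw [h, mul_zero]
  have habs : CFC.abs X = CFC.abs (star X) := by
    have h1 : ‖cfc (id : ℝ → ℝ) (CFC.abs X) * 1 - 1 * cfc (id : ℝ → ℝ) (CFC.abs (star X))‖ = 0 := by
      rw [← norm_inEigenbases (isHermitian_abs X) (isHermitian_abs (star X)), norm_eq_zero]
      ext i j
      exact hzero i j
    rw [mul_one, one_mul, norm_eq_zero, sub_eq_zero, cfc_id ℝ _ (isHermitian_abs X).isSelfAdjoint,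
      cfc_id ℝ _ (isHermitian_abs (star X)).isSelfAdjoint] at h1
    exact h1
  refine ⟨?_⟩
  rw [Commute, SemiconjBy, ← CFC.abs_sq X, habs, abs_star_sq]

end Klein

/-! ### Global solutions of bounded Lipschitz equations; radial retraction. -/

section ODE

open Set Filter
open scoped NNReal

variable {E : Type*} [NormedAddCommGroup E] [NormedSpace ℝ E]

theorem exists_global_solution_of_lipschitz [CompleteSpace E] {v : E → E} {K L : ℝ≥0}
    (hv : LipschitzWith K v) (hb : ∀ x, ‖v x‖ ≤ L) (x₀ : E) :
    ∃ α : ℝ → E, α 0 = x₀ ∧ ∀ t, HasDerivAt α (v (α t)) t := by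
  have hloc : ∀ N : ℕ, ∃ α : ℝ → E, α 0 = x₀ ∧
      ∀ t ∈ Ioo (-(N + 1 : ℝ)) (N + 1), HasDerivAt α (v (α t)) t := by
    intro N
    have hpos : (0 : ℝ) ≤ N + 1 := by positivity
    -- Speed at most L over time N + 1 cannot leave the ball of radius L(N + 1), so Picard–Lindelöf
    -- applies to the whole interval without shrinking it.
    have hpl : IsPicardLindelof (fun _ => v) (tmin := -(N + 1 : ℝ)) (tmax := N + 1)
        ⟨0, neg_nonpos.2 hpos, hpos⟩ x₀ (L * (N + 1)) 0 L K :=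
      IsPicardLindelof.of_time_independent (fun x _ => hb x) hv.lipschitzOnWith (by simp)
    obtain ⟨α, h0, hα⟩ := hpl.exists_eq_forall_mem_Icc_hasDerivWithinAt₀
    exact ⟨α, h0, fun t ht => (hα t (Ioo_subset_Icc_self ht)).hasDerivAt (Icc_mem_nhds ht.1 ht.2)⟩
  choose α h0 hα using hloc
  have hagree : ∀ M N : ℕ, M ≤ N → EqOn (α M) (α N) (Ioo (-(M + 1 : ℝ)) (M + 1)) := by
    intro M N hMN
    have hMN' : (M : ℝ) ≤ N := by exact_mod_cast hMN
    have hM : (0 : ℝ) ≤ M := by positivity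
    refine ODE_solution_unique_of_mem_Ioo (v := fun _ => v) (s := fun _ => univ) (K := K)
      (t₀ := 0) (fun t _ => hv.lipschitzOnWith) ⟨by linarith, by linarith⟩
      (fun t ht => ⟨hα M t ht, mem_univ _⟩)
      (fun t ht => ⟨hα N t ⟨by linarith [ht.1], by linarith [ht.2]⟩, mem_univ _⟩) ?_
    rw [h0, h0]
  refine ⟨fun t => α ⌈|t|⌉₊ t, by simp [h0], fun t => ?_⟩
  set N := ⌈|t|⌉₊ + 1 with hN
  have hceil : ∀ s : ℝ, s ∈ Ioo (-((⌈|s|⌉₊ : ℝ) + 1)) (⌈|s|⌉₊ + 1) := by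
    intro s
    have h1 := Nat.le_ceil |s|
    have h2 := abs_le.1 h1
    exact ⟨by linarith [h2.1], by linarith [h2.2]⟩
  have hmem : t ∈ Ioo (-(N : ℝ)) N := by
    rw [hN]; push_cast; exact hceil t
  have heq : (fun s => α ⌈|s|⌉₊ s) =ᶠ[𝓝 t] α N := by
    filter_upwards [Ioo_mem_nhds hmem.1 hmem.2] with s hs
    refine hagree _ _ (Nat.ceil_le.2 (abs_le.2 ⟨hs.1.le, hs.2.le⟩)) (hceil s)
  have h1 := hα N t ⟨by linarith [hmem.1], by linarith [hmem.2]⟩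
  have h2 := h1.congr_of_eventuallyEq heq
  rwa [← heq.eq_of_nhds] at h2

theorem eqOn_Ici_of_lipschitz {v : E → E} {K : ℝ≥0} (hv : LipschitzWith K v) {f g : ℝ → E}
    (hf : ∀ t, 0 ≤ t → HasDerivWithinAt f (v (f t)) (Ici 0) t)
    (hg : ∀ t, 0 ≤ t → HasDerivWithinAt g (v (g t)) (Ici 0) t) (h0 : f 0 = g 0) :
    EqOn f g (Ici 0) := by
  intro t ht
  refine ODE_solution_unique_of_mem_Icc_right (v := fun _ => v) (s := fun _ => univ) (K := K)
    (a := 0) (b := t) (fun t _ => hv.lipschitzOnWith)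
    (fun s hs => ((hf s hs.1).continuousWithinAt).mono Icc_subset_Ici_self)
    (fun s hs => (hf s hs.1).mono (Ici_subset_Ici.2 hs.1)) (fun _ _ => mem_univ _)
    (fun s hs => ((hg s hs.1).continuousWithinAt).mono Icc_subset_Ici_self)
    (fun s hs => (hg s hs.1).mono (Ici_subset_Ici.2 hs.1)) (fun _ _ => mem_univ _) h0 ⟨ht, le_rfl⟩

/-- The radial retraction onto the closed ball of radius `R`. -/
def retract (R : ℝ) (x : E) : E := (R / max R ‖x‖) • x

lemma retract_of_norm_le {R : ℝ} (hR : 0 < R) {x : E} (hx : ‖x‖ ≤ R) : retract R x = x := by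
  rw [retract, max_eq_left hx, div_self hR.ne', one_smul]

lemma norm_retract_le {R : ℝ} (hR : 0 < R) (x : E) : ‖retract R x‖ ≤ R := by
  have hm : 0 < max R ‖x‖ := lt_max_of_lt_left hR
  rw [retract, norm_smul, Real.norm_of_nonneg (by positivity), div_mul_eq_mul_div, div_le_iff₀ hm]
  exact mul_le_mul_of_nonneg_left (le_max_right _ _) hR.le

lemma norm_retract_sub_le {R : ℝ} (hR : 0 < R) (x y : E) :
    ‖retract R x - retract R y‖ ≤ 2 * ‖x - y‖ := by
  have hx : 0 < max R ‖x‖ := lt_max_of_lt_left hR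
  have hy : 0 < max R ‖y‖ := lt_max_of_lt_left hR
  have h1 : retract R x - retract R y =
      (R / max R ‖x‖) • (x - y) + (R / max R ‖x‖ - R / max R ‖y‖) • y := by
    simp only [retract, smul_sub, sub_smul]; abel
  have h2 : R / max R ‖x‖ ≤ 1 := (div_le_one hx).2 (le_max_left _ _)
  have h3 : ‖y‖ / max R ‖y‖ ≤ 1 := (div_le_one hy).2 (le_max_right _ _)
  have h4 : |max R ‖y‖ - max R ‖x‖| ≤ ‖x - y‖ := by
    rw [max_comm R, max_comm R]
    refine (abs_max_sub_max_le_abs ‖y‖ ‖x‖ R).trans ?_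
    rw [abs_sub_comm]
    exact abs_norm_sub_norm_le x y
  have h5 : R / max R ‖x‖ - R / max R ‖y‖ =
      (R / max R ‖x‖) * ((max R ‖y‖ - max R ‖x‖) / max R ‖y‖) := by
    field_simp
  rw [h1]
  refine (norm_add_le _ _).trans ?_
  rw [norm_smul, norm_smul, Real.norm_of_nonneg (by positivity), h5, Real.norm_eq_abs, abs_mul,
    abs_div _ (max R ‖y‖), abs_of_pos hy, abs_of_nonneg (by positivity : 0 ≤ R / max R ‖x‖)]
  have h6 : |max R ‖y‖ - max R ‖x‖| / max R ‖y‖ * ‖y‖ ≤ ‖x - y‖ := by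
    rw [div_mul_eq_mul_div, mul_div_assoc]
    exact (mul_le_of_le_one_right (abs_nonneg _) h3).trans h4
  have h7 : 0 ≤ R / max R ‖x‖ := by positivity
  have h8 : 0 ≤ |max R ‖y‖ - max R ‖x‖| / max R ‖y‖ * ‖y‖ := by positivity
  nlinarith [norm_nonneg (x - y)]

end ODE

/-! ### Extension of φ₁ and φ₂ from [0,b] to the line. -/

section Extension

/-- Extension of a function on `[0,b]` by constants. -/
def constExtend (b : ℝ) (φ : ℝ → ℝ) (x : ℝ) : ℝ := φ (max 0 (min x b))

variable {b : ℝ} {φ : ℝ → ℝ}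

lemma max_min_mem (hb : 0 ≤ b) (x : ℝ) : max 0 (min x b) ∈ Set.Icc 0 b :=
  ⟨le_max_left _ _, max_le hb (min_le_right _ _)⟩

lemma constExtend_eqOn : Set.EqOn (constExtend b φ) φ (Set.Icc 0 b) := fun x hx => by
  rw [constExtend, min_eq_left hx.2, max_eq_right hx.1]

lemma continuous_constExtend (hb : 0 ≤ b) (h : ContinuousOn φ (Set.Icc 0 b)) :
    Continuous (constExtend b φ) :=
  h.comp_continuous (by fun_prop) (max_min_mem hb)

lemma monotone_constExtend (hb : 0 ≤ b) (h : MonotoneOn φ (Set.Icc 0 b)) :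
    Monotone (constExtend b φ) := fun x y hxy =>
  h (max_min_mem hb x) (max_min_mem hb y) (max_le_max le_rfl (min_le_min hxy le_rfl))

lemma abs_constExtend_sub_le (hb : 0 ≤ b) {K : NNReal} (h : LipschitzOnWith K φ (Set.Icc 0 b))
    (x y : ℝ) : |constExtend b φ x - constExtend b φ y| ≤ K * |x - y| := by
  have h1 := h.dist_le_mul _ (max_min_mem hb x) _ (max_min_mem hb y)
  rw [Real.dist_eq, Real.dist_eq] at h1
  refine h1.trans (mul_le_mul_of_nonneg_left ?_ K.2)
  have h2 := abs_max_sub_max_le_abs (min x b) (min y b) 0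
  rw [max_comm _ 0, max_comm _ 0] at h2
  refine h2.trans ?_
  have h3 := abs_min_sub_min_le_max x b y b
  simpa using h3

lemma exists_abs_constExtend_le (hb : 0 ≤ b) (h : MonotoneOn φ (Set.Icc 0 b)) :
    ∃ c, 0 ≤ c ∧ ∀ x, |constExtend b φ x| ≤ c := by
  refine ⟨max |φ 0| |φ b|, by positivity, fun x => ?_⟩
  have h1 := max_min_mem hb x
  exact abs_le_max_abs_abs (h ⟨le_rfl, hb⟩ h1 h1.1) (h h1 ⟨hb, le_rfl⟩ h1.2)

end Extension

/-! ### Traces of powers of X*X and the singular values they control. -/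

section Powers

open Matrix
open scoped Matrix.Norms.Frobenius

variable {n : ℕ}

lemma hasDerivAt_trace_re {Y : ℝ → Matrix (Fin n) (Fin n) ℂ} {Y' : Matrix (Fin n) (Fin n) ℂ}
    {t : ℝ} (h : HasDerivAt Y Y' t) : HasDerivAt (fun t => (Y t).trace.re) Y'.trace.re t := by
  have h1 : ∀ i j, HasDerivAt (fun t => Y t i j) (Y' i j) t := fun i j =>
    hasDerivAt_pi.1 (hasDerivAt_pi.1 h i) j
  have h2 : HasDerivAt (fun t => (Y t).trace) Y'.trace t := by
    simp only [Matrix.trace, Matrix.diag]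
    exact HasDerivAt.fun_sum fun i _ => h1 i i
  exact (Complex.reCLM.hasFDerivAt.comp_hasDerivAt t h2)

lemma hasDerivAt_trace_pow {Y : ℝ → Matrix (Fin n) (Fin n) ℂ} {Y' : Matrix (Fin n) (Fin n) ℂ}
    {t : ℝ} (h : HasDerivAt Y Y' t) (p : ℕ) :
    HasDerivAt (fun t => ((Y t) ^ (p + 1)).trace.re) ((p + 1) * (Y t ^ p * Y').trace.re) t := by
  have h1 := hasDerivAt_trace_re (HasDerivAt.fun_pow' h (p + 1))
  have h2 : ∀ i ∈ Finset.range (p + 1), (Y t ^ ((p + 1).pred - i) * Y' * Y t ^ i).trace =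
      (Y t ^ p * Y').trace := by
    intro i hi
    rw [Matrix.trace_mul_comm, ← mul_assoc, ← pow_add]
    congr 3
    have := Finset.mem_range.1 hi
    simp only [Nat.pred_eq_sub_one]
    omega
  rw [trace_sum, Finset.sum_congr rfl h2, Finset.sum_const, Finset.card_range, nsmul_eq_mul] at h1
  have h3 : (((p + 1 : ℕ) : ℂ) * (Y t ^ p * Y').trace).re = (p + 1) * (Y t ^ p * Y').trace.re := by
    have : ((p + 1 : ℕ) : ℂ) = ((p + 1 : ℝ) : ℂ) := by push_cast; rfl
    rw [this, Complex.re_ofReal_mul]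
  rw [h3] at h1
  exact h1

lemma mul_pow_mul_star (X : Matrix (Fin n) (Fin n) ℂ) (p : ℕ) :
    X * (star X * X) ^ p * star X = (X * star X) ^ (p + 1) := by
  induction p with
  | zero => simp
  | succ p ih => rw [pow_succ (X * star X), ← ih, pow_succ]; noncomm_ring

/-- Cyclicity of the trace reduces the derivative to four terms, equal in pairs. The scalar c
accommodates the retracted vector field, which is a rescaled commutator. -/
lemma hasDerivAt_trace_abs_pow {X : ℝ → Matrix (Fin n) (Fin n) ℂ}
    {φ : Matrix (Fin n) (Fin n) ℂ} (hφ : IsSelfAdjoint φ) {c t : ℝ}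
    (h : HasDerivAt X (c • (φ * X t - X t * φ)) t) (p : ℕ) :
    HasDerivAt (fun t => ((star (X t) * X t) ^ (p + 1)).trace.re)
      (2 * (p + 1) * c * (φ * ((X t * star (X t)) ^ (p + 1) -
        (star (X t) * X t) ^ (p + 1))).trace.re) t := by
  have h1 := hasDerivAt_trace_pow (Y := fun t => star (X t) * X t) (h.star.mul h) p
  have h2 : (star (X t) * X t) ^ p * (star (c • (φ * X t - X t * φ)) * X t +
      star (X t) * (c • (φ * X t - X t * φ))) =
      c • (((star (X t) * X t) ^ p * (star (X t) * φ)) * X t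
        - ((star (X t) * X t) ^ p) * (φ * (star (X t) * X t)) +
        ((star (X t) * X t) ^ p * (star (X t) * φ)) * X t -
        ((star (X t) * X t) ^ p * (star (X t) * X t)) * φ) := by
    simp only [star_smul, star_sub, star_mul, hφ.star_eq, star_trivial, smul_mul_assoc,
      mul_smul_comm, ← smul_add]
    congr 1
    noncomm_ring
  have h3 : (((star (X t) * X t) ^ p * (star (X t) * φ)) * X t).trace =
      (φ * (X t * star (X t)) ^ (p + 1)).trace := by
    rw [← mul_pow_mul_star, Matrix.trace_mul_comm, ← mul_assoc, ← mul_assoc,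
      Matrix.trace_mul_comm]
  have h4 : (((star (X t) * X t) ^ p) * (φ * (star (X t) * X t))).trace =
      (φ * (star (X t) * X t) ^ (p + 1)).trace := by
    rw [Matrix.trace_mul_comm, mul_assoc, ← pow_succ']
  have h5 : (((star (X t) * X t) ^ p * (star (X t) * X t)) * φ).trace =
      (φ * (star (X t) * X t) ^ (p + 1)).trace := by
    rw [Matrix.trace_mul_comm, ← pow_succ]
  convert h1 using 1
  rw [h2, trace_smul, trace_sub, trace_add, trace_sub, h3, h4, h5, mul_sub, trace_sub,
    Complex.real_smul, Complex.re_ofReal_mul]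
  simp only [Complex.sub_re, Complex.add_re]
  ring

lemma trace_abs_pow (X : Matrix (Fin n) (Fin n) ℂ) (p : ℕ) :
    ((star X * X) ^ p).trace.re = ∑ i, (isHermitian_abs X).eigenvalues i ^ (2 * p) := by
  have e2 : (star X * X) ^ p = cfc (fun x : ℝ => x ^ (2 * p)) (CFC.abs X) := by
    rw [cfc_pow_id (R := ℝ) (CFC.abs X) (2 * p) (isHermitian_abs X).isSelfAdjoint, pow_mul,
      CFC.abs_sq]
  rw [e2, trace_cfc (isHermitian_abs X), Complex.ofReal_re]

lemma norm_sq_eq_trace (X : Matrix (Fin n) (Fin n) ℂ) : ‖X‖ ^ 2 = (star X * X).trace.re := by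
  rw [trace_star_mul_self, Complex.ofReal_re]

/-- If s > b > 0, the powers of s/b outgrow any constant C; hence dimension factors in trace bounds
do no harm. -/
lemma le_of_forall_pow_le {s b : ℝ} (hb : 0 ≤ b) {C : ℝ}
    (h : ∀ p : ℕ, s ^ (2 * (p + 1)) ≤ C * b ^ (2 * (p + 1))) : s ≤ b := by
  by_contra! hlt
  rcases hb.eq_or_lt with rfl | hb
  · have := h 0
    simp at this
    nlinarith
  · have h1 : 1 < s / b := (one_lt_div hb).2 hlt
    obtain ⟨p, hp⟩ := pow_unbounded_of_one_lt C h1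
    have h2 := h p
    have h3 : (s / b) ^ (2 * (p + 1)) ≤ C := by
      rw [div_pow, div_le_iff₀ (by positivity)]
      exact h2
    have h4 : (s / b) ^ p ≤ (s / b) ^ (2 * (p + 1)) := pow_le_pow_right₀ h1.le (by omega)
    linarith

lemma trace_abs_pow_le {X : Matrix (Fin n) (Fin n) ℂ} {b : ℝ} (hX : X ∈ matricesIn n 0 b)
    (p : ℕ) : ((star X * X) ^ p).trace.re ≤ n * b ^ (2 * p) := by
  rw [trace_abs_pow]
  calc ∑ i, (isHermitian_abs X).eigenvalues i ^ (2 * p) ≤ ∑ _i : Fin n, b ^ (2 * p) := by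
        refine Finset.sum_le_sum fun i _ => ?_
        have := hX ((isHermitian_abs X).eigenvalues_mem_spectrum_real i)
        exact pow_le_pow_left₀ this.1 this.2 _
    _ = n * b ^ (2 * p) := by simp

lemma mem_matricesIn_of_trace_le {X : Matrix (Fin n) (Fin n) ℂ} {b C : ℝ} (hb : 0 ≤ b)
    (h : ∀ p : ℕ, ((star X * X) ^ (p + 1)).trace.re ≤ C * b ^ (2 * (p + 1))) :
    X ∈ matricesIn n 0 b := by
  intro x hx
  refine ⟨spectrum_abs_nonneg X hx, ?_⟩
  rw [(isHermitian_abs X).spectrum_real_eq_range_eigenvalues] at hx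
  obtain ⟨i, rfl⟩ := hx
  refine le_of_forall_pow_le hb fun p => le_trans ?_ (h p)
  rw [trace_abs_pow]
  exact Finset.single_le_sum (f := fun i => (isHermitian_abs X).eigenvalues i ^ (2 * (p + 1)))
    (fun j _ => pow_nonneg (eigenvalues_abs_nonneg X j) _) (Finset.mem_univ i)

lemma norm_le_of_mem_matricesIn {X : Matrix (Fin n) (Fin n) ℂ} {b : ℝ} (hb : 0 ≤ b)
    (hX : X ∈ matricesIn n 0 b) : ‖X‖ ≤ n * b := by
  refine le_of_sq_le_sq ?_ (by positivity)
  have h := trace_abs_pow_le hX 1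
  rw [pow_one, mul_one] at h
  rw [norm_sq_eq_trace, mul_pow]
  have hn : (n : ℝ) ≤ (n : ℝ) ^ 2 := by
    exact_mod_cast Nat.le_self_pow two_ne_zero n
  nlinarith [sq_nonneg b]

lemma star_mem_matricesIn {X : Matrix (Fin n) (Fin n) ℂ} {b : ℝ} (hX : X ∈ matricesIn n 0 b) :
    star X ∈ matricesIn n 0 b := by
  intro x hx
  rw [(isHermitian_abs (star X)).spectrum_real_eq_range_eigenvalues, eigenvalues_abs_star,
    ← (isHermitian_abs X).spectrum_real_eq_range_eigenvalues] at hx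
  exact hX hx

lemma phi_constExtend {X : Matrix (Fin n) (Fin n) ℂ} {b : ℝ} (hX : X ∈ matricesIn n 0 b)
    (φ₁ φ₂ : ℝ → ℝ) : phi (constExtend b φ₁) (constExtend b φ₂) X = phi φ₁ φ₂ X :=
  phi_congr (constExtend_eqOn.mono hX) (constExtend_eqOn.mono (star_mem_matricesIn hX))

end Powers

/-! ### Existence, uniqueness and invariance of M_n[0,b]. -/

section Flow

open Matrix Set Filter
open scoped Matrix.Norms.Frobenius NNReal

variable {n : ℕ}

lemma commutator_smul (φ X : Matrix (Fin n) (Fin n) ℂ) (c : ℝ) :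
    φ * (c • X) - (c • X) * φ = c • (φ * X - X * φ) := by
  rw [mul_smul_comm, smul_mul_assoc, smul_sub]

lemma norm_commutator_le {E : Type*} [NormedRing E] (a b : E) :
    ‖a * b - b * a‖ ≤ 2 * ‖a‖ * ‖b‖ := by
  have h1 := norm_mul_le a b
  have h2 := norm_mul_le b a
  have h3 := norm_sub_le (a * b) (b * a)
  linarith

theorem exists_flow {b : ℝ} (hb : 0 ≤ b) {φ₁ φ₂ : ℝ → ℝ} (hφ : CondCL 0 b φ₁ φ₂)
    {T : Matrix (Fin n) (Fin n) ℂ} (hT : T ∈ matricesIn n 0 b) :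
    ∃ X : ℝ → Matrix (Fin n) (Fin n) ℂ, IsGlobalSolution 0 b φ₁ φ₂ T X ∧
      (∀ X' : ℝ → Matrix (Fin n) (Fin n) ℂ, IsGlobalSolution 0 b φ₁ φ₂ T X' →
        EqOn X' X (Ici 0)) ∧
      (∀ t, 0 ≤ t → HasDerivAt X (phi (constExtend b φ₁) (constExtend b φ₂) (X t) * X t -
        X t * phi (constExtend b φ₁) (constExtend b φ₂) (X t)) t) ∧
      Antitone (fun t => (star (X t) * X t).trace.re) := by
  obtain ⟨K₁, hK₁⟩ := hφ.lipschitz₁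
  obtain ⟨K₂, hK₂⟩ := hφ.lipschitz₂
  obtain ⟨c₁, hc₁, hb₁⟩ := exists_abs_constExtend_le hb hφ.monotoneOn₁
  obtain ⟨c₂, hc₂, hb₂⟩ := exists_abs_constExtend_le hb hφ.monotoneOn₂
  set ψ := phi (n := n) (constExtend b φ₁) (constExtend b φ₂) with hψ
  set L : ℝ := max K₁ K₂ with hL
  have hL0 : 0 ≤ L := le_max_of_le_left K₁.2
  set c := max c₁ c₂ with hc
  have hc0 : 0 ≤ c := le_max_of_le_left hc₁
  have hlip : ∀ X Y, ‖ψ X - ψ Y‖ ≤ 4 * L * ‖X - Y‖ := norm_phi_sub_le hL0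
    (fun x y => (abs_constExtend_sub_le hb hK₁ x y).trans
      (mul_le_mul_of_nonneg_right (le_max_left _ _) (abs_nonneg _)))
    (fun x y => (abs_constExtend_sub_le hb hK₂ x y).trans
      (mul_le_mul_of_nonneg_right (le_max_right _ _) (abs_nonneg _)))
  set C : ℝ := 2 * c * ‖(1 : Matrix (Fin n) (Fin n) ℂ)‖ with hC
  have hC0 : 0 ≤ C := by positivity
  have hbd : ∀ X, ‖ψ X‖ ≤ C := norm_phi_le hc0 (fun x => (hb₁ x).trans (le_max_left _ _))
    (fun x => (hb₂ x).trans (le_max_right _ _))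
  -- Matrices in M_n[0,b] have Frobenius norm at most n b, so the retraction to radius R acts
  -- trivially on them while making the field globally bounded and Lipschitz.
  set R : ℝ := n * b + 1 with hR
  have hR0 : 0 < R := by positivity
  set v : Matrix (Fin n) (Fin n) ℂ → Matrix (Fin n) (Fin n) ℂ :=
    fun X => ψ X * retract R X - retract R X * ψ X with hv
  have hvb : ∀ X, ‖v X‖ ≤ (2 * C * R).toNNReal := fun X => by
    rw [Real.coe_toNNReal _ (by positivity)]
    refine (norm_commutator_le _ _).trans ?_
    have := hbd X
    have := norm_retract_le hR0 X
    gcongr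
  have hvl : LipschitzWith (2 * (4 * L * R + 2 * C)).toNNReal v := by
    refine LipschitzWith.of_dist_le_mul fun X Y => ?_
    rw [Real.coe_toNNReal _ (by positivity), dist_eq_norm, dist_eq_norm]
    have : v X - v Y = ((ψ X - ψ Y) * retract R X - retract R X * (ψ X - ψ Y)) +
        (ψ Y * (retract R X - retract R Y) - (retract R X - retract R Y) * ψ Y) := by
      simp only [hv]; noncomm_ring
    rw [this]
    refine (norm_add_le _ _).trans ((add_le_add (norm_commutator_le _ _)
      (norm_commutator_le _ _)).trans ?_)
    have h1 : 2 * ‖ψ X - ψ Y‖ * ‖retract R X‖ ≤ 2 * (4 * L * ‖X - Y‖) * R := by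
      have := hlip X Y
      have := norm_retract_le hR0 X
      gcongr
    have h2 : 2 * ‖ψ Y‖ * ‖retract R X - retract R Y‖ ≤ 2 * C * (2 * ‖X - Y‖) := by
      have := hbd Y
      have := norm_retract_sub_le hR0 X Y
      gcongr
    linarith
  obtain ⟨X, hX0, hX⟩ := exists_global_solution_of_lipschitz hvl hvb T
  have hder : ∀ t, HasDerivAt X ((R / max R ‖X t‖) • (ψ (X t) * X t - X t * ψ (X t))) t := by
    intro t
    have h := hX t
    simp only [hv, retract] at h
    rw [commutator_smul] at h
    exact h
  have hpos : ∀ t, 0 ≤ R / max R ‖X t‖ := fun t => by positivity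
  -- The retraction multiplies the commutator by a nonnegative scalar, which preserves the sign in
  -- Klein's inequality. Monotonicity for all p then confines the singular values to [0,b], where
  -- the modified and original fields agree.
  have hanti : ∀ p : ℕ, Antitone (fun t => ((star (X t) * X t) ^ (p + 1)).trace.re) := by
    intro p
    refine antitone_of_hasDerivAt_nonpos
      (fun t => hasDerivAt_trace_abs_pow (isSelfAdjoint_phi _ _ (X t)) (hder t) p) fun t => ?_
    refine mul_nonpos_of_nonneg_of_nonpos (mul_nonneg (by positivity) (hpos t)) ?_
    exact trace_phi_mul_sub_nonpos (X t) (continuous_constExtend hb hφ.continuousOn₁)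
      (continuous_constExtend hb hφ.continuousOn₂) (monotone_constExtend hb hφ.monotoneOn₁)
      (monotone_constExtend hb hφ.monotoneOn₂) (p + 1)
  have hmem : ∀ t, 0 ≤ t → X t ∈ matricesIn n 0 b := by
    intro t ht
    refine mem_matricesIn_of_trace_le hb (C := n) fun p => (hanti p ht).trans ?_
    simp only [hX0]
    exact trace_abs_pow_le hT (p + 1)
  have hin : ∀ Z ∈ matricesIn n 0 b, v Z = phi φ₁ φ₂ Z * Z - Z * phi φ₁ φ₂ Z := by
    intro Z hZ
    simp only [hv]
    rw [retract_of_norm_le hR0 ((norm_le_of_mem_matricesIn hb hZ).trans (by linarith)), hψ,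
      phi_constExtend hZ]
  refine ⟨X, ⟨hX0, hmem, fun t ht => ?_⟩, fun X' hX' => ?_, fun t ht => ?_, ?_⟩
  · rw [← hin _ (hmem t ht)]
    exact (hX t).hasDerivWithinAt
  · refine eqOn_Ici_of_lipschitz hvl (fun t ht => ?_) (fun t _ => (hX t).hasDerivWithinAt) ?_
    · rw [hin _ (hX'.mem t ht)]
      exact hX'.deriv t ht
    · rw [hX'.initial, hX0]
  · have h := hX t
    rw [hin _ (hmem t ht), ← phi_constExtend (hmem t ht)] at h
    exact h
  · simpa using hanti 0

end Flow

/-! ### Barbalat's argument. -/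

section Barbalat

open Filter Set

/-- If h were below -ε at a late time, its Lipschitz bound would keep it below -ε/2 for a further
time τ, so u would drop by a fixed amount; convergence of u forbids this. -/
theorem tendsto_deriv_zero_of_antitone {u h : ℝ → ℝ} (hu : Antitone u) (hbdd : ∀ t, 0 ≤ u t)
    (hd : ∀ t, 0 ≤ t → HasDerivAt u (h t) t) (hneg : ∀ t, 0 ≤ t → h t ≤ 0) {M : ℝ} (hM : 0 ≤ M)
    (hlip : ∀ s t, 0 ≤ s → 0 ≤ t → |h s - h t| ≤ M * |s - t|) : Tendsto h atTop (𝓝 0) := by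
  have hlim : Tendsto u atTop (𝓝 (⨅ t, u t)) :=
    tendsto_atTop_ciInf hu ⟨0, by rintro _ ⟨t, rfl⟩; exact hbdd t⟩
  rw [Metric.tendsto_atTop]
  intro ε hε
  set τ := ε / (2 * (M + 1)) with hτ
  have hτ0 : 0 < τ := by positivity
  have hMτ : M * τ ≤ ε / 2 := by
    rw [hτ, mul_div_assoc', div_le_div_iff₀ (by positivity) (by positivity)]
    nlinarith
  have hdiff : Tendsto (fun t => u t - u (t + τ)) atTop (𝓝 0) := by
    have := hlim.sub (hlim.comp (tendsto_atTop_add_const_right atTop τ tendsto_id))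
    simpa using this
  obtain ⟨N, hN⟩ := ((hdiff.eventually (gt_mem_nhds
    (by positivity : (0 : ℝ) < ε / 2 * τ))).and (eventually_ge_atTop 0)).exists_forall_of_atTop
  refine ⟨N, fun t ht => ?_⟩
  obtain ⟨h1, h0⟩ := hN t ht
  rw [Real.dist_eq, sub_zero, abs_of_nonpos (hneg t h0)]
  by_contra! hcon
  obtain ⟨ξ, hξ, hξ'⟩ := exists_hasDerivAt_eq_slope u h (by linarith : t < t + τ)
    (fun s hs => (hd s (h0.trans hs.1)).continuousAt.continuousWithinAt)
    (fun s hs => hd s (h0.trans hs.1.le))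
  have h2 := hlip ξ t (h0.trans hξ.1.le) h0
  rw [abs_of_nonneg (by linarith [hξ.1] : 0 ≤ ξ - t)] at h2
  have h3 : M * (ξ - t) ≤ M * τ := mul_le_mul_of_nonneg_left (by linarith [hξ.2]) hM
  have h4 := (abs_le.1 h2).2
  have h5 : h ξ ≤ -(ε / 2) := by linarith
  rw [hξ', add_sub_cancel_left, div_le_iff₀ hτ0] at h5
  linarith

end Barbalat

/-! ### Limit points of the flow are normal. -/

section LaSalle

open Matrix Set Filter
open scoped Matrix.Norms.Frobenius

variable {n : ℕ}

lemma abs_trace_re_le (M : Matrix (Fin n) (Fin n) ℂ) : |M.trace.re| ≤ n * ‖M‖ := by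
  refine (Complex.abs_re_le_norm _).trans ?_
  rw [Matrix.trace]
  refine (norm_sum_le _ _).trans ?_
  calc ∑ i, ‖M.diag i‖ ≤ ∑ _i : Fin n, ‖M‖ := Finset.sum_le_sum fun i _ => entry_norm_le M i i
    _ = n * ‖M‖ := by simp

theorem tendsto_trace_phi_of_flow {b : ℝ} (hb : 0 ≤ b) {φ₁ φ₂ : ℝ → ℝ} (hφ : CondCL 0 b φ₁ φ₂)
    {X : ℝ → Matrix (Fin n) (Fin n) ℂ} (hmem : ∀ t, 0 ≤ t → X t ∈ matricesIn n 0 b)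
    (hX : ∀ t, 0 ≤ t → HasDerivAt X (phi (constExtend b φ₁) (constExtend b φ₂) (X t) * X t -
        X t * phi (constExtend b φ₁) (constExtend b φ₂) (X t)) t)
    (hanti : Antitone (fun t => (star (X t) * X t).trace.re)) :
    Tendsto (fun t => (phi (constExtend b φ₁) (constExtend b φ₂) (X t) *
      (X t * star (X t) - star (X t) * X t)).trace.re) atTop (𝓝 0) := by
  obtain ⟨K₁, hK₁⟩ := hφ.lipschitz₁
  obtain ⟨K₂, hK₂⟩ := hφ.lipschitz₂
  obtain ⟨c₁, hc₁, hb₁⟩ := exists_abs_constExtend_le hb hφ.monotoneOn₁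
  obtain ⟨c₂, hc₂, hb₂⟩ := exists_abs_constExtend_le hb hφ.monotoneOn₂
  set ψ := phi (n := n) (constExtend b φ₁) (constExtend b φ₂) with hψ
  set L : ℝ := max K₁ K₂ with hL
  have hL0 : 0 ≤ L := le_max_of_le_left K₁.2
  set c := max c₁ c₂ with hc
  have hc0 : 0 ≤ c := le_max_of_le_left hc₁
  have hlip : ∀ X Y, ‖ψ X - ψ Y‖ ≤ 4 * L * ‖X - Y‖ := norm_phi_sub_le hL0
    (fun x y => (abs_constExtend_sub_le hb hK₁ x y).trans
      (mul_le_mul_of_nonneg_right (le_max_left _ _) (abs_nonneg _)))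
    (fun x y => (abs_constExtend_sub_le hb hK₂ x y).trans
      (mul_le_mul_of_nonneg_right (le_max_right _ _) (abs_nonneg _)))
  set C : ℝ := 2 * c * ‖(1 : Matrix (Fin n) (Fin n) ℂ)‖ with hC
  have hC0 : 0 ≤ C := by positivity
  have hbd : ∀ X, ‖ψ X‖ ≤ C := norm_phi_le hc0 (fun x => (hb₁ x).trans (le_max_left _ _))
    (fun x => (hb₂ x).trans (le_max_right _ _))
  set R : ℝ := n * b with hR
  have hR0 : 0 ≤ R := by positivity
  have hXR : ∀ t, 0 ≤ t → ‖X t‖ ≤ R := fun t ht => norm_le_of_mem_matricesIn hb (hmem t ht)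
  have hXlip : ∀ s t, 0 ≤ s → 0 ≤ t → ‖X s - X t‖ ≤ 2 * C * R * |s - t| := by
    intro s t hs ht
    refine Convex.norm_image_sub_le_of_norm_hasDerivWithin_le (s := Ici 0)
      (fun r hr => (hX r hr).hasDerivWithinAt) (fun r hr => ?_) (convex_Ici 0) ht hs
    refine (norm_commutator_le _ _).trans ?_
    have := hbd (X r)
    have := hXR r hr
    gcongr
  set Q : Matrix (Fin n) (Fin n) ℂ → Matrix (Fin n) (Fin n) ℂ :=
    fun Z => Z * star Z - star Z * Z with hQ
  have hQb : ∀ Z, ‖Z‖ ≤ R → ‖Q Z‖ ≤ 2 * R * R := by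
    intro Z hZ
    refine (norm_commutator_le _ _).trans ?_
    rw [norm_star]
    gcongr
  have hQl : ∀ Z W, ‖Z‖ ≤ R → ‖W‖ ≤ R → ‖Q Z - Q W‖ ≤ 4 * R * ‖Z - W‖ := by
    intro Z W hZ hW
    have : Q Z - Q W = (Z * star (Z - W) - star (Z - W) * Z) +
        ((Z - W) * star W - star W * (Z - W)) := by
      simp only [hQ, star_sub]; noncomm_ring
    rw [this]
    refine (norm_add_le _ _).trans ((add_le_add (norm_commutator_le _ _)
      (norm_commutator_le _ _)).trans ?_)
    rw [norm_star, norm_star]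
    have h1 : 2 * ‖Z‖ * ‖Z - W‖ ≤ 2 * R * ‖Z - W‖ := by gcongr
    have h2 : 2 * ‖Z - W‖ * ‖W‖ ≤ 2 * ‖Z - W‖ * R := by gcongr
    linarith
  have hdu : ∀ t, 0 ≤ t → HasDerivAt (fun t => (star (X t) * X t).trace.re)
      (2 * (ψ (X t) * Q (X t)).trace.re) t := by
    intro t ht
    have h := hasDerivAt_trace_abs_pow (c := 1) (isSelfAdjoint_phi (constExtend b φ₁)
      (constExtend b φ₂) (X t)) (by rw [one_smul]; exact hX t ht) 0
    simpa using h
  have hneg : ∀ t, (ψ (X t) * Q (X t)).trace.re ≤ 0 := by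
    intro t
    have := trace_phi_mul_sub_nonpos (X t) (continuous_constExtend hb hφ.continuousOn₁)
      (continuous_constExtend hb hφ.continuousOn₂) (monotone_constExtend hb hφ.monotoneOn₁)
      (monotone_constExtend hb hφ.monotoneOn₂) 1
    simpa using this
  have hfin := tendsto_deriv_zero_of_antitone hanti
    (fun t => by rw [← norm_sq_eq_trace]; positivity) hdu
    (fun t _ => by linarith [hneg t])
    (M := 2 * (n * ((4 * L * (2 * R * R) + C * (4 * R)) * (2 * C * R)))) (by positivity) ?_
  · have := hfin.const_mul (1 / 2 : ℝ)
    simp only [← mul_assoc] at this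
    norm_num at this
    exact this
  · intro s t hs ht
    rw [← mul_sub, abs_mul, abs_of_pos (two_pos : (0 : ℝ) < 2), mul_assoc 2, ← Complex.sub_re,
      ← trace_sub]
    refine mul_le_mul_of_nonneg_left ((abs_trace_re_le _).trans ?_) two_pos.le
    rw [mul_assoc]
    refine mul_le_mul_of_nonneg_left ?_ (by positivity)
    have : ψ (X s) * Q (X s) - ψ (X t) * Q (X t) =
        (ψ (X s) - ψ (X t)) * Q (X s) + ψ (X t) * (Q (X s) - Q (X t)) := by noncomm_ring
    rw [this]
    have e1 : ‖(ψ (X s) - ψ (X t)) * Q (X s)‖ ≤ 4 * L * ‖X s - X t‖ * (2 * R * R) := by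
      refine (norm_mul_le _ _).trans ?_
      have := hlip (X s) (X t)
      have := hQb _ (hXR s hs)
      gcongr
    have e2 : ‖ψ (X t) * (Q (X s) - Q (X t))‖ ≤ C * (4 * R * ‖X s - X t‖) := by
      refine (norm_mul_le _ _).trans ?_
      have := hbd (X t)
      have := hQl _ _ (hXR s hs) (hXR t ht)
      gcongr
    have e3 := hXlip s t hs ht
    have e4 : (4 * L * (2 * R * R) + C * (4 * R)) * ‖X s - X t‖ ≤
        (4 * L * (2 * R * R) + C * (4 * R)) * (2 * C * R * |s - t|) := by gcongr
    refine (norm_add_le _ _).trans ?_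
    linarith

lemma continuous_aeval_matrix (q : Polynomial ℂ) :
    Continuous fun Z : Matrix (Fin n) (Fin n) ℂ => Polynomial.aeval Z q :=
  Polynomial.continuous_aeval q

lemma isClosed_matricesIn {b : ℝ} (hb : 0 ≤ b) : IsClosed (matricesIn n 0 b) := by
  have : matricesIn n 0 b = ⋂ p : ℕ, {Z | ((star Z * Z) ^ (p + 1)).trace.re ≤
      n * b ^ (2 * (p + 1))} := by
    ext Z
    simp only [mem_iInter, mem_ofPred_eq]
    exact ⟨fun h p => trace_abs_pow_le h (p + 1), fun h => mem_matricesIn_of_trace_le hb h⟩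
  rw [this]
  refine isClosed_iInter fun p => isClosed_le ?_ continuous_const
  exact Complex.continuous_re.comp (Continuous.matrix_trace (by fun_prop))

/-- A LaSalle principle for observables that are constant on the candidate limit set. Along each
ultrafilter the flow has a limit Z in the compact set M_n[0,b]; Z is normal by the equality case and
satisfies q(Z) = 0. Convergence of X itself is not needed. -/
theorem tendsto_of_forall_normal {b : ℝ} (hb : 0 ≤ b) {φ₁ φ₂ : ℝ → ℝ} (hφ : CondCL 0 b φ₁ φ₂)
    {X : ℝ → Matrix (Fin n) (Fin n) ℂ} (hmem : ∀ t, 0 ≤ t → X t ∈ matricesIn n 0 b)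
    (hlim : Tendsto (fun t => (phi (constExtend b φ₁) (constExtend b φ₂) (X t) *
      (X t * star (X t) - star (X t) * X t)).trace.re) atTop (𝓝 0))
    {q : Polynomial ℂ} (hq : ∀ t, 0 ≤ t → Polynomial.aeval (X t) q = 0)
    {F : Type*} [TopologicalSpace F] {Ψ : Matrix (Fin n) (Fin n) ℂ → F} (hΨ : Continuous Ψ) {c : F}
    (hc : ∀ Z, IsStarNormal Z → Polynomial.aeval Z q = 0 → Ψ Z = c) :
    Tendsto (fun t => Ψ (X t)) atTop (𝓝 c) := by
  obtain ⟨K₁, hK₁⟩ := hφ.lipschitz₁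
  obtain ⟨K₂, hK₂⟩ := hφ.lipschitz₂
  set ψ := phi (n := n) (constExtend b φ₁) (constExtend b φ₂) with hψ
  set L : ℝ := max K₁ K₂ with hL
  have hL0 : 0 ≤ L := le_max_of_le_left K₁.2
  have hlip : ∀ X Y, ‖ψ X - ψ Y‖ ≤ 4 * L * ‖X - Y‖ := norm_phi_sub_le hL0
    (fun x y => (abs_constExtend_sub_le hb hK₁ x y).trans
      (mul_le_mul_of_nonneg_right (le_max_left _ _) (abs_nonneg _)))
    (fun x y => (abs_constExtend_sub_le hb hK₂ x y).trans
      (mul_le_mul_of_nonneg_right (le_max_right _ _) (abs_nonneg _)))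
  have hψc : Continuous ψ := by
    refine (LipschitzWith.of_dist_le_mul (K := (4 * L).toNNReal) fun X Y => ?_).continuous
    rw [Real.coe_toNNReal _ (by positivity), dist_eq_norm, dist_eq_norm]
    exact hlip X Y
  have hDc : Continuous fun Z : Matrix (Fin n) (Fin n) ℂ =>
      (ψ Z * (Z * star Z - star Z * Z)).trace.re :=
    Complex.continuous_re.comp (Continuous.matrix_trace (by fun_prop))
  have hcomp : IsCompact (matricesIn n 0 b) := by
    refine Metric.isCompact_of_isClosed_isBounded (isClosed_matricesIn hb) ?_
    exact (Metric.isBounded_closedBall (x := 0) (r := n * b)).subset fun Z hZ => by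
      rw [mem_closedBall_zero_iff]
      exact norm_le_of_mem_matricesIn hb hZ
  rw [tendsto_iff_ultrafilter]
  intro g hg
  have hg0 : ∀ᶠ t in (g : Filter ℝ), 0 ≤ t := hg (eventually_ge_atTop 0)
  obtain ⟨Z, hZ, hgZ⟩ := hcomp.ultrafilter_le_nhds (g.map X)
    (by rw [le_principal_iff, Ultrafilter.mem_coe, Ultrafilter.mem_map]
        exact hg0.mono hmem)
  have hXZ : Tendsto X g (𝓝 Z) := hgZ
  have h1 : (ψ Z * (Z * star Z - star Z * Z)).trace.re = 0 :=
    tendsto_nhds_unique ((hDc.tendsto Z).comp hXZ) (hlim.mono_left hg)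
  have h2 : Polynomial.aeval Z q = 0 := by
    refine tendsto_nhds_unique (((continuous_aeval_matrix q).tendsto Z).comp hXZ)
      (tendsto_const_nhds.congr' ?_)
    exact hg0.mono fun t ht => (hq t ht).symm
  have h3 : IsStarNormal Z := by
    refine isStarNormal_of_trace_phi_mul_sub_eq_zero Z (continuous_constExtend hb hφ.continuousOn₁)
      (continuous_constExtend hb hφ.continuousOn₂) (monotone_constExtend hb hφ.monotoneOn₁)
      (monotone_constExtend hb hφ.monotoneOn₂) (hφ.strictMonoOn_add.congr fun x hx => ?_) hZ h1
    simp only [constExtend_eqOn hx]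
  rw [← hc Z h3 h2]
  exact (hΨ.tendsto Z).comp hXZ

end LaSalle

/-! ### Isospectrality, Riesz idempotents and eigenvalue bounds. -/

section Isospectral

open Matrix Set Filter Polynomial
open scoped Matrix.Norms.Frobenius NNReal

variable {n : ℕ}

/-- Commutation with φ is a derivation, so polynomials in X obey the same Lax equation. This serves
both for q(X) = 0 and for the evolution of the idempotents. -/
lemma hasDerivAt_aeval_commutator {X : ℝ → Matrix (Fin n) (Fin n) ℂ}
    {φ : Matrix (Fin n) (Fin n) ℂ} {t : ℝ} (h : HasDerivAt X (φ * X t - X t * φ) t) (q : ℂ[X]) :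
    HasDerivAt (fun t => aeval (X t) q) (φ * aeval (X t) q - aeval (X t) q * φ) t := by
  have hpow : ∀ k : ℕ, HasDerivAt (fun t => X t ^ k) (φ * X t ^ k - X t ^ k * φ) t := by
    intro k
    induction k with
    | zero =>
      simp only [pow_zero, mul_one, one_mul, sub_self]
      exact hasDerivAt_const t (1 : Matrix (Fin n) (Fin n) ℂ)
    | succ k ih =>
      have h1 := HasDerivAt.mul ih h
      have h2 : (φ * X t ^ k - X t ^ k * φ) * X t + X t ^ k * (φ * X t - X t * φ) =
          φ * X t ^ (k + 1) - X t ^ (k + 1) * φ := by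
        rw [pow_succ]; noncomm_ring
      rw [h2] at h1
      exact h1
  induction q using Polynomial.induction_on' with
  | add p q hp hq =>
    have h1 := HasDerivAt.add hp hq
    have h2 : φ * aeval (X t) p - aeval (X t) p * φ + (φ * aeval (X t) q - aeval (X t) q * φ) =
        φ * aeval (X t) (p + q) - aeval (X t) (p + q) * φ := by
      rw [map_add]; noncomm_ring
    rw [h2] at h1
    simp only [map_add]
    simp only [map_add] at h1
    exact h1
  | monomial k a =>
    have h1 := HasDerivAt.const_mul (algebraMap ℂ (Matrix (Fin n) (Fin n) ℂ) a) (hpow k)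
    have h2 : (algebraMap ℂ (Matrix (Fin n) (Fin n) ℂ) a) * (φ * X t ^ k - X t ^ k * φ) =
        φ * aeval (X t) (monomial k a) - aeval (X t) (monomial k a) * φ := by
      rw [aeval_monomial, mul_sub, ← mul_assoc, ← mul_assoc, Algebra.commutes a φ,
        mul_assoc, mul_assoc]
    rw [h2] at h1
    simp only [aeval_monomial] at h1 ⊢
    exact h1

lemma eq_zero_of_commutator_ode {E : Type*} [NormedRing E] [NormedSpace ℝ E] {M φ : ℝ → E} {C : ℝ}
    (hφ : ∀ t, 0 ≤ t → ‖φ t‖ ≤ C)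
    (hM : ∀ t, 0 ≤ t → HasDerivAt M (φ t * M t - M t * φ t) t) (h0 : M 0 = 0) {t : ℝ}
    (ht : 0 ≤ t) : M t = 0 := by
  refine eq_zero_of_abs_deriv_le_mul_abs_self_of_eq_zero_right (K := 2 * C) (a := 0) (b := t)
    (fun s hs => (hM s hs.1).continuousAt.continuousWithinAt)
    (fun s hs => (hM s hs.1).hasDerivWithinAt) h0 (fun s hs => ?_) t ⟨ht, le_rfl⟩
  refine (norm_commutator_le _ _).trans ?_
  have := hφ s hs.1
  gcongr

lemma commute_aeval {R : Type*} [Ring R] [Algebra ℂ R] {W Z : R} (h : Commute W Z) (p : ℂ[X]) :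
    Commute W (aeval Z p) := by
  induction p using Polynomial.induction_on' with
  | add p q hp hq => rw [map_add]; exact hp.add_right hq
  | monomial k a =>
    rw [aeval_monomial]
    exact (Algebra.commute_algebraMap_right a W).mul_right (h.pow_right k)

lemma isStarNormal_aeval {Z : Matrix (Fin n) (Fin n) ℂ} (h : IsStarNormal Z) (p : ℂ[X]) :
    IsStarNormal (aeval Z p) := by
  refine ⟨?_⟩
  have h1 : Commute (star Z) (aeval Z p) := commute_aeval h.star_comm_self p
  have h2 : Commute (star (aeval Z p)) Z := by
    have := h1.star_star
    rw [star_star] at this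
    exact this.symm
  exact commute_aeval h2 p

lemma eq_zero_of_star_mul_self {Z : Matrix (Fin n) (Fin n) ℂ} (h : star Z * Z = 0) : Z = 0 := by
  have h1 := norm_sq_eq_trace Z
  rw [h] at h1
  simpa using h1

/-- Normality gives (P - P*P)*(P - P*P) = 0, so P = P*P is visibly self-adjoint. -/
lemma isSelfAdjoint_of_normal_idempotent {P : Matrix (Fin n) (Fin n) ℂ} (h : IsStarNormal P)
    (hP : P * P = P) : star P = P := by
  have hc : star P * P = P * star P := h.star_comm_self.eq
  have hP' : star P * star P = star P := by rw [← star_mul, hP]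
  have h1 : star (P - star P * P) * (P - star P * P) = 0 := by
    have e1 : star P * (star P * P) = star P * P := by rw [← mul_assoc, hP']
    have e2 : star P * P * P = star P * P := by rw [mul_assoc, hP]
    have e3 : star P * P * (star P * P) = star P * P := by
      rw [mul_assoc, ← mul_assoc P, ← hc, mul_assoc, hP, e1]
    rw [star_sub, star_mul, star_star, sub_mul, mul_sub, mul_sub, e1, e2, e3]
    simp
  have h2 := sub_eq_zero.1 (eq_zero_of_star_mul_self h1)
  rw [h2, star_mul, star_star]

lemma eq_zero_of_isSelfAdjoint_pow {H : Matrix (Fin n) (Fin n) ℂ} (h : IsSelfAdjoint H) (k : ℕ)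
    (hk : H ^ (2 ^ k) = 0) : H = 0 := by
  induction k with
  | zero => simpa using hk
  | succ k ih =>
    refine ih (eq_zero_of_star_mul_self ?_)
    rw [star_pow, h.star_eq, ← pow_add, ← two_mul, ← pow_succ', hk]

lemma eq_zero_of_normal_nilpotent {N : Matrix (Fin n) (Fin n) ℂ} (h : IsStarNormal N) {k : ℕ}
    (hN : N ^ k = 0) : N = 0 := by
  refine eq_zero_of_star_mul_self
    (eq_zero_of_isSelfAdjoint_pow (IsSelfAdjoint.star_mul_self N) k ?_)
  have h1 : (star N * N) ^ k = 0 := by rw [h.star_comm_self.mul_pow, hN, mul_zero]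
  exact pow_eq_zero_of_le Nat.lt_two_pow_self.le h1

/-- Polynomials whose values at a matrix with the same spectrum as `T` are the Riesz projections. -/
theorem exists_spectral_polynomials (T : Matrix (Fin n) (Fin n) ℂ) :
    ∃ (s : Finset ℂ) (q : ℂ[X]) (p : s → ℂ[X]), (∀ l ∈ s, T.charpoly.IsRoot l) ∧ aeval T q = 0 ∧
      ∀ Z : Matrix (Fin n) (Fin n) ℂ, aeval Z q = 0 →
        (∀ i j, aeval Z (p i) * aeval Z (p j) = if i = j then aeval Z (p i) else 0) ∧
        ∑ i, aeval Z (p i) = 1 ∧ (Z - ∑ i : s, (i : ℂ) • aeval Z (p i)) ^ n = 0 := by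
  classical
  set s := T.charpoly.roots.toFinset with hs
  -- The exponent n dominates every root multiplicity, so the characteristic polynomial divides q,
  -- while factors for distinct roots stay coprime.
  set q : ℂ[X] := ∏ l ∈ s, (X - C l) ^ n with hq
  have hne : T.charpoly ≠ 0 := T.charpoly_monic.ne_zero
  have hcop : ∀ a b : ℂ, a ≠ b → IsCoprime ((X - C a) ^ n : ℂ[X]) ((X - C b) ^ n) := fun a b hab =>
    (Polynomial.isCoprime_X_sub_C_of_isUnit_sub (sub_ne_zero.2 hab).isUnit).pow
  have hT : aeval T q = 0 := by
    have hdvd : T.charpoly ∣ q := by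
      have hsplit := IsAlgClosed.splits T.charpoly
      rw [hsplit.eq_prod_roots_of_monic T.charpoly_monic, Finset.prod_multiset_map_count]
      refine Finset.prod_dvd_prod_of_dvd _ _ fun l _ => pow_dvd_pow _ ?_
      refine (Multiset.count_le_card _ _).trans ((Polynomial.card_roots' _).trans ?_)
      rw [T.charpoly_natDegree_eq_dim, Fintype.card_fin]
    obtain ⟨r, hr⟩ := hdvd
    rw [hr, map_mul, Matrix.aeval_self_charpoly, zero_mul]
  set I : s → Ideal ℂ[X] := fun i => Ideal.span {(X - C (i : ℂ)) ^ n} with hI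
  have hIcop : Pairwise (Function.onFun IsCoprime I) := fun i j hij => by
    rw [Function.onFun, hI, Ideal.isCoprime_span_singleton_iff]
    exact hcop _ _ fun h => hij (Subtype.ext h)
  -- Chinese remainder theorem: p i is 1 modulo the i-th factor and 0 modulo the others. Identities
  -- among the p i need checking only modulo each factor, since they then hold modulo q.
  choose p hp using fun i : s =>
    Ideal.exists_forall_sub_mem_ideal hIcop fun j => if j = i then (1 : ℂ[X]) else 0
  have hmk : ∀ i k : s, Ideal.Quotient.mk (I k) (p i) = if k = i then 1 else 0 := by
    intro i k
    have h1 := Ideal.Quotient.eq.2 (hp i k)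
    rw [h1]
    split_ifs <;> simp
  have hzero : ∀ f : ℂ[X], (∀ k : s, Ideal.Quotient.mk (I k) f = 0) →
      ∀ Z : Matrix (Fin n) (Fin n) ℂ, aeval Z q = 0 → aeval Z f = 0 := by
    intro f hf Z hZ
    have hdvd : q ∣ f := by
      refine Finset.prod_dvd_of_coprime (fun a _ b _ hab => hcop a b hab) fun l hl => ?_
      exact Ideal.mem_span_singleton.1 (Ideal.Quotient.eq_zero_iff_mem.1 (hf ⟨l, hl⟩))
    obtain ⟨r, hr⟩ := hdvd
    rw [hr, map_mul, hZ, zero_mul]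
  refine ⟨s, q, p, fun l hl => ?_, hT, fun Z hZ => ⟨fun i j => ?_, ?_, ?_⟩⟩
  · exact (Polynomial.mem_roots hne).1 (Multiset.mem_toFinset.1 hl)
  · have h1 := hzero (p i * p j - if i = j then p i else 0) (fun k => ?_) Z hZ
    · rw [map_sub, map_mul, sub_eq_zero] at h1
      rw [h1]
      split_ifs <;> simp
    · rw [map_sub, map_mul, hmk, hmk]
      by_cases hij : i = j
      · subst hij; simp only [hmk, if_true]; split_ifs <;> simp
      · by_cases hki : k = i
        · subst hki; simp [hij]
        · simp [hij, hki]
  · have h1 := hzero (∑ i, p i - 1) (fun k => ?_) Z hZ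
    · rw [map_sub, map_sum, map_one, sub_eq_zero] at h1
      exact h1
    · simp [hmk]
  · have h1 := hzero ((X - ∑ i : s, C (i : ℂ) * p i) ^ n) (fun k => ?_) Z hZ
    · simpa [map_pow, map_sub, map_sum, Algebra.smul_def] using h1
    · have h2 : Ideal.Quotient.mk (I k) ((X - C (k : ℂ)) ^ n) = 0 :=
        Ideal.Quotient.eq_zero_iff_mem.2 (Ideal.mem_span_singleton_self _)
      rw [← h2, map_pow, map_pow, map_sub, map_sub, map_sum]
      simp [hmk]

lemma norm_cfc_mul_le {m : Type*} [Fintype m] [DecidableEq m] {A : Matrix m m ℂ}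
    (hA : A.IsHermitian) (f : ℝ → ℝ) {c : ℝ} (hc : 0 ≤ c) (h : ∀ x ∈ spectrum ℝ A, |f x| ≤ c)
    (M : Matrix m m ℂ) : ‖cfc f A * M‖ ≤ c * ‖M‖ := by
  rw [← norm_inEigenbases hA hA, ← norm_inEigenbases hA hA M]
  refine norm_le_of_entry_le hc fun i j => ?_
  rw [inEigenbases_cfc_mul, norm_mul, Complex.norm_real]
  exact mul_le_mul_of_nonneg_right (h _ (hA.eigenvalues_mem_spectrum_real i)) (norm_nonneg _)

lemma norm_abs_mul (X M : Matrix (Fin n) (Fin n) ℂ) : ‖CFC.abs X * M‖ = ‖X * M‖ := by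
  have h : ‖CFC.abs X * M‖ ^ 2 = ‖X * M‖ ^ 2 := by
    rw [norm_sq_eq_trace, norm_sq_eq_trace, star_mul, star_mul,
      (isHermitian_abs X).isSelfAdjoint.star_eq, mul_assoc, ← mul_assoc (CFC.abs X), ← sq,
      CFC.abs_sq]
    simp only [mul_assoc]
  exact (pow_left_inj₀ (norm_nonneg _) (norm_nonneg _) two_ne_zero).1 h

lemma norm_root_charpoly_le {T : Matrix (Fin n) (Fin n) ℂ} {b : ℝ} (hb : 0 ≤ b)
    (hT : T ∈ matricesIn n 0 b) {l : ℂ} (hl : T.charpoly.IsRoot l) : ‖l‖ ≤ b := by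
  have h1 : Module.End.HasEigenvalue (Matrix.toLin' T) l := by
    rw [Module.End.hasEigenvalue_iff_isRoot_charpoly, Matrix.charpoly_toLin']
    exact hl
  obtain ⟨v, hv⟩ := h1.exists_hasEigenvector
  have hTv : T *ᵥ v = l • v := by
    have := hv.apply_eq_smul
    rwa [Matrix.toLin'_apply] at this
  -- Repeating the eigenvector as a square matrix lets the Frobenius estimates replace vector norms.
  set V : Matrix (Fin n) (Fin n) ℂ := Matrix.replicateCol (Fin n) v with hV
  have hV0 : V ≠ 0 := by
    intro h
    apply hv.2
    ext i
    exact congrFun (congrFun h i) i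
  have hTV : T * V = l • V := by
    ext i j
    have := congrFun hTv i
    rw [Matrix.mul_apply, Matrix.smul_apply]
    exact this
  have h2 : ‖CFC.abs T * V‖ ≤ b * ‖V‖ := by
    have := norm_cfc_mul_le (isHermitian_abs T) id hb
      (fun x hx => abs_le.2 ⟨by linarith [(hT hx).1, show id x = x from rfl], (hT hx).2⟩) V
    rwa [cfc_id ℝ _ (isHermitian_abs T).isSelfAdjoint] at this
  rw [norm_abs_mul, hTV, norm_smul] at h2
  exact le_of_mul_le_mul_right h2 (norm_pos_iff.2 hV0)

end Isospectral

set_option linter.unusedSectionVars false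

/-! ### Block multipliers for a family of idempotents. -/

section Resolution

variable {ι E : Type*} [Fintype ι] [DecidableEq ι] [NormedRing E] [NormedAlgebra ℂ E]

/-- A finite family of mutually orthogonal idempotents with sum one. -/
structure IsResolution (p : ι → E) : Prop where
  mul_eq : ∀ i j, p i * p j = if i = j then p i else 0
  sum_eq : ∑ i, p i = 1

/-- The linear combination of the idempotents with given coefficients. -/
def lin (p : ι → E) (u : ι → ℂ) : E := ∑ i, u i • p i

/-- The Schur multiplier with respect to a family of idempotents. -/
def blk (p : ι → E) (d : ι → ι → ℂ) (M : E) : E := ∑ i, ∑ k, d i k • (p i * M * p k)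

variable {p : ι → E}

lemma mul_blk_mul (hp : IsResolution p) (d : ι → ι → ℂ) (M : E) (i k : ι) :
    p i * blk p d M * p k = d i k • (p i * M * p k) := by
  have h : ∀ i' k', p i * (d i' k' • (p i' * M * p k')) * p k =
      if i = i' then (if k' = k then d i k • (p i * M * p k) else 0) else 0 := by
    intro i' k'
    rw [mul_smul_comm, smul_mul_assoc, ← mul_assoc, ← mul_assoc, hp.mul_eq, mul_assoc, hp.mul_eq]
    rcases eq_or_ne i i' with rfl | h1 <;> rcases eq_or_ne k' k with rfl | h2 <;> simp [*]
  simp only [blk, Finset.mul_sum, Finset.sum_mul, h]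
  rw [Finset.sum_eq_single i (fun x _ hx => by simp [hx.symm]) (by simp)]
  simp

/-- Block multipliers compose by multiplying coefficients. Left and right products with `lin` are
special cases, so first-order calculations become scalar identities in the indices. -/
lemma blk_blk (hp : IsResolution p) (d d' : ι → ι → ℂ) (M : E) :
    blk p d (blk p d' M) = blk p (fun i k => d i k * d' i k) M := by
  change ∑ i, ∑ k, d i k • (p i * blk p d' M * p k) = _
  simp only [mul_blk_mul hp, smul_smul]
  rfl

lemma lin_mul (hp : IsResolution p) (u : ι → ℂ) (M : E) :
    lin p u * M = blk p (fun i _ => u i) M := by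
  have : ∀ i, ∑ k, u i • (p i * M * p k) = u i • p i * M := by
    intro i
    rw [← Finset.smul_sum, ← Finset.mul_sum, hp.sum_eq, mul_one, smul_mul_assoc]
  simp only [blk, this, lin, Finset.sum_mul]

lemma mul_lin (hp : IsResolution p) (u : ι → ℂ) (M : E) :
    M * lin p u = blk p (fun _ k => u k) M := by
  rw [blk, Finset.sum_comm]
  have : ∀ k, ∑ i, u k • (p i * M * p k) = M * (u k • p k) := by
    intro k
    rw [← Finset.smul_sum, ← Finset.sum_mul, ← Finset.sum_mul, hp.sum_eq, one_mul, mul_smul_comm]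
  simp only [this, lin, Finset.mul_sum]

lemma lin_const (hp : IsResolution p) (c : ℂ) : lin p (fun _ => c) = algebraMap ℂ E c := by
  rw [lin, ← Finset.smul_sum, hp.sum_eq, Algebra.algebraMap_eq_smul_one]

lemma lin_single (j : ι) : lin p (Pi.single j 1) = p j := by
  rw [lin, Finset.sum_eq_single j] <;> simp +contextual

lemma lin_mul_lin (hp : IsResolution p) (u w : ι → ℂ) :
    lin p u * lin p w = lin p (fun i => u i * w i) := by
  rw [lin_mul hp, blk]
  conv_rhs => rw [lin]
  refine Finset.sum_congr rfl fun i _ => ?_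
  have : ∀ k, p i * lin p w * p k = if i = k then w i • p i else 0 := by
    intro k
    have h1 : p i * lin p w = w i • p i := by
      simp only [lin, Finset.mul_sum, mul_smul_comm, hp.mul_eq, smul_ite, smul_zero]
      simp
    rw [h1, smul_mul_assoc, hp.mul_eq, smul_ite, smul_zero]
  simp only [this, smul_ite, smul_zero, Finset.sum_ite_eq, Finset.mem_univ, if_true, smul_smul]

lemma blk_add_coeff (d d' : ι → ι → ℂ) (M : E) :
    blk p (fun i k => d i k + d' i k) M = blk p d M + blk p d' M := by
  simp only [blk, add_smul, Finset.sum_add_distrib]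

lemma blk_sub_coeff (d d' : ι → ι → ℂ) (M : E) :
    blk p (fun i k => d i k - d' i k) M = blk p d M - blk p d' M := by
  simp only [blk, sub_smul, Finset.sum_sub_distrib]

lemma blk_sub (d : ι → ι → ℂ) (M N : E) : blk p d (M - N) = blk p d M - blk p d N := by
  simp only [blk, mul_sub, sub_mul, smul_sub, Finset.sum_sub_distrib]

lemma commutator_idempotent (hp : IsResolution p) (M : E) (j : ι) :
    M * p j - p j * M =
      blk p (fun i k => (Pi.single j 1 : ι → ℂ) k - (Pi.single j 1 : ι → ℂ) i) M := by
  rw [blk_sub_coeff, ← mul_lin hp, ← lin_mul hp, lin_single]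

end Resolution

/-! ### First-order perturbation of polynomial functional calculus. -/

section Asymptotics

open Asymptotics Filter Polynomial

variable {τ ι E : Type*} [Fintype ι] [DecidableEq ι] [NormedRing E] [NormedAlgebra ℂ E]
  {l : Filter τ} {κ : τ → ℝ}

lemma littleO_mul {f g : τ → E} (hf : f =o[l] fun _ => (1 : ℝ)) (hg : g =O[l] κ) :
    (fun t => f t * g t) =o[l] κ := by
  simpa using hf.mul_isBigO hg

lemma mul_littleO {f g : τ → E} (hf : f =O[l] κ) (hg : g =o[l] fun _ => (1 : ℝ)) :
    (fun t => f t * g t) =o[l] κ := by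
  simpa using hf.mul_isLittleO hg

lemma bigO_mul_littleO {f g : τ → E} (hf : f =O[l] fun _ => (1 : ℝ)) (hg : g =o[l] κ) :
    (fun t => f t * g t) =o[l] κ := by
  simpa using hf.mul_isLittleO hg

lemma littleO_mul_bigO {f g : τ → E} (hf : f =o[l] κ) (hg : g =O[l] fun _ => (1 : ℝ)) :
    (fun t => f t * g t) =o[l] κ := by
  simpa using hf.mul_isBigO hg

lemma bigO_mul {f g : τ → E} (hf : f =O[l] fun _ => (1 : ℝ)) (hg : g =O[l] κ) :
    (fun t => f t * g t) =O[l] κ := by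
  simpa using hf.mul hg

lemma mul_bigO {f g : τ → E} (hf : f =O[l] κ) (hg : g =O[l] fun _ => (1 : ℝ)) :
    (fun t => f t * g t) =O[l] κ := by
  simpa using hf.mul hg

variable {P : ι → τ → E}

lemma lin_isBigO (hP : ∀ i, P i =O[l] fun _ => (1 : ℝ)) (u : ι → ℂ) :
    (fun t => lin (P · t) u) =O[l] fun _ => (1 : ℝ) :=
  (IsBigO.sum (s := Finset.univ) fun i _ => (hP i).const_smul_left (u i)).congr_left
    fun t => by simp [lin]

lemma blk_isBigO (hP : ∀ i, P i =O[l] fun _ => (1 : ℝ)) (d : ι → ι → ℂ) {M : τ → E}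
    (hM : M =O[l] κ) : (fun t => blk (P · t) d (M t)) =O[l] κ :=
  (IsBigO.sum (s := Finset.univ) fun i _ => IsBigO.sum (s := Finset.univ) fun k _ =>
    (mul_bigO (bigO_mul (hP i) hM) (hP k)).const_smul_left (d i k)).congr_left
    fun t => by simp [blk]

lemma blk_isLittleO (hP : ∀ i, P i =O[l] fun _ => (1 : ℝ)) (d : ι → ι → ℂ) {M : τ → E}
    (hM : M =o[l] κ) : (fun t => blk (P · t) d (M t)) =o[l] κ :=
  (IsLittleO.sum (s := Finset.univ) fun i _ => IsLittleO.sum (s := Finset.univ) fun k _ =>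
    (littleO_mul_bigO (bigO_mul_littleO (hP i) hM) (hP k)).const_smul_left (d i k)).congr_left
    fun t => by simp [blk]

/-- The divided difference of a polynomial. -/
def divDiff (q : ℂ[X]) (x y : ℂ) : ℂ :=
  if x = y then q.derivative.eval x else (q.eval x - q.eval y) / (x - y)

lemma divDiff_add (q r : ℂ[X]) (x y : ℂ) : divDiff (q + r) x y = divDiff q x y + divDiff r x y := by
  unfold divDiff
  split_ifs
  · simp
  · simp only [eval_add]; ring

lemma divDiff_C (c x y : ℂ) : divDiff (C c) x y = 0 := by
  unfold divDiff
  split_ifs <;> simp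

/-- This Leibniz rule mirrors [q(A)A, M] = q(A)[A, M] + [q(A), M]A and drives the induction on
degree. -/
lemma divDiff_mul_X (q : ℂ[X]) (x y : ℂ) :
    divDiff (q * X) x y = q.eval x + divDiff q x y * y := by
  unfold divDiff
  split_ifs with h
  · subst h; simp [add_comm]
  · have : x - y ≠ 0 := sub_ne_zero.2 h
    simp only [eval_mul, eval_X]
    field_simp
    ring

variable {A : τ → E} {a : ι → ℂ}

lemma isBigO_one_of_near (hP : ∀ i, P i =O[l] fun _ => (1 : ℝ))
    (hA : (fun t => A t - lin (P · t) a) =o[l] fun _ => (1 : ℝ)) : A =O[l] fun _ => (1 : ℝ) := by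
  have := hA.isBigO.add (lin_isBigO hP a)
  simpa using this

lemma aeval_near (hres : ∀ t, IsResolution (P · t)) (hP : ∀ i, P i =O[l] fun _ => (1 : ℝ))
    (hA : (fun t => A t - lin (P · t) a) =o[l] fun _ => (1 : ℝ)) (q : ℂ[X]) :
    (fun t => aeval (A t) q - lin (P · t) (fun i => q.eval (a i))) =o[l] fun _ => (1 : ℝ) := by
  induction q using Polynomial.induction_on with
  | C c =>
    have : (fun t => aeval (A t) (C c) - lin (P · t) (fun i => (C c).eval (a i))) = fun _ => 0 := by
      funext t
      simp only [eval_C, aeval_C, lin_const (hres t), sub_self]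
    rw [this]
    exact isLittleO_zero _ _
  | add p q hp hq =>
    refine (hp.add hq).congr_left fun t => ?_
    simp only [map_add, eval_add, lin, add_smul, Finset.sum_add_distrib]
    abel
  | monomial k c ih =>
    have h1 := littleO_mul_bigO ih (isBigO_one_of_near hP hA)
    have h2 := bigO_mul_littleO (lin_isBigO hP fun i => (C c * X ^ k : ℂ[X]).eval (a i)) hA
    refine (h1.add h2).congr_left fun t => ?_
    rw [pow_succ, ← mul_assoc, map_mul (aeval (A t)) (C c * X ^ k) X, aeval_X, mul_sub,
      lin_mul_lin (hres t), sub_mul]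
    simp only [eval_mul, eval_X]
    abel

/-- If A were exactly Σ a_i P_i, the divided-difference formula for [q(A), M] would be exact. Each
use of A near that combination costs o(1) times a commutator of size O(κ), hence o(κ). -/
theorem aeval_commutator_near (hres : ∀ t, IsResolution (P · t))
    (hP : ∀ i, P i =O[l] fun _ => (1 : ℝ))
    (hA : (fun t => A t - lin (P · t) a) =o[l] fun _ => (1 : ℝ)) {M : τ → E}
    (hM : (fun t => A t * M t - M t * A t) =O[l] κ) (q : ℂ[X]) :
    (fun t => aeval (A t) q * M t - M t * aeval (A t) q -
      blk (P · t) (fun i k => divDiff q (a i) (a k)) (A t * M t - M t * A t)) =o[l] κ := by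
  induction q using Polynomial.induction_on with
  | C c =>
    refine (isLittleO_zero _ _).congr_left fun t => ?_
    simp only [aeval_C, divDiff_C, blk, zero_smul, Finset.sum_const_zero, sub_zero]
    rw [Algebra.commutes, sub_self]
  | add p q hp hq =>
    refine (hp.add hq).congr_left fun t => ?_
    simp only [map_add, divDiff_add, blk_add_coeff, add_mul, mul_add]
    abel
  | monomial k c ih =>
    set r : ℂ[X] := C c * X ^ k
    have h1 := littleO_mul (aeval_near hres hP hA r) hM
    have h2 := littleO_mul_bigO ih (isBigO_one_of_near hP hA)
    have h3 := mul_littleO (blk_isBigO hP (fun i k => divDiff r (a i) (a k)) hM) hA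
    refine ((h1.add h2).add h3).congr_left fun t => ?_
    have e1 : blk (P · t) (fun i k => divDiff (r * X) (a i) (a k)) (A t * M t - M t * A t) =
        lin (P · t) (fun i => r.eval (a i)) * (A t * M t - M t * A t) +
        blk (P · t) (fun i k => divDiff r (a i) (a k)) (A t * M t - M t * A t) *
          lin (P · t) a := by
      rw [lin_mul (hres t), mul_lin (hres t), blk_blk (hres t), ← blk_add_coeff]
      congr 1
      funext i k
      rw [divDiff_mul_X, mul_comm (a k)]
    rw [pow_succ, ← mul_assoc, e1, map_mul (aeval (A t)) _ X, aeval_X]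
    noncomm_ring

end Asymptotics

set_option linter.unusedSectionVars false

/-! ### Families approaching normal elements; control of small singular values. -/

section NearNormal

open Asymptotics Filter Polynomial

variable {τ ι E : Type*} [Fintype ι] [DecidableEq ι] [NormedRing E] [NormedAlgebra ℂ E]
  [StarRing E] [NormedStarGroup E] [StarModule ℂ E]

/-- A family of elements that approaches the set of normal elements with eigenvalues `lam`, with
spectral idempotents `P`; the function `κ` measures how far these are from being self-adjoint. -/
structure NearNormal (l : Filter τ) (lam : ι → ℂ) (X : τ → E) (P : ι → τ → E) (κ : τ → ℝ) :
    Prop where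
  res : ∀ t, IsResolution (P · t)
  comm : ∀ t i, X t * P i t = P i t * X t
  bdd : ∀ i, P i =O[l] fun _ => (1 : ℝ)
  near : (fun t => X t - lin (P · t) lam) =o[l] fun _ => (1 : ℝ)
  sa : ∀ i, (fun t => star (P i t) - P i t) =O[l] κ
  small : κ =o[l] fun _ => (1 : ℝ)

variable {l : Filter τ} {lam : ι → ℂ} {X : τ → E} {P : ι → τ → E} {κ : τ → ℝ}

lemma star_lin (p : ι → E) (u : ι → ℂ) : star (lin p u) = lin (fun i => star (p i)) (star u) := by
  simp [lin, star_sum, star_smul]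

lemma lin_sub_lin (p p' : ι → E) (u : ι → ℂ) : lin p u - lin p' u = lin (fun i => p i - p' i) u := by
  simp [lin, smul_sub]

lemma lin_isBigO' {p : ι → τ → E} (hp : ∀ i, p i =O[l] κ) (u : ι → ℂ) :
    (fun t => lin (p · t) u) =O[l] κ :=
  (IsBigO.sum (s := Finset.univ) fun i _ => (hp i).const_smul_left (u i)).congr_left
    fun t => by simp [lin]

lemma isBigO_star {f : τ → E} {g : τ → ℝ} (hf : f =O[l] g) : (fun t => star (f t)) =O[l] g :=
  hf.norm_left.congr_left (fun t => (norm_star (f t)).symm) |>.of_norm_left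

lemma isLittleO_star {f : τ → E} {g : τ → ℝ} (hf : f =o[l] g) : (fun t => star (f t)) =o[l] g :=
  hf.norm_left.congr_left (fun t => (norm_star (f t)).symm) |>.of_norm_left

namespace NearNormal

variable (h : NearNormal l lam X P κ)
include h

lemma bddX : X =O[l] fun _ => (1 : ℝ) := isBigO_one_of_near h.bdd h.near

lemma sa_small (i : ι) : (fun t => star (P i t) - P i t) =o[l] fun _ => (1 : ℝ) :=
  (h.sa i).trans_isLittleO h.small

lemma lin_sa (u : ι → ℂ) : (fun t => star (lin (P · t) u) - lin (P · t) (star u)) =O[l] κ := by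
  simp only [star_lin, lin_sub_lin]
  exact lin_isBigO' h.sa _

lemma star_near : (fun t => star (X t) - lin (P · t) (star lam)) =o[l] fun _ => (1 : ℝ) := by
  refine ((isLittleO_star h.near).add ((h.lin_sa lam).trans_isLittleO h.small)).congr_left
    fun t => ?_
  rw [star_sub]; abel

lemma star : NearNormal l (star lam) (fun t => star (X t)) (fun i t => star (P i t)) κ where
  res t := ⟨fun i j => by
      rw [← star_mul, (h.res t).mul_eq]
      by_cases hij : i = j
      · simp [hij]
      · simp [hij, Ne.symm hij], by rw [← star_sum, (h.res t).sum_eq, star_one]⟩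
  comm t i := by rw [← star_mul, ← star_mul, h.comm]
  bdd i := isBigO_star (h.bdd i)
  near := (isLittleO_star h.near).congr_left fun t => by rw [star_sub, star_lin]
  sa i := (isBigO_star (h.sa i)).congr_left fun t => by rw [star_sub]
  small := h.small

lemma abs_sq_near : (fun t => Star.star (X t) * X t -
    lin (P · t) (fun i => ((‖lam i‖ ^ 2 : ℝ) : ℂ))) =o[l] fun _ => (1 : ℝ) := by
  have h1 := littleO_mul_bigO h.star_near h.bddX
  have h2 := bigO_mul_littleO (lin_isBigO h.bdd (Star.star lam)) h.near
  refine (h1.add h2).congr_left fun t => ?_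
  have h3 : lin (P · t) (Star.star lam) * lin (P · t) lam =
      lin (P · t) (fun i => ((‖lam i‖ ^ 2 : ℝ) : ℂ)) := by
    rw [lin_mul_lin (h.res t)]
    congr 1
    funext i
    rw [Pi.star_apply, Complex.star_def, ← Complex.normSq_eq_conj_mul_self,
      Complex.normSq_eq_norm_sq]
  rw [← h3]
  noncomm_ring

/-- X* commutes with P_j*, so its commutator with P_j sees only the difference P_j* - P_j. -/
lemma star_commutator (j : ι) (t : τ) : Star.star (X t) * P j t - P j t * Star.star (X t) =
    (Star.star (P j t) - P j t) * Star.star (X t) -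
      Star.star (X t) * (Star.star (P j t) - P j t) := by
  have h1 := h.star.comm t j
  rw [sub_mul, mul_sub, h1]
  abel

lemma star_commutator_isBigO (j : ι) :
    (fun t => Star.star (X t) * P j t - P j t * Star.star (X t)) =O[l] κ := by
  simp only [h.star_commutator]
  exact (mul_bigO (h.sa j) (isBigO_star h.bddX)).sub (bigO_mul (isBigO_star h.bddX) (h.sa j))

lemma abs_sq_commutator (j : ι) (t : τ) :
    Star.star (X t) * X t * P j t - P j t * (Star.star (X t) * X t) =
      (Star.star (X t) * P j t - P j t * Star.star (X t)) * X t := by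
  rw [mul_assoc, h.comm, sub_mul, mul_assoc, mul_assoc]

lemma abs_sq_commutator_isBigO (j : ι) :
    (fun t => Star.star (X t) * X t * P j t - P j t * (Star.star (X t) * X t)) =O[l] κ := by
  simp only [h.abs_sq_commutator]
  exact mul_bigO (h.star_commutator_isBigO j) h.bddX

lemma comm_lin (u : ι → ℂ) (t : τ) : X t * lin (P · t) u = lin (P · t) u * X t := by
  simp only [lin, Finset.mul_sum, Finset.sum_mul, mul_smul_comm, smul_mul_assoc, h.comm]

/-- `X` is bounded below on the range of the idempotents with nonzero eigenvalue. -/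
lemma bounded_below : ∃ C, 0 < C ∧ ∀ᶠ t in l, ∀ M : E,
    ‖lin (P · t) (fun i => if lam i = 0 then 0 else 1) * M‖ ≤
      C * ‖X t * (lin (P · t) (fun i => if lam i = 0 then 0 else 1) * M)‖ := by
  have hZ := lin_isBigO h.bdd (fun i => (lam i)⁻¹)
  obtain ⟨c, hc, hcZ⟩ := hZ.exists_pos
  have hsmall := (bigO_mul_littleO hZ h.near).bound (show (0 : ℝ) < 1 / 2 by norm_num)
  refine ⟨2 * c, by positivity, ?_⟩
  filter_upwards [hcZ.bound, hsmall] with t ht1 ht2 M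
  rw [norm_one, mul_one] at ht1 ht2
  set R := lin (P · t) (fun i => if lam i = 0 then 0 else 1) with hR
  -- With 0⁻¹ = 0, Z inverts Σ λ_i P_i on the range of R. Replacing that sum by X costs at most half
  -- of the left side, which is absorbed.
  set Z := lin (P · t) (fun i => (lam i)⁻¹) with hZdef
  have h1 : Z * lin (P · t) lam * R = R := by
    rw [hZdef, hR, lin_mul_lin (h.res t), lin_mul_lin (h.res t)]
    congr 1
    funext i
    by_cases hi : lam i = 0 <;> simp [hi]
  have h2 : R * M = Z * (X t * (R * M)) - Z * (X t - lin (P · t) lam) * (R * M) := by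
    have : Z * (X t * (R * M)) - Z * (X t - lin (P · t) lam) * (R * M) =
        (Z * lin (P · t) lam * R) * M := by noncomm_ring
    rw [this, h1]
  have h3 : ‖R * M‖ ≤ c * ‖X t * (R * M)‖ + 1 / 2 * ‖R * M‖ := by
    calc ‖R * M‖ = ‖Z * (X t * (R * M)) - Z * (X t - lin (P · t) lam) * (R * M)‖ := by rw [← h2]
      _ ≤ ‖Z * (X t * (R * M))‖ + ‖Z * (X t - lin (P · t) lam) * (R * M)‖ := norm_sub_le _ _
      _ ≤ c * ‖X t * (R * M)‖ + 1 / 2 * ‖R * M‖ := by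
        refine add_le_add ((norm_mul_le _ _).trans ?_) ((norm_mul_le _ _).trans ?_)
        · gcongr
        · gcongr
  linarith

/-- Spectral projections of `|X|` for small singular values almost annihilate the idempotents with
nonzero eigenvalue. -/
lemma exists_small_singular_bound (B : ℝ) : ∃ δ, 0 < δ ∧ ∃ C, 0 ≤ C ∧ ∀ᶠ t in l, ∀ Q : E,
    Q * (Star.star (X t) * X t * Q) = Star.star (X t) * X t * Q → Star.star Q = Q → ‖Q‖ ≤ B →
    ‖Star.star (X t) * X t * Q‖ ≤ δ →
      ∀ j, lam j ≠ 0 → ‖P j t * Q‖ ≤ C * ‖κ t‖ ∧ ‖Q * P j t‖ ≤ C * ‖κ t‖ := by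
  obtain ⟨C₁, hC₁, hb₁⟩ := h.bounded_below
  obtain ⟨C₂, hC₂, hb₂⟩ := h.star.bounded_below
  set u : ι → ℂ := fun i => if lam i = 0 then 0 else 1 with hu
  have hu' : (fun i => if Star.star lam i = 0 then (0 : ℂ) else 1) = u := by
    funext i
    simp [hu]
  have hustar : Star.star u = u := by
    funext i
    by_cases hi : lam i = 0 <;> simp [hu, hi]
  have hRsa := h.lin_sa u
  rw [hustar] at hRsa
  obtain ⟨C₃, hC₃, hb₃⟩ := hRsa.exists_nonneg
  obtain ⟨C₄, hC₄, hb₄⟩ := h.bddX.exists_nonneg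
  have hbd : (fun t => ∑ i, ‖P i t‖) =O[l] fun _ => (1 : ℝ) :=
    (IsBigO.sum (s := Finset.univ) fun i _ => (h.bdd i).norm_left).congr_left fun t => by simp
  obtain ⟨C₅, hC₅, hb₅⟩ := hbd.exists_nonneg
  have hsa : (fun t => ∑ i, ‖Star.star (P i t) - P i t‖) =O[l] κ :=
    (IsBigO.sum (s := Finset.univ) fun i _ => (h.sa i).norm_left).congr_left fun t => by simp
  obtain ⟨C₆, hC₆, hb₆⟩ := hsa.exists_nonneg
  set B' := max B 0 with hB'
  have hB0 : 0 ≤ B' := le_max_right _ _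
  set D := C₃ * B' * (1 + 2 * C₁ * C₄) with hD
  have hD0 : 0 ≤ D := by positivity
  -- Bounding RQ below by X and then by X* returns R' X*X Q, so ‖RQ‖ ≤ C₁C₂δ‖R'Q‖ + O(κ). This δ
  -- makes the factor 1/2; since R' - R = O(κ), the main term is absorbed.
  refine ⟨1 / (2 * C₁ * C₂), by positivity, C₅ * D + C₆ * B', by positivity, ?_⟩
  filter_upwards [hb₁, hb₂, hb₃.bound, hb₄.bound, hb₅.bound, hb₆.bound]
    with t h1 h2 h3 h4 h5 h6 Q hQ hQsa hQB hQδ j hj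
  rw [norm_one, mul_one] at h4 h5
  replace hQB : ‖Q‖ ≤ B' := hQB.trans (le_max_left _ _)
  rw [hu'] at h2
  set R := lin (P · t) u with hR
  set R' := lin (fun i => Star.star (P i t)) u with hR'
  set A := Star.star (X t) * X t with hA
  have hRR' : Star.star R = R' := by rw [hR, star_lin, hustar]
  rw [hRR'] at h3
  have h3' : ‖R - R'‖ ≤ C₃ * ‖κ t‖ := by rwa [norm_sub_rev]
  have hk := norm_nonneg (κ t)
  have e1 : X t * (R * Q) = R * (X t * Q) := by
    rw [← mul_assoc, h.comm_lin, mul_assoc]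
  have e2 : Star.star (X t) * (R' * (X t * Q)) = R' * Q * (A * Q) := by
    have := h.star.comm_lin u t
    rw [← mul_assoc, this, mul_assoc, ← mul_assoc (Star.star (X t)), mul_assoc R', ← hA, hQ]
  have f1 : ‖R * Q‖ ≤ C₁ * ‖R * (X t * Q)‖ := by rw [← e1]; exact h1 Q
  have f2 : ‖R' * (X t * Q)‖ ≤ C₂ * (‖R' * Q‖ * (1 / (2 * C₁ * C₂))) := by
    refine (h2 (X t * Q)).trans ?_
    rw [e2]
    refine mul_le_mul_of_nonneg_left ((norm_mul_le _ _).trans ?_) hC₂.le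
    gcongr
  have f3 : ‖R * (X t * Q)‖ ≤ ‖R' * (X t * Q)‖ + C₃ * ‖κ t‖ * (C₄ * B') := by
    have : R * (X t * Q) = R' * (X t * Q) + (R - R') * (X t * Q) := by noncomm_ring
    rw [this]
    refine (norm_add_le _ _).trans (add_le_add le_rfl ((norm_mul_le _ _).trans ?_))
    have : ‖X t * Q‖ ≤ C₄ * B' := (norm_mul_le _ _).trans (by gcongr)
    gcongr
  have f4 : ‖R' * Q‖ ≤ ‖R * Q‖ + C₃ * ‖κ t‖ * B' := by
    have : R' * Q = R * Q + (R' - R) * Q := by noncomm_ring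
    rw [this]
    refine (norm_add_le _ _).trans (add_le_add le_rfl ((norm_mul_le _ _).trans ?_))
    gcongr
  have f5 : ‖R * Q‖ ≤ D * ‖κ t‖ := by
    have g1 : C₁ * (C₂ * (‖R' * Q‖ * (1 / (2 * C₁ * C₂)))) = ‖R' * Q‖ / 2 := by
      field_simp
    have g2 : C₁ * ‖R * (X t * Q)‖ ≤ ‖R' * Q‖ / 2 + C₁ * (C₃ * ‖κ t‖ * (C₄ * B')) := by
      rw [← g1, ← mul_add]
      exact mul_le_mul_of_nonneg_left (f3.trans (add_le_add f2 le_rfl)) hC₁.le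
    rw [hD]
    nlinarith
  have hPj : P j t * R = P j t := by
    rw [hR, ← lin_single (p := (P · t)) j, lin_mul_lin (h.res t)]
    congr 1
    funext i
    by_cases hij : i = j
    · subst hij; simp [hu, hj]
    · simp [hij]
  have g5 : ‖P j t‖ ≤ C₅ := by
    refine le_trans ?_ ((le_abs_self _).trans h5)
    simpa using Finset.single_le_sum (f := fun i => ‖P i t‖) (fun _ _ => norm_nonneg _)
      (Finset.mem_univ j)
  have g6 : ‖Star.star (P j t) - P j t‖ ≤ C₆ * ‖κ t‖ := by
    refine le_trans ?_ ((le_abs_self _).trans h6)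
    simpa using Finset.single_le_sum (f := fun i => ‖Star.star (P i t) - P i t‖)
      (fun _ _ => norm_nonneg _) (Finset.mem_univ j)
  have r1 : ‖P j t * Q‖ ≤ C₅ * D * ‖κ t‖ := by
    rw [← hPj, mul_assoc, mul_assoc C₅]
    refine (norm_mul_le _ _).trans ?_
    gcongr
  refine ⟨r1.trans (by nlinarith [mul_nonneg (mul_nonneg hC₆ hB0) hk]), ?_⟩
  have r2 : Q * P j t = Star.star (P j t * Q) - Q * (Star.star (P j t) - P j t) := by
    rw [star_mul, hQsa]; noncomm_ring
  rw [r2]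
  refine (norm_sub_le _ _).trans ?_
  rw [norm_star]
  have r3 : ‖Q * (Star.star (P j t) - P j t)‖ ≤ B' * (C₆ * ‖κ t‖) :=
    (norm_mul_le _ _).trans (by gcongr)
  linarith

end NearNormal

end NearNormal

/-! ### Hermite interpolation and slopes in squared variables. -/

section RealAnalysis

open Filter Set Polynomial

/-- The divided difference of a function with respect to the squares of its arguments. -/
def sqSlope (b : ℝ) (φ : ℝ → ℝ) (x y : ℝ) : ℝ :=
  if x = y then derivWithin φ (Icc 0 b) x / (2 * x) else (φ x - φ y) / (x ^ 2 - y ^ 2)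

lemma sqSlope_comm (b : ℝ) (φ : ℝ → ℝ) (x y : ℝ) : sqSlope b φ x y = sqSlope b φ y x := by
  unfold sqSlope
  by_cases h : x = y
  · simp [h]
  · rw [if_neg h, if_neg (Ne.symm h), ← neg_sub, ← neg_sub (y ^ 2), neg_div_neg_eq]

/-- Correct the Lagrange interpolant by a multiple of the nodal polynomial: values at the nodes are
unchanged, and derivatives can be prescribed because the nodal polynomial has simple roots. -/
lemma exists_hermite (s : Finset ℝ) (v w : ℝ → ℝ) :
    ∃ p : ℝ[X], ∀ x ∈ s, p.eval x = v x ∧ p.derivative.eval x = w x := by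
  set I := Lagrange.interpolate s id v
  set N := Lagrange.nodal s (id : ℝ → ℝ) with hN
  set J := Lagrange.interpolate s id
    (fun x => (w x - I.derivative.eval x) / N.derivative.eval x)
  have hinj : Set.InjOn (id : ℝ → ℝ) s := Function.injective_id.injOn
  refine ⟨I + N * J, fun x hx => ?_⟩
  have h1 : I.eval x = v x := Lagrange.eval_interpolate_at_node (v := id) v hinj hx
  have h2 : J.eval x = (w x - I.derivative.eval x) / N.derivative.eval x :=
    Lagrange.eval_interpolate_at_node (v := id) _ hinj hx
  have h3 : N.eval x = 0 := Lagrange.eval_nodal_at_node (v := id) hx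
  have h4 : N.derivative.eval x ≠ 0 := by
    have := Lagrange.eval_nodal_derivative_eval_node_eq (v := (id : ℝ → ℝ)) hx
    rw [id] at this
    rw [hN, this]
    refine Lagrange.eval_nodal_not_at_node fun y hy => ?_
    exact (Finset.ne_of_mem_erase hy).symm
  constructor
  · simp [h1, h3]
  · simp only [derivative_add, derivative_mul, eval_add, eval_mul, h3, h2]
    field_simp
    ring

lemma eventually_ball {b x : ℝ} {U : Set ℝ} (hU : U ∈ 𝓝[Icc 0 b] x) :
    ∀ᶠ r in 𝓝[>] (0 : ℝ), ∀ s ∈ Icc 0 b, |s - x| < r → s ∈ U := by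
  obtain ⟨ε, hε, h⟩ := Metric.mem_nhdsWithin_iff.1 hU
  filter_upwards [Ioo_mem_nhdsGT hε] with r hr s hs hsx
  exact h ⟨by rw [Metric.mem_ball, Real.dist_eq]; exact hsx.trans hr.2, hs⟩

/-- Near distinct points, x² - y² stays away from 0 while g is small. Near a common point x > 0, the
mean value inequality applies with g' small and s + s' ≥ x. The case x = y = 0 is excluded, because
s + s' then has no lower bound. -/
lemma eventually_abs_sub_le_sq {b : ℝ} {g g' : ℝ → ℝ}
    (hg : ∀ s ∈ Icc 0 b, HasDerivWithinAt g (g' s) (Icc 0 b) s)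
    (hg' : ContinuousOn g' (Icc 0 b)) {x y : ℝ} (hx : x ∈ Icc 0 b) (hy : y ∈ Icc 0 b)
    (hgx : g x = 0) (hgy : g y = 0) (hgx' : x = y → g' x = 0) (hxy : x ≠ 0 ∨ y ≠ 0)
    {ε : ℝ} (hε : 0 < ε) :
    ∀ᶠ r in 𝓝[>] (0 : ℝ), ∀ s ∈ Icc 0 b, ∀ s' ∈ Icc 0 b, |s - x| < r → |s' - y| < r →
      |g s - g s'| ≤ ε * |s ^ 2 - s' ^ 2| := by
  by_cases h : x = y
  · subst h
    have hx0 : 0 < x := lt_of_le_of_ne hx.1 (by tauto)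
    have h1 : {s | |g' s| < ε * x} ∈ 𝓝[Icc 0 b] x := by
      have := (hg' x hx).abs
      refine this (Iio_mem_nhds ?_)
      simp only [hgx' rfl, abs_zero]
      positivity
    filter_upwards [eventually_ball h1, Ioo_mem_nhdsGT (half_pos hx0)]
      with r hr hrx s hs s' hs' h2 h3
    have hmv := Convex.norm_image_sub_le_of_norm_hasDerivWithin_le (f := g) (f' := g')
      (s := Icc 0 b ∩ Metric.ball x r) (C := ε * x) (x := s') (y := s)
      (fun z hz => (hg z hz.1).mono inter_subset_left)
      (fun z hz => (hr z hz.1 (by simpa [Real.dist_eq] using hz.2)).le)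
      ((convex_Icc _ _).inter (convex_ball _ _))
      ⟨hs', by simpa [Real.dist_eq] using h3⟩ ⟨hs, by simpa [Real.dist_eq] using h2⟩
    rw [Real.norm_eq_abs, Real.norm_eq_abs] at hmv
    refine hmv.trans ?_
    have e1 : x ≤ s + s' := by
      have := abs_lt.1 h2
      have := abs_lt.1 h3
      have := hrx.2
      linarith
    rw [sq_sub_sq, abs_mul, abs_of_nonneg (hx0.le.trans e1), mul_assoc]
    gcongr
  · have hne : 0 < |x ^ 2 - y ^ 2| := by
      rw [abs_pos, sub_ne_zero]
      intro h2
      exact h ((pow_left_inj₀ hx.1 hy.1 two_ne_zero).1 h2)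
    have key : ∀ z ∈ Icc 0 b, g z = 0 → {s | |g s| < ε * |x ^ 2 - y ^ 2| / 4 ∧
        |s ^ 2 - z ^ 2| < |x ^ 2 - y ^ 2| / 4} ∈ 𝓝[Icc 0 b] z := by
      intro z hz hgz
      have c1 : ContinuousWithinAt (fun s => |g s|) (Icc 0 b) z := (hg z hz).continuousWithinAt.abs
      have c2 : ContinuousWithinAt (fun s => |s ^ 2 - z ^ 2|) (Icc 0 b) z := by fun_prop
      refine inter_mem (c1 (Iio_mem_nhds ?_)) (c2 (Iio_mem_nhds ?_))
      · simp only [hgz, abs_zero]; positivity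
      · simp only [sub_self, abs_zero]; positivity
    filter_upwards [eventually_ball (key x hx hgx), eventually_ball (key y hy hgy)]
      with r hr1 hr2 s hs s' hs' h2 h3
    obtain ⟨a1, a2⟩ := hr1 s hs h2
    obtain ⟨b1, b2⟩ := hr2 s' hs' h3
    have e1 : |x ^ 2 - y ^ 2| / 2 ≤ |s ^ 2 - s' ^ 2| := by
      have t1 := abs_sub_abs_le_abs_sub (x ^ 2 - y ^ 2) (s ^ 2 - s' ^ 2)
      have t2 : x ^ 2 - y ^ 2 - (s ^ 2 - s' ^ 2) = (s' ^ 2 - y ^ 2) - (s ^ 2 - x ^ 2) := by ring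
      have t3 := abs_sub (s' ^ 2 - y ^ 2) (s ^ 2 - x ^ 2)
      rw [t2] at t1
      linarith
    have e2 : |g s - g s'| ≤ ε * (|x ^ 2 - y ^ 2| / 2) := by
      have := abs_sub (g s) (g s')
      linarith
    exact e2.trans (by gcongr)

end RealAnalysis

/-! ### Entrywise commutator bounds and localization of singular values. -/

section Matrices

open Asymptotics Filter Set Polynomial Matrix
open scoped Matrix.Norms.Frobenius

variable {n : ℕ}

lemma abs_le_norm_cfc {m : Type*} [Fintype m] [DecidableEq m] {A : Matrix m m ℂ}
    (hA : A.IsHermitian) (f : ℝ → ℝ) {s : ℝ} (hs : s ∈ spectrum ℝ A) : |f s| ≤ ‖cfc f A‖ := by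
  rw [hA.spectrum_real_eq_range_eigenvalues] at hs
  obtain ⟨i, rfl⟩ := hs
  have h1 := inEigenbases_cfc_mul hA hA f 1 i i
  have h2 : inEigenbases hA hA (1 : Matrix m m ℂ) = 1 := by simp [inEigenbases]
  rw [h2, mul_one, one_apply_eq, mul_one] at h1
  rw [← norm_inEigenbases hA hA (cfc f A), ← Real.norm_eq_abs, ← Complex.norm_real, ← h1]
  exact entry_norm_le _ _ _

/-- In an eigenbasis of A, an entry with an index where f = 1 is bounded through f(A)M or M f(A);
any other entry through the commutator with k(A). -/
lemma norm_commutator_cfc_le {m : Type*} [Fintype m] [DecidableEq m] {A : Matrix m m ℂ}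
    (hA : A.IsHermitian) (f g k : ℝ → ℝ) {ε : ℝ} (hε : 0 ≤ ε)
    (hg : ∀ x ∈ spectrum ℝ A, |g x| ≤ ε)
    (h : ∀ x ∈ spectrum ℝ A, ∀ y ∈ spectrum ℝ A, f x = 1 ∨ f y = 1 ∨ |g x - g y| ≤ ε * |k x - k y|)
    (M : Matrix m m ℂ) :
    ‖cfc g A * M - M * cfc g A‖ ≤ Fintype.card m *
      (ε * (2 * ‖cfc f A * M‖ + 2 * ‖M * cfc f A‖ + ‖cfc k A * M - M * cfc k A‖)) := by
  rw [← norm_inEigenbases hA hA (cfc g A * M - M * cfc g A)]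
  refine norm_le_card_mul_of_entry_le (by positivity) fun i j => ?_
  have hi : hA.eigenvalues i ∈ spectrum ℝ A := by
    rw [hA.spectrum_real_eq_range_eigenvalues]; exact ⟨i, rfl⟩
  have hj : hA.eigenvalues j ∈ spectrum ℝ A := by
    rw [hA.spectrum_real_eq_range_eigenvalues]; exact ⟨j, rfl⟩
  rw [inEigenbases_commutator, norm_mul, Complex.norm_real, Real.norm_eq_abs]
  have h2 : |g (hA.eigenvalues i) - g (hA.eigenvalues j)| ≤ 2 * ε := by
    have := abs_sub (g (hA.eigenvalues i)) (g (hA.eigenvalues j))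
    linarith [hg _ hi, hg _ hj]
  have e1 := entry_norm_le (inEigenbases hA hA (cfc f A * M)) i j
  have e2 := entry_norm_le (inEigenbases hA hA (M * cfc f A)) i j
  have e3 := entry_norm_le (inEigenbases hA hA (cfc k A * M - M * cfc k A)) i j
  rw [norm_inEigenbases] at e1 e2 e3
  rw [inEigenbases_cfc_mul] at e1
  rw [inEigenbases_mul_cfc] at e2
  rw [inEigenbases_commutator, norm_mul, Complex.norm_real, Real.norm_eq_abs] at e3
  have p1 := norm_nonneg (cfc f A * M)
  have p2 := norm_nonneg (M * cfc f A)
  have p3 := norm_nonneg (cfc k A * M - M * cfc k A)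
  have p4 := norm_nonneg (inEigenbases hA hA M i j)
  rcases h _ hi _ hj with h3 | h3 | h3
  · rw [h3, Complex.ofReal_one, one_mul] at e1
    calc _ ≤ 2 * ε * ‖cfc f A * M‖ := by gcongr
      _ ≤ _ := by nlinarith [mul_nonneg hε p2, mul_nonneg hε p3]
  · rw [h3, Complex.ofReal_one, mul_one] at e2
    calc _ ≤ 2 * ε * ‖M * cfc f A‖ := by gcongr
      _ ≤ _ := by nlinarith [mul_nonneg hε p1, mul_nonneg hε p3]
  · calc _ ≤ ε * |k (hA.eigenvalues i) - k (hA.eigenvalues j)| * ‖inEigenbases hA hA M i j‖ := by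
          gcongr
      _ ≤ ε * ‖cfc k A * M - M * cfc k A‖ := by
          rw [mul_assoc]; gcongr
      _ ≤ _ := by nlinarith [mul_nonneg hε p1, mul_nonneg hε p2]

variable {τ ι : Type*} [Fintype ι] [DecidableEq ι] {l : Filter τ} {lam : ι → ℂ}
  {X : τ → Matrix (Fin n) (Fin n) ℂ} {P : ι → τ → Matrix (Fin n) (Fin n) ℂ} {κ : τ → ℝ}

/-- The singular values approach the moduli of the limiting eigenvalues. -/
lemma NearNormal.eventually_spectrum (h : NearNormal l lam X P κ) {r : ℝ} (hr : 0 < r) :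
    ∀ᶠ t in l, ∀ s ∈ spectrum ℝ (CFC.abs (X t)), ∃ i, |s - ‖lam i‖| < r := by
  -- m(X*X) tends to 0 because m vanishes at every limiting squared modulus. A singular value at
  -- distance at least r from all the moduli would make |m(s²)| at least r to the power 2|ι|.
  set m : ℝ[X] := ∏ i, (Polynomial.X - C (‖lam i‖ ^ 2)) with hm
  have h1 := aeval_near h.res h.bdd h.abs_sq_near (m.map (algebraMap ℝ ℂ))
  have h2 : ∀ i, (m.map (algebraMap ℝ ℂ)).eval ((‖lam i‖ ^ 2 : ℝ) : ℂ) = 0 := by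
    intro i
    have : ((‖lam i‖ ^ 2 : ℝ) : ℂ) = algebraMap ℝ ℂ (‖lam i‖ ^ 2) := rfl
    rw [this, eval_map_algebraMap, aeval_algebraMap_apply, hm, coe_aeval_eq_eval, eval_prod,
      Finset.prod_eq_zero (Finset.mem_univ i) (by simp), map_zero]
  have h3 : ∀ᶠ t in l, ‖aeval (Star.star (X t) * X t) m‖ < r ^ (2 * Fintype.card ι) := by
    have hpos : 0 < r ^ (2 * Fintype.card ι) / 2 := by positivity
    filter_upwards [h1.bound hpos] with t ht
    simp only [h2, lin, zero_smul, Finset.sum_const_zero, sub_zero, aeval_map_algebraMap, norm_one,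
      mul_one] at ht
    linarith
  filter_upwards [h3] with t ht s hs
  by_contra! hc
  have h4 := abs_le_norm_cfc (isHermitian_abs (X t)) (fun s => m.eval (s ^ 2)) hs
  rw [cfc_eval_sq_abs] at h4
  refine absurd (h4.trans_lt ht) (not_lt.2 ?_)
  have hs0 := spectrum_abs_nonneg (X t) hs
  rw [hm, eval_prod, Finset.abs_prod, pow_mul, ← Finset.card_univ, ← Finset.prod_const]
  refine Finset.prod_le_prod (fun _ _ => by positivity) fun i _ => ?_
  rw [eval_sub, eval_X, eval_C, sq_sub_sq, abs_mul, sq]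
  have h5 := hc i
  refine mul_le_mul (h5.trans ?_) h5 hr.le (abs_nonneg _)
  rw [abs_le]
  have := norm_nonneg (lam i)
  rw [abs_of_nonneg (a := s + ‖lam i‖) (by positivity)]
  constructor <;> linarith

end Matrices

/-! ### Commutators of functions of |X| with the idempotents. -/

section CommutatorAsymptotics

open Asymptotics Filter Set Polynomial Matrix
open scoped Matrix.Norms.Frobenius

variable {n : ℕ} {τ ι : Type*} [Fintype ι] [DecidableEq ι] {l : Filter τ} {lam : ι → ℂ}
  {X : τ → Matrix (Fin n) (Fin n) ℂ} {P : ι → τ → Matrix (Fin n) (Fin n) ℂ} {κ : τ → ℝ}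

namespace NearNormal

variable (h : NearNormal l lam X P κ)
include h

/-- The slope of g against s² is small near every pair of moduli except (0,0). The exceptional
entries lie in the range of the small-singular-value projection, whose products with P_j are O(κ)
because λ_j ≠ 0; smallness of g then makes them o(κ). -/
lemma commutator_remainder {b : ℝ} (hmem : ∀ t, X t ∈ matricesIn n 0 b)
    (hlam : ∀ i, ‖lam i‖ ∈ Icc 0 b) {g g' : ℝ → ℝ}
    (hg : ∀ s ∈ Icc 0 b, HasDerivWithinAt g (g' s) (Icc 0 b) s)
    (hg' : ContinuousOn g' (Icc 0 b)) (hg0 : ∀ i, g ‖lam i‖ = 0)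
    (hg1 : ∀ i, lam i ≠ 0 → g' ‖lam i‖ = 0) {j : ι} (hj : lam j ≠ 0) :
    (fun t => cfc g (CFC.abs (X t)) * P j t - P j t * cfc g (CFC.abs (X t))) =o[l] κ := by
  set B := ‖(1 : Matrix (Fin n) (Fin n) ℂ)‖ with hB
  obtain ⟨δ, hδ, C, hC, hsmall⟩ := h.exists_small_singular_bound B
  obtain ⟨C', hC', hA⟩ := (h.abs_sq_commutator_isBigO j).exists_nonneg
  set ρ := min 1 (δ / (B + 1)) with hρ
  have hB0 : 0 ≤ B := norm_nonneg _
  have hρ0 : 0 < ρ := lt_min one_pos (by positivity)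
  have hρδ : ρ ^ 2 * B ≤ δ := by
    have h1 : ρ ^ 2 ≤ δ / (B + 1) := by
      rw [sq]
      calc ρ * ρ ≤ 1 * (δ / (B + 1)) := mul_le_mul (min_le_left _ _) (min_le_right _ _) hρ0.le
            zero_le_one
        _ = _ := one_mul _
    calc ρ ^ 2 * B ≤ δ / (B + 1) * (B + 1) := by gcongr; linarith
      _ = δ := by field_simp
  set f : ℝ → ℝ := fun s => if s < ρ then 1 else 0 with hf
  rw [isLittleO_iff]
  intro c hc
  set ε := c / ((n + 1) * (4 * C + C' + 1)) with hε
  have hε0 : 0 < ε := by positivity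
  obtain ⟨r, hr0, hrρ, hr1, hr2⟩ : ∃ r, 0 < r ∧ r ≤ ρ ∧
      (∀ i, ∀ s ∈ Icc 0 b, |s - ‖lam i‖| < r → |g s| ≤ ε) ∧
      (∀ i k, (lam i ≠ 0 ∨ lam k ≠ 0) → ∀ s ∈ Icc 0 b, ∀ s' ∈ Icc 0 b, |s - ‖lam i‖| < r →
        |s' - ‖lam k‖| < r → |g s - g s'| ≤ ε * |s ^ 2 - s' ^ 2|) := by
    have e1 : ∀ᶠ r in 𝓝[>] (0 : ℝ), ∀ i, ∀ s ∈ Icc 0 b, |s - ‖lam i‖| < r → |g s| ≤ ε := by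
      rw [eventually_all]
      intro i
      have c1 : ContinuousWithinAt (fun s => |g s|) (Icc 0 b) ‖lam i‖ :=
        (hg _ (hlam i)).continuousWithinAt.abs
      refine eventually_ball (c1 (Iic_mem_nhds ?_))
      simpa only [hg0, abs_zero]
    have e2 : ∀ᶠ r in 𝓝[>] (0 : ℝ), ∀ i k, (lam i ≠ 0 ∨ lam k ≠ 0) → ∀ s ∈ Icc 0 b,
        ∀ s' ∈ Icc 0 b, |s - ‖lam i‖| < r → |s' - ‖lam k‖| < r →
          |g s - g s'| ≤ ε * |s ^ 2 - s' ^ 2| := by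
      rw [eventually_all]
      intro i
      rw [eventually_all]
      intro k
      by_cases hik : lam i ≠ 0 ∨ lam k ≠ 0
      · have := eventually_abs_sub_le_sq hg hg' (hlam i) (hlam k) (hg0 i) (hg0 k) (fun hxy => by
          refine hg1 i fun h0 => ?_
          rw [h0, norm_zero] at hxy
          have := norm_eq_zero.1 hxy.symm
          tauto) (by simpa using hik) hε0
        exact this.mono fun r hr _ => hr
      · exact Eventually.of_forall fun r hik' => absurd hik' hik
    obtain ⟨r, h1, h2, h3⟩ := (e1.and (e2.and (Ioc_mem_nhdsGT hρ0))).exists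
    exact ⟨r, h3.1, h3.2, h1, h2⟩
  filter_upwards [hsmall, hA.bound, h.eventually_spectrum hr0] with t ht1 ht2 ht3
  set S := CFC.abs (X t) with hS
  have hSH : S.IsHermitian := isHermitian_abs (X t)
  have hcont : ∀ k : ℝ → ℝ, ContinuousOn k (spectrum ℝ S) := fun k =>
    (finite_spectrum_real hSH).continuousOn k
  have hsq : cfc (fun s : ℝ => s ^ 2) S = Star.star (X t) * X t := by
    have := cfc_eval_sq_abs Polynomial.X (X t)
    simpa only [eval_X, aeval_X] using this
  have hAQ : Star.star (X t) * X t * cfc f S = cfc (fun s => s ^ 2 * f s) S := by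
    rw [← hsq, ← cfc_mul _ _ S (hcont _) (hcont _)]
  obtain ⟨q1, q2⟩ := ht1 (cfc f S) (by
      rw [hAQ, ← cfc_mul _ _ S (hcont _) (hcont _)]
      refine cfc_congr fun s _ => ?_
      by_cases hs : s < ρ <;> simp [hf, hs]) (cfc_predicate f S) (by
      refine (norm_cfc_le hSH f zero_le_one fun x _ => ?_).trans (one_mul _).le
      by_cases hs : x < ρ <;> simp [hf, hs]) (by
      rw [hAQ]
      refine (norm_cfc_le hSH _ (sq_nonneg ρ) fun x hx => ?_).trans hρδ
      have hx0 := spectrum_abs_nonneg (X t) hx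
      by_cases hs : x < ρ
      · simp only [hf, hs, if_true, mul_one]
        rw [abs_of_nonneg (sq_nonneg x)]
        gcongr
      · simp [hf, hs, sq_nonneg]) j hj
  have hbound := norm_commutator_cfc_le hSH f g (fun s => s ^ 2) hε0.le
    (fun x hx => by
      obtain ⟨i, hi⟩ := ht3 x hx
      exact hr1 i x (hmem t hx) hi)
    (fun x hx y hy => by
      obtain ⟨i, hi⟩ := ht3 x hx
      obtain ⟨k, hk⟩ := ht3 y hy
      by_cases hik : lam i ≠ 0 ∨ lam k ≠ 0
      · exact Or.inr (Or.inr (hr2 i k hik x (hmem t hx) y (hmem t hy) hi hk))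
      · push Not at hik
        left
        rw [hik.1, norm_zero, sub_zero] at hi
        simp only [hf, (le_abs_self x).trans_lt (hi.trans_le hrρ), if_true]) (P j t)
  rw [hsq, Fintype.card_fin] at hbound
  refine hbound.trans ?_
  have hk := norm_nonneg (κ t)
  have e3 : (n : ℝ) * (ε * (4 * C + C')) ≤ c := by
    have : ε * ((n + 1) * (4 * C + C' + 1)) = c := by rw [hε]; field_simp
    have hn : (0 : ℝ) ≤ n := n.cast_nonneg
    rw [← this]
    nlinarith [mul_nonneg hε0.le hn,
      mul_nonneg hε0.le (mul_nonneg hn (by positivity : 0 ≤ 4 * C + C')),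
      mul_nonneg hε0.le (by positivity : 0 ≤ 4 * C + C')]
  calc _ ≤ (n : ℝ) * (ε * (2 * (C * ‖κ t‖) + 2 * (C * ‖κ t‖) + C' * ‖κ t‖)) := by gcongr
    _ = n * (ε * (4 * C + C')) * ‖κ t‖ := by ring
    _ ≤ c * ‖κ t‖ := by gcongr

/-- Interpolate φ∘√ by a polynomial matching values and derivatives at the squared moduli. Its
commutator follows the divided-difference formula, and the difference is the negligible remainder.
-/
theorem cfc_commutator_near {b : ℝ} (hinj : Function.Injective lam)
    (hmem : ∀ t, X t ∈ matricesIn n 0 b)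
    (hlam : ∀ i, ‖lam i‖ ∈ Icc 0 b) {φ : ℝ → ℝ} (hφ : ContDiffOn ℝ 1 φ (Icc 0 b)) (j : ι) :
    (fun t => cfc φ (CFC.abs (X t)) * P j t - P j t * cfc φ (CFC.abs (X t)) -
      blk (P · t) (fun i k => (sqSlope b φ ‖lam i‖ ‖lam k‖ : ℂ))
        (Star.star (X t) * X t * P j t - P j t * (Star.star (X t) * X t))) =o[l] κ := by
  set a : ι → ℂ := fun i => ((‖lam i‖ ^ 2 : ℝ) : ℂ) with ha
  -- At a zero modulus, division by zero prescribes derivative 0, in agreement with `sqSlope`. The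
  -- value is immaterial: it multiplies a diagonal block of a commutator with P_j, which vanishes.
  obtain ⟨p, hp⟩ := exists_hermite (Finset.univ.image fun i => ‖lam i‖ ^ 2) (fun x => φ √x)
    (fun x => derivWithin φ (Icc 0 b) √x / (2 * √x))
  replace hp : ∀ i, p.eval (‖lam i‖ ^ 2) = φ ‖lam i‖ ∧ p.derivative.eval (‖lam i‖ ^ 2) =
      derivWithin φ (Icc 0 b) ‖lam i‖ / (2 * ‖lam i‖) := by
    intro i
    have := hp (‖lam i‖ ^ 2) (Finset.mem_image_of_mem _ (Finset.mem_univ i))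
    rwa [Real.sqrt_sq (norm_nonneg _)] at this
  set q : ℂ[X] := p.map (algebraMap ℝ ℂ) with hq
  have hev : ∀ (r : ℝ[X]) (x : ℝ), (r.map (algebraMap ℝ ℂ)).eval (x : ℂ) = ((r.eval x : ℝ) : ℂ) := by
    intro r x
    have : (x : ℂ) = algebraMap ℝ ℂ x := rfl
    rw [this, eval_map_algebraMap, aeval_algebraMap_apply, coe_aeval_eq_eval]
    rfl
  have hslope : ∀ i k, (sqSlope b φ ‖lam i‖ ‖lam k‖ : ℂ) = divDiff q (a i) (a k) := by
    intro i k
    have hiff : a i = a k ↔ ‖lam i‖ = ‖lam k‖ := by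
      rw [ha]
      simp only [Complex.ofReal_inj]
      exact pow_left_inj₀ (norm_nonneg _) (norm_nonneg _) two_ne_zero
    unfold sqSlope divDiff
    by_cases hik : ‖lam i‖ = ‖lam k‖
    · rw [if_pos hik, if_pos (hiff.2 hik), hq, derivative_map, ha]
      simp only [hev, (hp i).2]
    · rw [if_neg hik, if_neg (mt hiff.1 hik), hq, ha]
      simp only [hev, (hp _).1]
      push_cast
      rfl
  set g : ℝ → ℝ := fun s => φ s - p.eval (s ^ 2) with hg
  set g' : ℝ → ℝ := fun s => derivWithin φ (Icc 0 b) s - p.derivative.eval (s ^ 2) * (2 * s)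
    with hgd
  set F : ι → τ → Matrix (Fin n) (Fin n) ℂ := fun j t =>
    cfc φ (CFC.abs (X t)) * P j t - P j t * cfc φ (CFC.abs (X t)) -
      blk (P · t) (fun i k => (sqSlope b φ ‖lam i‖ ‖lam k‖ : ℂ))
        (Star.star (X t) * X t * P j t - P j t * (Star.star (X t) * X t)) with hF
  have main : ∀ j, lam j ≠ 0 → F j =o[l] κ := by
    intro j hj
    have hb : 0 < b := lt_of_lt_of_le (norm_pos_iff.2 hj) (hlam j).2
    have hdφ : ∀ s ∈ Icc 0 b, HasDerivWithinAt φ (derivWithin φ (Icc 0 b) s) (Icc 0 b) s :=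
      fun s hs => (hφ.differentiableOn one_ne_zero s hs).hasDerivWithinAt
    have hrem := h.commutator_remainder hmem hlam (g := g) (g' := g')
      (fun s hs => by
        have h1 := ((p.hasDerivAt (s ^ 2)).comp s ((hasDerivAt_id s).pow 2)).hasDerivWithinAt
          (s := Icc 0 b)
        have h2 := (hdφ s hs).sub h1
        refine h2.congr_deriv ?_
        simp [hgd])
      (by
        refine (hφ.continuousOn_derivWithin (uniqueDiffOn_Icc hb) le_rfl).sub ?_
        fun_prop)
      (fun i => by simp [hg, (hp i).1])
      (fun i hi => by
        have : ‖lam i‖ ≠ 0 := norm_ne_zero_iff.2 hi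
        simp only [hgd, (hp i).2]
        field_simp
        ring) hj
    have hpoly := aeval_commutator_near h.res h.bdd h.abs_sq_near (h.abs_sq_commutator_isBigO j) q
    refine (hrem.add hpoly).congr_left fun t => ?_
    have hcont : ∀ k : ℝ → ℝ, ContinuousOn k (spectrum ℝ (CFC.abs (X t))) := fun k =>
      (finite_spectrum_real (isHermitian_abs (X t))).continuousOn k
    have e1 : cfc g (CFC.abs (X t)) = cfc φ (CFC.abs (X t)) - aeval (Star.star (X t) * X t) q := by
      rw [hg, cfc_sub _ _ _ (hcont _) (hcont _), cfc_eval_sq_abs, hq, aeval_map_algebraMap]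
    simp only [hF, e1, hslope, ha]
    rw [sub_mul, mul_sub]
    abel
  by_cases hj : lam j ≠ 0
  · exact main j hj
  · push Not at hj
    -- All idempotents sum to 1, whose commutators vanish. By injectivity only one index has
    -- eigenvalue 0, so its error is minus the sum of errors already estimated.
    have hsum : ∀ t, ∑ i, F i t = 0 := by
      intro t
      set D := fun i k => (sqSlope b φ ‖lam i‖ ‖lam k‖ : ℂ)
      have hblk : ∀ M : ι → Matrix (Fin n) (Fin n) ℂ, ∑ i, blk (P · t) D (M i) =
          blk (P · t) D (∑ i, M i) := by
        intro M
        simp only [blk, Finset.mul_sum, Finset.sum_mul, Finset.smul_sum]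
        rw [Finset.sum_comm]
        exact Finset.sum_congr rfl fun i _ => Finset.sum_comm
      simp only [hF, Finset.sum_sub_distrib, hblk, ← Finset.mul_sum, ← Finset.sum_mul,
        (h.res t).sum_eq, mul_one, one_mul, sub_self]
      simp [blk]
    have hneg : ∀ t, F j t = -∑ i ∈ Finset.univ.erase j, F i t := by
      intro t
      have := Finset.add_sum_erase Finset.univ (fun i => F i t) (Finset.mem_univ j)
      rw [hsum] at this
      exact eq_neg_of_add_eq_zero_left this
    have : (fun t => -∑ i ∈ Finset.univ.erase j, F i t) =o[l] κ := by
      refine IsLittleO.neg_left ((IsLittleO.sum (s := Finset.univ.erase j)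
        fun i hi => main i ?_).congr_left fun t => ?_)
      · intro h0
        exact Finset.ne_of_mem_erase hi (hinj (h0.trans hj.symm))
      · simp
    exact this.congr_left fun t => (hneg t).symm

theorem cfc_star_commutator_near {b : ℝ} (hinj : Function.Injective lam)
    (hmem : ∀ t, X t ∈ matricesIn n 0 b)
    (hlam : ∀ i, ‖lam i‖ ∈ Icc 0 b) {φ : ℝ → ℝ} (hφ : ContDiffOn ℝ 1 φ (Icc 0 b)) (j : ι) :
    (fun t => cfc φ (CFC.abs (Star.star (X t))) * P j t -
      P j t * cfc φ (CFC.abs (Star.star (X t))) -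
      blk (P · t) (fun i k => (sqSlope b φ ‖lam i‖ ‖lam k‖ : ℂ))
        (X t * Star.star (X t) * P j t - P j t * (X t * Star.star (X t)))) =o[l] κ := by
  have h1 := h.star.cfc_commutator_near (b := b) (star_injective.comp hinj)
    (fun t => star_mem_matricesIn (hmem t)) (fun i => by simpa using hlam i) hφ j
  refine (isLittleO_star h1.neg_left).congr_left fun t => ?_
  have e1 : Star.star (cfc φ (CFC.abs (Star.star (X t)))) = cfc φ (CFC.abs (Star.star (X t))) :=
    cfc_predicate (p := IsSelfAdjoint) φ _
  have e2 : ∀ M, Star.star (blk (fun i => Star.star (P i t))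
      (fun i k => (sqSlope b φ ‖Star.star lam i‖ ‖Star.star lam k‖ : ℂ)) M) =
      blk (P · t) (fun i k => (sqSlope b φ ‖lam i‖ ‖lam k‖ : ℂ)) (Star.star M) := by
    intro M
    simp only [blk, star_sum, star_smul, star_mul, star_star, Pi.star_apply, Complex.star_def,
      Complex.conj_ofReal, RCLike.norm_conj]
    rw [Finset.sum_comm]
    refine Finset.sum_congr rfl fun i _ => Finset.sum_congr rfl fun k _ => ?_
    rw [sqSlope_comm, mul_assoc]
  rw [star_neg, star_sub, star_sub, e2]
  simp only [star_sub, star_mul, star_star, e1, blk_sub]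
  noncomm_ring

end NearNormal

end CommutatorAsymptotics

/-! ### First-order expansions in the Gram defect K. -/

section GramDefect

set_option linter.unusedSectionVars false

open Asymptotics Filter

variable {τ ι E : Type*} [Fintype ι] [DecidableEq ι] [NormedRing E] [NormedAlgebra ℂ E]
  [StarRing E]

/-- The deviation of a resolution of the identity from being orthogonal. -/
def gramDefect (p : ι → E) : E := ∑ i, star (p i) * p i - 1

lemma star_gramDefect (p : ι → E) : star (gramDefect p) = gramDefect p := by
  simp [gramDefect, star_sum]

/-- K P_j = P_j* P_j - P_j and its adjoint give P_j* - P_j = K P_j - P_j* K. Thus P_j* - P_j is [K,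
P_j] up to a term quadratic in the deviation. -/
lemma IsResolution.star_sub {p : ι → E} (hp : IsResolution p) (j : ι) :
    star (p j) - p j = gramDefect p * p j - p j * gramDefect p -
      (star (p j) - p j) * gramDefect p := by
  have h1 : gramDefect p * p j = star (p j) * p j - p j := by
    simp only [gramDefect, sub_mul, one_mul, Finset.sum_mul, mul_assoc, hp.mul_eq]
    simp
  have h2 : star (p j) * gramDefect p = star (p j) * p j - star (p j) := by
    have := congrArg star h1
    simpa [star_gramDefect] using this
  rw [sub_mul, h1, h2]
  abel

variable [NormedStarGroup E] [StarModule ℂ E] {l : Filter τ} {lam : ι → ℂ} {X : τ → E} {P : ι → τ → E}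

namespace NearNormal

variable (h : NearNormal l lam X P (fun t => ‖gramDefect (P · t)‖))
include h

omit h in
lemma gramDefect_isBigO : (fun t => gramDefect (P · t)) =O[l] fun t => ‖gramDefect (P · t)‖ :=
  (isBigO_refl _ _).norm_right

lemma star_sub_near (j : ι) : (fun t => Star.star (P j t) - P j t -
    blk (P · t) (fun i k => (Pi.single j 1 : ι → ℂ) k - (Pi.single j 1 : ι → ℂ) i)
      (gramDefect (P · t))) =o[l] fun t => ‖gramDefect (P · t)‖ := by
  refine (littleO_mul (h.sa_small j) gramDefect_isBigO).neg_left.congr_left fun t => ?_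
  rw [← commutator_idempotent (h.res t)]
  conv_rhs => rw [(h.res t).star_sub j]
  abel

lemma star_commutator_near (j : ι) :
    (fun t => Star.star (X t) * P j t - P j t * Star.star (X t) -
      blk (P · t) (fun i k => (Star.star (lam k) - Star.star (lam i)) *
        ((Pi.single j 1 : ι → ℂ) k - (Pi.single j 1 : ι → ℂ) i)) (gramDefect (P · t))) =o[l]
      fun t => ‖gramDefect (P · t)‖ := by
  set e : ι → ι → ℂ := fun i k => (Pi.single j 1 : ι → ℂ) k - (Pi.single j 1 : ι → ℂ) i with he
  have hQ := h.star_sub_near j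
  have hb := blk_isBigO h.bdd e (gramDefect_isBigO (l := l) (P := P))
  have h1 := littleO_mul_bigO hQ (isBigO_star h.bddX)
  have h2 := bigO_mul_littleO (isBigO_star h.bddX) hQ
  have h3 := mul_littleO hb h.star_near
  have h4 := littleO_mul h.star_near hb
  refine (((h1.sub h2).add h3).sub h4).congr_left fun t => ?_
  have e1 : blk (P · t) (fun i k => (Star.star (lam k) - Star.star (lam i)) * e i k)
      (gramDefect (P · t)) =
      blk (P · t) e (gramDefect (P · t)) * lin (P · t) (Star.star lam) -
        lin (P · t) (Star.star lam) * blk (P · t) e (gramDefect (P · t)) := by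
    rw [mul_lin (h.res t), lin_mul (h.res t), blk_blk (h.res t), blk_blk (h.res t),
      ← blk_sub_coeff]
    congr 1
    funext i k
    rw [Pi.star_apply, Pi.star_apply]
    ring
  rw [e1, h.star_commutator]
  simp only [he]
  noncomm_ring

/-- Since X commutes with P_j, [X*X, P_j] = [X*, P_j] X, and the right factor contributes λ_k. For
XX* the factor X stands on the left and contributes λ_i. -/
lemma abs_sq_commutator_near (j : ι) :
    (fun t => Star.star (X t) * X t * P j t - P j t * (Star.star (X t) * X t) -
      blk (P · t) (fun i k => lam k * ((Star.star (lam k) - Star.star (lam i)) *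
        ((Pi.single j 1 : ι → ℂ) k - (Pi.single j 1 : ι → ℂ) i))) (gramDefect (P · t))) =o[l]
      fun t => ‖gramDefect (P · t)‖ := by
  set e : ι → ι → ℂ := fun i k => (Star.star (lam k) - Star.star (lam i)) *
        ((Pi.single j 1 : ι → ℂ) k - (Pi.single j 1 : ι → ℂ) i) with he
  have hb := blk_isBigO h.bdd e (gramDefect_isBigO (l := l) (P := P))
  have h1 := littleO_mul_bigO (h.star_commutator_near j) h.bddX
  have h2 := mul_littleO hb h.near
  refine (h1.add h2).congr_left fun t => ?_
  have e1 : blk (P · t) (fun i k => lam k * e i k) (gramDefect (P · t)) =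
      blk (P · t) e (gramDefect (P · t)) * lin (P · t) lam := by
    rw [mul_lin (h.res t), blk_blk (h.res t)]
  rw [e1, h.abs_sq_commutator]
  simp only [he]
  noncomm_ring

lemma abs_star_sq_commutator_near (j : ι) :
    (fun t => X t * Star.star (X t) * P j t - P j t * (X t * Star.star (X t)) -
      blk (P · t) (fun i k => lam i * ((Star.star (lam k) - Star.star (lam i)) *
        ((Pi.single j 1 : ι → ℂ) k - (Pi.single j 1 : ι → ℂ) i))) (gramDefect (P · t))) =o[l]
      fun t => ‖gramDefect (P · t)‖ := by
  set e : ι → ι → ℂ := fun i k => (Star.star (lam k) - Star.star (lam i)) *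
        ((Pi.single j 1 : ι → ℂ) k - (Pi.single j 1 : ι → ℂ) i) with he
  have hb := blk_isBigO h.bdd e (gramDefect_isBigO (l := l) (P := P))
  have h1 := bigO_mul_littleO h.bddX (h.star_commutator_near j)
  have h2 := littleO_mul h.near hb
  refine (h1.add h2).congr_left fun t => ?_
  have e1 : blk (P · t) (fun i k => lam i * e i k) (gramDefect (P · t)) =
      lin (P · t) lam * blk (P · t) e (gramDefect (P · t)) := by
    rw [lin_mul (h.res t), blk_blk (h.res t)]
  have e2 : X t * Star.star (X t) * P j t - P j t * (X t * Star.star (X t)) =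
      X t * (Star.star (X t) * P j t - P j t * Star.star (X t)) := by
    rw [← mul_assoc (P j t), ← h.comm]
    noncomm_ring
  rw [e1, e2]
  simp only [he]
  noncomm_ring

end NearNormal

end GramDefect

/-! ### Strict decrease of the trace of the Gram defect. -/

section Lyapunov

open Asymptotics Filter Set Matrix
open scoped Matrix.Norms.Frobenius

variable {n : ℕ} {τ ι : Type*} [Fintype ι] [DecidableEq ι] {l : Filter τ} {lam : ι → ℂ}
  {X : τ → Matrix (Fin n) (Fin n) ℂ} {P : ι → τ → Matrix (Fin n) (Fin n) ℂ}

lemma trace_blk_mul_blk {p : ι → Matrix (Fin n) (Fin n) ℂ} (hp : IsResolution p)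
    (u w : ι → ι → ℂ) (M : Matrix (Fin n) (Fin n) ℂ) :
    (blk p u M * blk p w M).trace =
      ∑ i, ∑ k, u i k * w k i * (p i * M * p k * (p k * M * p i)).trace := by
  conv_lhs => rw [blk]
  simp only [Finset.sum_mul, trace_sum]
  refine Finset.sum_congr rfl fun i _ => Finset.sum_congr rfl fun k _ => ?_
  have hi : p i * p i = p i := by simpa using hp.mul_eq i i
  have hk : p k * p k = p k := by simpa using hp.mul_eq k k
  have h1 : (p i * M * p k * blk p w M).trace = (p i * M * p k * (p k * blk p w M * p i)).trace := by
    calc (p i * M * p k * blk p w M).trace = (p i * (p i * M * (p k * p k) * blk p w M)).trace := by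
          rw [hk, ← mul_assoc, ← mul_assoc, ← mul_assoc, hi]
      _ = _ := by
          rw [trace_mul_comm]
          simp only [mul_assoc]
  rw [smul_mul_assoc, trace_smul, h1, mul_blk_mul hp, mul_smul_comm, trace_smul, smul_eq_mul,
    smul_eq_mul, ← mul_assoc (u i k)]

lemma trace_re_isLittleO {f : τ → Matrix (Fin n) (Fin n) ℂ} {g : τ → ℝ} (hf : f =o[l] g) :
    (fun t => (f t).trace.re) =o[l] g :=
  IsBigO.trans_isLittleO (IsBigO.of_bound n (Eventually.of_forall fun t => abs_trace_re_le (f t))) hf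

lemma trace_re_isBigO {f : τ → Matrix (Fin n) (Fin n) ℂ} {g : τ → ℝ} (hf : f =O[l] g) :
    (fun t => (f t).trace.re) =O[l] g :=
  IsBigO.trans (IsBigO.of_bound n (Eventually.of_forall fun t => abs_trace_re_le (f t))) hf

lemma norm_sq_le_sum_blocks {p : ι → Matrix (Fin n) (Fin n) ℂ} (hp : IsResolution p)
    (M : Matrix (Fin n) (Fin n) ℂ) :
    ‖M‖ ^ 2 ≤ (Fintype.card ι : ℝ) ^ 2 * ∑ i, ∑ k, ‖p k * M * p i‖ ^ 2 := by
  have h1 : ‖M‖ ≤ ∑ x : ι × ι, ‖p x.2 * M * p x.1‖ := by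
    rw [Fintype.sum_prod_type]
    have h2 : M = ∑ i, ∑ k, p k * M * p i := by
      simp only [← Finset.sum_mul, ← Finset.mul_sum, hp.sum_eq, one_mul, mul_one]
    conv_lhs => rw [h2]
    exact (norm_sum_le _ _).trans (Finset.sum_le_sum fun i _ => norm_sum_le _ _)
  have h3 := sq_sum_le_card_mul_sum_sq (s := (Finset.univ : Finset (ι × ι)))
    (f := fun x => ‖p x.2 * M * p x.1‖)
  rw [Finset.card_univ, Fintype.card_prod,
    Fintype.sum_prod_type (f := fun x : ι × ι => ‖p x.2 * M * p x.1‖ ^ 2)] at h3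
  calc ‖M‖ ^ 2 ≤ (∑ x : ι × ι, ‖p x.2 * M * p x.1‖) ^ 2 := by gcongr
    _ ≤ _ := by rw [sq (Fintype.card ι : ℝ)]; exact_mod_cast h3

namespace NearNormal

variable (h : NearNormal l lam X P (fun t => ‖gramDefect (P · t)‖))
include h

/-- P_i K P_i equals P_i (P_i* - P_i) P_i, and the first-order part of P_i* - P_i has no diagonal
blocks. -/
lemma diagonal_block_isLittleO (i : ι) :
    (fun t => P i t * gramDefect (P · t) * P i t) =o[l] fun t => ‖gramDefect (P · t)‖ := by
  have h1 := littleO_mul_bigO (bigO_mul_littleO (h.bdd i) (h.star_sub_near i)) (h.bdd i)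
  refine h1.congr_left fun t => ?_
  have hi : P i t * P i t = P i t := by simpa using (h.res t).mul_eq i i
  have h2 : gramDefect (P · t) * P i t = Star.star (P i t) * P i t - P i t := by
    simp only [gramDefect, sub_mul, one_mul, Finset.sum_mul, mul_assoc, (h.res t).mul_eq]
    simp
  rw [mul_sub, sub_mul, mul_blk_mul (h.res t), sub_self, zero_smul, sub_zero, mul_assoc _ _ (P i t),
    mul_assoc _ _ (P i t), h2, sub_mul, hi]

/-- The linear part of P_j* - P_j is a commutator with P_j, which contributes no trace after
multiplication by P_j. Only the quadratic term (P_j* - P_j) K P_j survives. -/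
lemma trace_gramDefect_isBigO :
    (fun t => (gramDefect (P · t)).trace.re) =O[l] fun t => ‖gramDefect (P · t)‖ ^ 2 := by
  have h1 : ∀ j, (fun t => (Star.star (P j t) - P j t) * gramDefect (P · t) * P j t) =O[l]
      fun t => ‖gramDefect (P · t)‖ ^ 2 := by
    intro j
    refine mul_bigO ?_ (h.bdd j)
    simpa [sq] using (h.sa j).mul (gramDefect_isBigO (l := l) (P := P))
  have h2 := trace_re_isBigO ((IsBigO.fun_sum (s := Finset.univ) fun j _ => h1 j).neg_left)
  refine h2.congr_left fun t => ?_
  congr 1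
  have h3 : ∀ j, (-((Star.star (P j t) - P j t) * gramDefect (P · t) * P j t)).trace =
      (Star.star (P j t) * P j t - P j t).trace := by
    intro j
    have hj : P j t * P j t = P j t := by simpa using (h.res t).mul_eq j j
    have e1 : -((Star.star (P j t) - P j t) * gramDefect (P · t) * P j t) =
        (Star.star (P j t) - P j t) * P j t -
        (gramDefect (P · t) * P j t - P j t * gramDefect (P · t)) * P j t := by
      conv_rhs => rw [(h.res t).star_sub j]
      noncomm_ring
    have e2 : ((gramDefect (P · t) * P j t - P j t * gramDefect (P · t)) * P j t).trace = 0 := by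
      rw [sub_mul, trace_sub, mul_assoc, hj, mul_assoc, trace_mul_comm (P j t), mul_assoc, hj,
        sub_self]
    rw [e1, trace_sub, e2, sub_zero, sub_mul, hj]
  calc (-∑ j, (Star.star (P j t) - P j t) * gramDefect (P · t) * P j t).trace
      = ∑ j, (-((Star.star (P j t) - P j t) * gramDefect (P · t) * P j t)).trace := by
        rw [← Finset.sum_neg_distrib, trace_sum]
    _ = (gramDefect (P · t)).trace := by
        simp only [h3]
        rw [← trace_sum, Finset.sum_sub_distrib, (h.res t).sum_eq, gramDefect]

/-- K is self-adjoint and the idempotents nearly so; hence P_i K P_k is nearly the adjoint of P_k K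
P_i. -/
lemma block_trace_near (i k : ι) :
    (fun t => (P i t * gramDefect (P · t) * P k t * (P k t * gramDefect (P · t) * P i t)).trace.re -
      ‖P k t * gramDefect (P · t) * P i t‖ ^ 2) =o[l] fun t => ‖gramDefect (P · t)‖ ^ 2 := by
  have hK := gramDefect_isBigO (l := l) (P := P)
  have h1 := littleO_mul (h.sa_small i) (mul_bigO hK (isBigO_star (h.bdd k)))
  have h2 := mul_littleO (bigO_mul (h.bdd i) hK) (h.sa_small k)
  have h3 := (h1.add h2).mul_isBigO (mul_bigO (bigO_mul (h.bdd k) hK) (h.bdd i))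
  have h4 := trace_re_isLittleO h3.neg_left
  simp only [← sq] at h4
  refine h4.congr_left fun t => ?_
  have h5 : ‖P k t * gramDefect (P · t) * P i t‖ ^ 2 =
      (Star.star (P k t * gramDefect (P · t) * P i t) *
        (P k t * gramDefect (P · t) * P i t)).trace.re := by
    rw [trace_star_mul_self, Complex.ofReal_re]
  rw [h5, ← Complex.sub_re, ← trace_sub]
  congr 2
  rw [star_mul, star_mul, star_gramDefect]
  noncomm_ring

/-- The derivative of the sum of the squared norms of the spectral idempotents is bounded above by
a negative multiple of the square of their Gram defect. -/
theorem exists_trace_le {d₁ d₂ : ι → ι → ℝ} (hd₁ : ∀ i k, d₁ i k = d₁ k i)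
    (hd₂ : ∀ i k, d₂ i k = d₂ k i) {γ : ℝ} (hγ0 : 0 < γ)
    (hγ : ∀ i k, i ≠ k → γ ≤ (d₁ i k + d₂ i k) * ‖lam i - lam k‖ ^ 2)
    {Φ : τ → Matrix (Fin n) (Fin n) ℂ}
    (hΦ : ∀ j, (fun t => Φ t * P j t - P j t * Φ t -
      blk (P · t) (fun i k => (d₁ i k * lam k - d₂ i k * lam i) *
        ((Star.star (lam k) - Star.star (lam i)) *
        ((Pi.single j 1 : ι → ℂ) k - (Pi.single j 1 : ι → ℂ) i))) (gramDefect (P · t))) =o[l]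
      fun t => ‖gramDefect (P · t)‖) :
    ∃ c, 0 < c ∧ ∀ᶠ t in l, ∑ j, (Star.star (P j t) * (Φ t * P j t - P j t * Φ t)).trace.re ≤
      -c * ‖gramDefect (P · t)‖ ^ 2 := by
  set K := fun t => gramDefect (P · t) with hKdef
  have hK : K =O[l] fun t => ‖K t‖ := gramDefect_isBigO
  set e : ι → ι → ι → ℂ := fun j i k => (Pi.single j 1 : ι → ℂ) k - (Pi.single j 1 : ι → ℂ) i
    with he
  set w : ι → ι → ι → ℂ := fun j i k => (d₁ i k * lam k - d₂ i k * lam i) *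
    ((Star.star (lam k) - Star.star (lam i)) * e j i k) with hw
  set tr : ι → ι → τ → ℂ := fun i k t => (P i t * K t * P k t * (P k t * K t * P i t)).trace with htr
  have htr_comm : ∀ i k t, tr i k t = tr k i t := fun i k t => trace_mul_comm _ _
  have step1 : ∀ j, (fun t => (Star.star (P j t) * (Φ t * P j t - P j t * Φ t)).trace.re -
      (blk (P · t) (e j) (K t) * blk (P · t) (w j) (K t)).trace.re) =o[l] fun t => ‖K t‖ ^ 2 := by
    intro j
    have hΦO : (fun t => Φ t * P j t - P j t * Φ t) =O[l] fun t => ‖K t‖ := by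
      exact ((hΦ j).isBigO.add (blk_isBigO h.bdd (w j) hK)).congr_left fun t => sub_add_cancel _ _
    have h1 := (h.star_sub_near j).mul_isBigO hΦO
    have h2 := (blk_isBigO h.bdd (e j) hK).mul_isLittleO (hΦ j)
    refine (trace_re_isLittleO (h1.add h2)).congr (fun t => ?_) fun t => (sq _).symm
    have hj : P j t * P j t = P j t := by simpa using (h.res t).mul_eq j j
    have e0 : (P j t * (Φ t * P j t - P j t * Φ t)).trace = 0 := by
      rw [mul_sub, trace_sub, ← mul_assoc (P j t) (P j t), hj, ← mul_assoc, trace_mul_comm _ (P j t),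
        ← mul_assoc, hj, sub_self]
    have e1 : (Star.star (P j t) * (Φ t * P j t - P j t * Φ t)).trace =
        ((Star.star (P j t) - P j t) * (Φ t * P j t - P j t * Φ t)).trace := by
      rw [sub_mul, trace_sub, e0, sub_zero]
    rw [e1, ← Complex.sub_re, ← trace_sub]
    congr 2
    simp only [hw, he, hKdef]
    noncomm_ring
  have step2 : ∀ t, ∑ j, (blk (P · t) (e j) (K t) * blk (P · t) (w j) (K t)).trace.re =
      -∑ i, ∑ k, (d₁ i k + d₂ i k) * ‖lam i - lam k‖ ^ 2 * (tr i k t).re := by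
    intro t
    -- Only j = i and j = k contribute, each -1.
    have e1 : ∀ i k, i ≠ k → ∑ j, e j i k * e j k i = -2 := by
      intro i k hik
      have : ∀ j, e j i k * e j k i = -(Pi.single j 1 : ι → ℂ) k - (Pi.single j 1 : ι → ℂ) i := by
        intro j
        simp only [he, Pi.single_apply]
        by_cases h1 : k = j <;> by_cases h2 : i = j
        · exact absurd (h2.trans h1.symm) hik
        all_goals simp [h1, h2]
      simp only [this, Finset.sum_sub_distrib, Finset.sum_neg_distrib, Pi.single_apply,
        Finset.sum_ite_eq, Finset.mem_univ, if_true]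
      norm_num
    set f : ι → ι → ℂ := fun i k => (d₁ k i * lam i - d₂ k i * lam k) *
      (Star.star (lam i) - Star.star (lam k)) with hf
    have e2 : ∑ j, (blk (P · t) (e j) (K t) * blk (P · t) (w j) (K t)).trace =
        -2 * ∑ i, ∑ k, f i k * tr i k t := by
      simp only [trace_blk_mul_blk (h.res t)]
      rw [Finset.sum_comm, Finset.mul_sum]
      refine Finset.sum_congr rfl fun i _ => ?_
      rw [Finset.sum_comm, Finset.mul_sum]
      refine Finset.sum_congr rfl fun k _ => ?_
      rw [← Finset.sum_mul]
      change _ * tr i k t = _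
      rw [← mul_assoc]
      congr 1
      by_cases hik : i = k
      · subst hik; simp [hf, hw]
      · rw [← e1 i k hik, Finset.sum_mul]
        refine Finset.sum_congr rfl fun j _ => ?_
        simp only [hw, hf]
        ring
    have e3 : ∑ i, ∑ k, f i k * tr i k t = ∑ i, ∑ k, f k i * tr i k t := by
      rw [Finset.sum_comm]
      refine Finset.sum_congr rfl fun i _ => Finset.sum_congr rfl fun k _ => ?_
      rw [htr_comm]
    -- Symmetrizing in (i,k) removes the nonreal part of the coefficients and exhibits the positive
    -- weight. The factor 2 from the previous sum is used up here.
    have e4 : ∀ i k, f i k + f k i = (((d₁ i k + d₂ i k) * ‖lam i - lam k‖ ^ 2 : ℝ) : ℂ) := by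
      intro i k
      have : ((‖lam i - lam k‖ ^ 2 : ℝ) : ℂ) = (lam i - lam k) * Star.star (lam i - lam k) := by
        rw [← Complex.normSq_eq_norm_sq, Complex.star_def, Complex.mul_conj]
      rw [Complex.ofReal_mul, this, star_sub]
      simp only [hf, hd₁ k i, hd₂ k i]
      push_cast
      ring
    have e5 : ∑ j, (blk (P · t) (e j) (K t) * blk (P · t) (w j) (K t)).trace =
        -∑ i, ∑ k, (((d₁ i k + d₂ i k) * ‖lam i - lam k‖ ^ 2 : ℝ) : ℂ) * tr i k t := by
      have e6 : ∀ i k, (((d₁ i k + d₂ i k) * ‖lam i - lam k‖ ^ 2 : ℝ) : ℂ) * tr i k t =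
          f i k * tr i k t + f k i * tr i k t := fun i k => by rw [← e4, add_mul]
      simp only [e2, e6, Finset.sum_add_distrib]
      rw [← e3]
      ring
    rw [← Complex.re_sum, e5]
    simp only [Complex.neg_re, Complex.re_sum, Complex.re_ofReal_mul]
  have step3 : (fun t => ∑ i, ∑ k, (d₁ i k + d₂ i k) * ‖lam i - lam k‖ ^ 2 *
      ((tr i k t).re - ‖P k t * K t * P i t‖ ^ 2)) =o[l] fun t => ‖K t‖ ^ 2 :=
    IsLittleO.fun_sum fun i _ => IsLittleO.fun_sum fun k _ =>
      (h.block_trace_near i k).const_mul_left _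
  have step4 : (fun t => γ * ∑ i, ‖P i t * K t * P i t‖ ^ 2) =o[l] fun t => ‖K t‖ ^ 2 :=
    (IsLittleO.fun_sum fun i _ =>
      (h.diagonal_block_isLittleO i).norm_left.pow two_pos).const_mul_left γ
  have step5 := IsLittleO.fun_sum (s := Finset.univ) fun j _ => step1 j
  set N : ℝ := (Fintype.card ι : ℝ) with hN
  refine ⟨γ / (2 * (N ^ 2 + 1)), by positivity, ?_⟩
  -- Three error terms, each allowed a sixth of the main term, leave half of it.
  have hc : 0 < γ / (6 * (N ^ 2 + 1)) := by positivity
  filter_upwards [step3.bound hc, step4.bound hc, step5.bound hc] with t h3 h4 h5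
  rw [Real.norm_eq_abs, Real.norm_eq_abs, abs_of_nonneg (sq_nonneg ‖K t‖)] at h3 h4 h5
  rw [Finset.sum_sub_distrib, step2] at h5
  simp only [mul_sub, Finset.sum_sub_distrib] at h3
  have h6 : γ * ∑ i, ∑ k, ‖P k t * K t * P i t‖ ^ 2 - γ * ∑ i, ‖P i t * K t * P i t‖ ^ 2 ≤
      ∑ i, ∑ k, (d₁ i k + d₂ i k) * ‖lam i - lam k‖ ^ 2 * ‖P k t * K t * P i t‖ ^ 2 := by
    rw [← mul_sub, ← Finset.sum_sub_distrib, Finset.mul_sum]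
    refine Finset.sum_le_sum fun i _ => ?_
    rw [← Finset.sum_erase_add _ _ (Finset.mem_univ i), add_sub_cancel_right,
      ← Finset.sum_erase_add _ _ (Finset.mem_univ i), sub_self, norm_zero, zero_pow two_ne_zero,
      mul_zero, zero_mul, add_zero, Finset.mul_sum]
    refine Finset.sum_le_sum fun k hk => ?_
    have := hγ i k (Finset.ne_of_mem_erase hk).symm
    gcongr
  have h7 := norm_sq_le_sum_blocks (h.res t) (K t)
  have h8 : γ / (N ^ 2 + 1) * ‖K t‖ ^ 2 ≤ γ * ∑ i, ∑ k, ‖P k t * K t * P i t‖ ^ 2 := by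
    rw [div_mul_eq_mul_div, div_le_iff₀ (by positivity), mul_assoc]
    refine mul_le_mul_of_nonneg_left ?_ hγ0.le
    have : 0 ≤ ∑ i, ∑ k, ‖P k t * K t * P i t‖ ^ 2 := by positivity
    linarith
  have h9 : γ / (N ^ 2 + 1) = 6 * (γ / (6 * (N ^ 2 + 1))) := by field_simp
  have h10 : γ / (2 * (N ^ 2 + 1)) = 3 * (γ / (6 * (N ^ 2 + 1))) := by field_simp; norm_num
  rw [h9] at h8
  rw [h10]
  have := abs_le.1 h3
  have := abs_le.1 h4
  have := abs_le.1 h5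
  linarith

end NearNormal

end Lyapunov

/-! ### Positivity of the slopes. -/

section Slopes

open Set Filter

lemma sqSlope_add_pos {b : ℝ} {φ₁ φ₂ : ℝ → ℝ} (hφ : CondC1 0 b φ₁ φ₂) {x y : ℝ} (hx : x ∈ Icc 0 b)
    (hy : y ∈ Icc 0 b) (hxy : x ≠ 0 ∨ y ≠ 0) : 0 < sqSlope b φ₁ x y + sqSlope b φ₂ x y := by
  have key : ∀ {x y : ℝ}, x ∈ Icc 0 b → y ∈ Icc 0 b → x < y →
      0 < sqSlope b φ₁ x y + sqSlope b φ₂ x y := by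
    intro x y hx hy hlt
    have h1 := hφ.strictMonoOn_add hx hy hlt
    have h2 : x ^ 2 < y ^ 2 := pow_lt_pow_left₀ hlt hx.1 two_ne_zero
    simp only at h1
    rw [sqSlope, sqSlope, if_neg hlt.ne, if_neg hlt.ne, ← add_div]
    exact div_pos_of_neg_of_neg (by linarith) (by linarith)
  rcases lt_trichotomy x y with h | h | h
  · exact key hx hy h
  · subst h
    have hx0 : x ≠ 0 := by tauto
    have hpos : 0 < x := lt_of_le_of_ne hx.1 hx0.symm
    rw [sqSlope, sqSlope, if_pos rfl, if_pos rfl, ← add_div]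
    exact div_pos (hφ.deriv_pos x ⟨hx, hx0⟩) (by positivity)
  · rw [sqSlope_comm, sqSlope_comm b φ₂]
    exact key hy hx h

lemma exists_pos_forall_le {α : Type*} [Finite α] (f : α → ℝ) :
    ∃ γ : ℝ, 0 < γ ∧ ∀ a, 0 < f a → γ ≤ f a := by
  have : ∀ᶠ γ in 𝓝[>] (0 : ℝ), ∀ a, 0 < f a → γ ≤ f a := by
    rw [eventually_all]
    intro a
    by_cases ha : 0 < f a
    · filter_upwards [Ioc_mem_nhdsGT ha] with γ hγ _ using hγ.2
    · exact Eventually.of_forall fun _ h => absurd h ha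
  obtain ⟨γ, h, hγ⟩ := (this.and self_mem_nhdsWithin).exists
  exact ⟨γ, hγ, h⟩

end Slopes

/-! ### Self-adjointness of the idempotents up to O(‖K‖). -/

section Construction

open Asymptotics Filter Set

variable {τ ι E : Type*} [Fintype ι] [DecidableEq ι] [NormedRing E] [NormedAlgebra ℂ E]
  [StarRing E] {l : Filter τ} {lam : ι → ℂ} {X : τ → E} {P : ι → τ → E}

lemma NearNormal.of_tendsto_gramDefect (hres : ∀ t, IsResolution (P · t))
    (hcomm : ∀ t i, X t * P i t = P i t * X t) (hbdd : ∀ i, P i =O[l] fun _ => (1 : ℝ))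
    (hnear : (fun t => X t - lin (P · t) lam) =o[l] fun _ => (1 : ℝ))
    (hsmall : Tendsto (fun t => ‖gramDefect (P · t)‖) l (𝓝 0)) :
    NearNormal l lam X P (fun t => ‖gramDefect (P · t)‖) where
  res := hres
  comm := hcomm
  bdd := hbdd
  near := hnear
  small := (isLittleO_one_iff ℝ).2 hsmall
  sa i := by
    obtain ⟨C, hC, hb⟩ := (hbdd i).exists_nonneg
    -- Once ‖K‖ < 1/2, the quadratic term in the formula for P_i* - P_i is absorbed into the left
    -- side, doubling the constant 2C.
    refine IsBigO.of_bound (4 * C) ?_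
    filter_upwards [hb.bound, hsmall (Iio_mem_nhds (show (0 : ℝ) < 1 / 2 by norm_num))] with t h1 h2
    rw [norm_one, mul_one] at h1
    replace h2 : ‖gramDefect (P · t)‖ < 1 / 2 := h2
    rw [norm_norm]
    have h3 : ‖Star.star (P i t) - P i t‖ ≤ 2 * ‖gramDefect (P · t)‖ * ‖P i t‖ +
        ‖Star.star (P i t) - P i t‖ * ‖gramDefect (P · t)‖ := by
      conv_lhs => rw [(hres t).star_sub i]
      exact (norm_sub_le _ _).trans (add_le_add (norm_commutator_le _ _) (norm_mul_le _ _))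
    have h4 : ‖Star.star (P i t) - P i t‖ * ‖gramDefect (P · t)‖ ≤
        ‖Star.star (P i t) - P i t‖ * (1 / 2) := by
      gcongr
    have h5 : 2 * ‖gramDefect (P · t)‖ * ‖P i t‖ ≤ 2 * ‖gramDefect (P · t)‖ * C := by gcongr
    linarith

end Construction

/-! ### Finite length from a Lyapunov function. -/

section Convergence

open Filter Set

variable {F : Type*} [NormedAddCommGroup F] [NormedSpace ℝ F] [CompleteSpace F]

/-- If a Lyapunov function decreases at least as fast as the square of the speed of a curve, and is
bounded above by a multiple of that square, then the curve converges. -/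
theorem exists_tendsto_of_lyapunov {W W' κ : ℝ → ℝ} {p p' : ℝ → F} {t₀ c C D : ℝ} (hc : 0 < c)
    (hC : 0 < C) (hD : 0 < D) (hW : ∀ t, t₀ ≤ t → HasDerivAt W (W' t) t)
    (hW' : ∀ t, t₀ ≤ t → W' t ≤ -c * κ t ^ 2) (hWκ : ∀ t, t₀ ≤ t → W t ≤ C * κ t ^ 2)
    (hW0 : Tendsto W atTop (𝓝 0)) (hp : ∀ t, t₀ ≤ t → HasDerivAt p (p' t) t)
    (hp' : ∀ t, t₀ ≤ t → ‖p' t‖ ≤ D * κ t) : ∃ q, Tendsto p atTop (𝓝 q) := by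
  have hanti : AntitoneOn W (Ici t₀) := by
    refine antitoneOn_of_hasDerivWithinAt_nonpos (f' := W') (convex_Ici t₀)
      (fun t ht => (hW t ht).continuousAt.continuousWithinAt) (fun t ht => ?_) fun t ht => ?_
    · exact (hW t (interior_subset ht)).hasDerivWithinAt
    · exact (hW' t (interior_subset ht)).trans (by nlinarith [sq_nonneg (κ t)])
  have hWnn : ∀ t, t₀ ≤ t → 0 ≤ W t := fun t ht =>
    le_of_tendsto hW0 ((eventually_ge_atTop t).mono fun s hs => hanti ht (ht.trans hs) hs)
  -- With this η, ηW uses at most half of the decay c κ², so W decays exponentially.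
  set η := c / (2 * C) with hη
  have hη0 : 0 < η := by positivity
  -- B is a barrier for the curve: its derivative dominates Dκ by the inequality 2κ ≤ e^(-ηt) +
  -- e^(ηt) κ², and B ≤ 0. A bounded barrier makes the curve Cauchy.
  set B : ℝ → ℝ := fun t =>
    -(D / (2 * η) * Real.exp (-(η * t))) - D / c * (Real.exp (η * t) * W t) with hB
  set B' : ℝ → ℝ := fun t => D / 2 * Real.exp (-(η * t)) -
    D / c * (Real.exp (η * t) * (η * W t + W' t)) with hB'
  have hBd : ∀ t, t₀ ≤ t → HasDerivAt B (B' t) t := by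
    intro t ht
    have h1 : HasDerivAt (fun t => Real.exp (-(η * t))) (Real.exp (-(η * t)) * (-(η * 1))) t :=
      ((hasDerivAt_id t).const_mul η).neg.exp
    have h2 : HasDerivAt (fun t => Real.exp (η * t)) (Real.exp (η * t) * (η * 1)) t :=
      ((hasDerivAt_id t).const_mul η).exp
    refine (((h1.const_mul (D / (2 * η))).neg).sub
      ((h2.mul (hW t ht)).const_mul (D / c))).congr_deriv ?_
    simp only [hB']
    field_simp
  have hbound : ∀ t, t₀ ≤ t → ‖p' t‖ ≤ B' t := by
    intro t ht
    refine (hp' t ht).trans ?_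
    set x := Real.exp (-(η * t)) with hx
    set y := Real.exp (η * t) with hy
    have hy0 : 0 < y := Real.exp_pos _
    have hxy : y * x = 1 := by rw [hx, hy, ← Real.exp_add, add_neg_cancel, Real.exp_zero]
    have h1 : η * W t + W' t ≤ -(c / 2) * κ t ^ 2 := by
      have h2 : η * W t ≤ c / 2 * κ t ^ 2 := by
        calc η * W t ≤ η * (C * κ t ^ 2) := by gcongr; exact hWκ t ht
          _ = _ := by rw [hη]; field_simp
      linarith [hW' t ht]
    have h3 : D / c * (y * (η * W t + W' t)) ≤ D / c * (y * (-(c / 2) * κ t ^ 2)) := by gcongr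
    have h4 : D / c * (y * (-(c / 2) * κ t ^ 2)) = -(D / 2) * (y * κ t ^ 2) := by field_simp
    have h5 : 2 * κ t ≤ x + y * κ t ^ 2 := by
      have h6 : y * (x - κ t) ^ 2 = (y * x) * x - 2 * (y * x) * κ t + y * κ t ^ 2 := by ring
      rw [hxy] at h6
      have := mul_nonneg hy0.le (sq_nonneg (x - κ t))
      linarith
    have h7 : D / 2 * (2 * κ t) ≤ D / 2 * (x + y * κ t ^ 2) := by gcongr
    simp only [hB', ← hx, ← hy]
    linarith
  have hdiff : ∀ s t, t₀ ≤ s → s ≤ t → ‖p t - p s‖ ≤ B t - B s := by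
    intro s t hs hst
    refine image_norm_le_of_norm_deriv_right_le_deriv_boundary' (f := fun t => p t - p s)
      (f' := p') (B := fun t => B t - B s) (B' := B') (a := s) (b := t) ?_ ?_ (by simp) ?_ ?_ ?_
      ⟨hst, le_rfl⟩
    · exact fun x hx => ((hp x (hs.trans hx.1)).sub_const _).continuousAt.continuousWithinAt
    · exact fun x hx => ((hp x (hs.trans hx.1)).sub_const _).hasDerivWithinAt
    · exact fun x hx => ((hBd x (hs.trans hx.1)).sub_const _).continuousAt.continuousWithinAt
    · exact fun x hx => ((hBd x (hs.trans hx.1)).sub_const _).hasDerivWithinAt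
    · exact fun x hx => hbound x (hs.trans hx.1)
  have hBneg : ∀ t, t₀ ≤ t → B t ≤ 0 := by
    intro t ht
    have h1 : 0 ≤ D / (2 * η) * Real.exp (-(η * t)) := by positivity
    have h2 : 0 ≤ D / c * (Real.exp (η * t) * W t) :=
      mul_nonneg (by positivity) (mul_nonneg (Real.exp_pos _).le (hWnn t ht))
    simp only [hB]
    linarith
  refine cauchySeq_tendsto_of_complete (Metric.cauchySeq_iff'.2 fun ε hε => ?_)
  set S := B '' Ici t₀ with hS
  have hbdd : BddAbove S := ⟨0, by rintro _ ⟨t, ht, rfl⟩; exact hBneg t ht⟩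
  obtain ⟨_, ⟨s, hs, rfl⟩, hlt⟩ := exists_lt_of_lt_csSup
    (show S.Nonempty from ⟨B t₀, t₀, self_mem_Ici, rfl⟩)
    (show sSup S - ε < sSup S by linarith)
  refine ⟨s, fun t ht => ?_⟩
  rw [dist_eq_norm]
  have h1 := hdiff s t hs ht
  have h2 : B t ≤ sSup S := le_csSup hbdd ⟨t, le_trans hs ht, rfl⟩
  linarith

end Convergence

/-! ### Commutators of φ(X) with the idempotents. -/

section Phi

open Asymptotics Filter Set Matrix
open scoped Matrix.Norms.Frobenius

variable {n : ℕ} {τ ι : Type*} [Fintype ι] [DecidableEq ι] {l : Filter τ} {lam : ι → ℂ}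
  {X : τ → Matrix (Fin n) (Fin n) ℂ} {P : ι → τ → Matrix (Fin n) (Fin n) ℂ}

namespace NearNormal

variable (h : NearNormal l lam X P (fun t => ‖gramDefect (P · t)‖))
include h

lemma phi_commutator_near {b : ℝ} (hinj : Function.Injective lam)
    (hmem : ∀ t, X t ∈ matricesIn n 0 b) (hlam : ∀ i, ‖lam i‖ ∈ Icc 0 b) {φ₁ φ₂ : ℝ → ℝ}
    (h₁ : ContDiffOn ℝ 1 φ₁ (Icc 0 b)) (h₂ : ContDiffOn ℝ 1 φ₂ (Icc 0 b)) (j : ι) :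
    (fun t => phi φ₁ φ₂ (X t) * P j t - P j t * phi φ₁ φ₂ (X t) -
      blk (P · t) (fun i k => (sqSlope b φ₁ ‖lam i‖ ‖lam k‖ * lam k -
        sqSlope b φ₂ ‖lam i‖ ‖lam k‖ * lam i) * ((Star.star (lam k) - Star.star (lam i)) *
        ((Pi.single j 1 : ι → ℂ) k - (Pi.single j 1 : ι → ℂ) i))) (gramDefect (P · t))) =o[l]
      fun t => ‖gramDefect (P · t)‖ := by
  have f1 := h.cfc_commutator_near hinj hmem hlam h₁ j
  have f2 := h.cfc_star_commutator_near hinj hmem hlam h₂ j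
  have g1 := blk_isLittleO h.bdd (fun i k => (sqSlope b φ₁ ‖lam i‖ ‖lam k‖ : ℂ))
    (h.abs_sq_commutator_near j)
  have g2 := blk_isLittleO h.bdd (fun i k => (sqSlope b φ₂ ‖lam i‖ ‖lam k‖ : ℂ))
    (h.abs_star_sq_commutator_near j)
  refine ((f1.add g1).sub (f2.add g2)).congr_left fun t => ?_
  simp only [sub_mul (sqSlope b φ₁ _ _ * _ : ℂ), mul_assoc (sqSlope b _ _ _ : ℂ), blk_sub_coeff,
    ← blk_blk (h.res t), blk_sub]
  rw [phi, sub_mul, mul_sub]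
  abel

theorem exists_trace_phi_le {b : ℝ} (hinj : Function.Injective lam)
    (hmem : ∀ t, X t ∈ matricesIn n 0 b) (hlam : ∀ i, ‖lam i‖ ∈ Icc 0 b) {φ₁ φ₂ : ℝ → ℝ}
    (hφ : CondC1 0 b φ₁ φ₂) : ∃ c, 0 < c ∧ ∀ᶠ t in l,
      ∑ j, (Star.star (P j t) * (phi φ₁ φ₂ (X t) * P j t - P j t * phi φ₁ φ₂ (X t))).trace.re ≤
      -c * ‖gramDefect (P · t)‖ ^ 2 := by
  obtain ⟨γ, hγ0, hγ⟩ := exists_pos_forall_le (fun x : ι × ι =>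
    (sqSlope b φ₁ ‖lam x.1‖ ‖lam x.2‖ + sqSlope b φ₂ ‖lam x.1‖ ‖lam x.2‖) *
      ‖lam x.1 - lam x.2‖ ^ 2)
  refine h.exists_trace_le (d₁ := fun i k => sqSlope b φ₁ ‖lam i‖ ‖lam k‖)
    (d₂ := fun i k => sqSlope b φ₂ ‖lam i‖ ‖lam k‖) (fun i k => sqSlope_comm _ _ _ _)
    (fun i k => sqSlope_comm _ _ _ _) hγ0 (fun i k hik => hγ (i, k) ?_)
    (h.phi_commutator_near hinj hmem hlam hφ.contDiffOn₁ hφ.contDiffOn₂)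
  have hne : lam i ≠ lam k := hinj.ne hik
  refine mul_pos (sqSlope_add_pos hφ (hlam i) (hlam k) ?_) ?_
  -- Distinct eigenvalues cannot both be 0, which is what positivity of the slope sum needs.
  · by_contra! h0
    exact hne ((norm_eq_zero.1 h0.1).trans (norm_eq_zero.1 h0.2).symm)
  · have := norm_pos_iff.2 (sub_ne_zero.2 hne)
    positivity

end NearNormal

end Phi

/-! ### Convergence of the flow to a normal matrix. -/

section FlowConvergence

open Asymptotics Filter Set Matrix Polynomial
open scoped Matrix.Norms.Frobenius

variable {n : ℕ}

lemma gramDefect_aeval_of_isStarNormal {ι : Type*} [Fintype ι] [DecidableEq ι] {p : ι → ℂ[X]}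
    {Z : Matrix (Fin n) (Fin n) ℂ} (hZ : IsStarNormal Z)
    (hp : IsResolution fun i => aeval Z (p i)) : gramDefect (fun i => aeval Z (p i)) = 0 := by
  have hi : ∀ i, aeval Z (p i) * aeval Z (p i) = aeval Z (p i) := fun i => by
    simpa using hp.mul_eq i i
  simp only [gramDefect, fun i => isSelfAdjoint_of_normal_idempotent (isStarNormal_aeval hZ (p i))
    (hi i), hi, hp.sum_eq, sub_self]

theorem exists_tendsto_flow {b : ℝ} (hb : 0 ≤ b) {φ₁ φ₂ : ℝ → ℝ} (hφ : CondC1 0 b φ₁ φ₂)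
    {T : Matrix (Fin n) (Fin n) ℂ} (hT : T ∈ matricesIn n 0 b)
    {X : ℝ → Matrix (Fin n) (Fin n) ℂ} (hsol : IsGlobalSolution 0 b φ₁ φ₂ T X)
    (hX : ∀ t, 0 ≤ t → HasDerivAt X (phi (constExtend b φ₁) (constExtend b φ₂) (X t) * X t -
        X t * phi (constExtend b φ₁) (constExtend b φ₂) (X t)) t)
    (hanti : Antitone (fun t => (star (X t) * X t).trace.re)) :
    ∃ N : Matrix (Fin n) (Fin n) ℂ, IsStarNormal N ∧ Tendsto X atTop (𝓝 N) := by
  obtain ⟨s, q, p, hroot, hq, hp⟩ := exists_spectral_polynomials T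
  obtain ⟨c₁, hc₁, hb₁⟩ := exists_abs_constExtend_le hb hφ.monotoneOn₁
  obtain ⟨c₂, hc₂, hb₂⟩ := exists_abs_constExtend_le hb hφ.monotoneOn₂
  have hlim := tendsto_trace_phi_of_flow hb hφ.toCondCL hsol.mem hX hanti
  have hqX : ∀ t, 0 ≤ t → aeval (X t) q = 0 := fun t ht =>
    eq_zero_of_commutator_ode (M := fun t => aeval (X t) q)
      (φ := fun t => phi (constExtend b φ₁) (constExtend b φ₂) (X t))
      (C := 2 * max c₁ c₂ * ‖(1 : Matrix (Fin n) (Fin n) ℂ)‖)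
      (fun t _ => norm_phi_le (le_max_of_le_left hc₁) (fun x => (hb₁ x).trans (le_max_left _ _))
        (fun x => (hb₂ x).trans (le_max_right _ _)) _)
      (fun t ht => hasDerivAt_aeval_commutator (hX t ht) q) (by rw [hsol.initial, hq]) ht
  have hX' : ∀ t, 0 ≤ t → HasDerivAt X (phi φ₁ φ₂ (X t) * X t - X t * phi φ₁ φ₂ (X t)) t := by
    intro t ht
    have := hX t ht
    rwa [phi_constExtend (hsol.mem t ht)] at this
  -- Used for three observables that vanish on normal Z with q(Z) = 0: the Gram defect, the
  -- nilpotent part Z - Σ λ_i P_i, and the self-commutator.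
  have hlaSalle : ∀ {F : Type} [TopologicalSpace F] {Ψ : Matrix (Fin n) (Fin n) ℂ → F},
      Continuous Ψ → ∀ {c : F}, (∀ Z, IsStarNormal Z → aeval Z q = 0 → Ψ Z = c) →
      Tendsto (fun t => Ψ (X t)) atTop (𝓝 c) := by
    intro F _ Ψ hΨ c hc
    exact tendsto_of_forall_normal hb hφ.toCondCL hsol.mem hlim hqX hΨ hc
  have hres : ∀ Z : Matrix (Fin n) (Fin n) ℂ, aeval Z q = 0 →
      IsResolution fun i => aeval Z (p i) := fun Z hZ => ⟨(hp Z hZ).1, (hp Z hZ).2.1⟩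
  set lam : s → ℂ := Subtype.val with hlamdef
  have hnil : ∀ Z : Matrix (Fin n) (Fin n) ℂ, IsStarNormal Z → aeval Z q = 0 →
      Z - lin (fun i => aeval Z (p i)) lam = 0 := by
    intro Z hZ hZq
    refine eq_zero_of_normal_nilpotent ?_ (hp Z hZq).2.2
    have e1 : Z - ∑ i : s, (i : ℂ) • aeval Z (p i) =
        aeval Z (Polynomial.X - ∑ i : s, (i : ℂ) • p i) := by simp
    exact e1 ▸ isStarNormal_aeval hZ _
  have hcontp : ∀ i, Continuous fun Z : Matrix (Fin n) (Fin n) ℂ => aeval Z (p i) := fun i =>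
    continuous_aeval_matrix (p i)
  have hcontlin : Continuous fun Z : Matrix (Fin n) (Fin n) ℂ =>
      lin (fun i => aeval Z (p i)) lam := by
    unfold lin
    exact continuous_finsetSum _ fun i _ => by
      have := hcontp i
      fun_prop
  have hcontK : Continuous fun Z : Matrix (Fin n) (Fin n) ℂ =>
      gramDefect fun i => aeval Z (p i) := by
    unfold gramDefect
    exact (continuous_finsetSum _ fun i _ => (continuous_star.comp (hcontp i)).mul (hcontp i)).sub
      continuous_const
  have hKlim := hlaSalle hcontK fun Z hZ hZq => gramDefect_aeval_of_isStarNormal hZ (hres Z hZq)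
  have hYlim := hlaSalle (continuous_id.sub hcontlin) fun Z hZ hZq => hnil Z hZ hZq
  have hNlim := hlaSalle (Ψ := fun Z => star Z * Z - Z * star Z) (by fun_prop) (c := 0)
    fun Z hZ _ => sub_eq_zero.2 hZ.star_comm_self.eq
  -- Freezing X at negative times makes the algebraic clauses of `NearNormal` hold for every t.
  set Xt : ℝ → Matrix (Fin n) (Fin n) ℂ := fun t => X (max t 0) with hXt
  have hXt_eq : ∀ t, 0 ≤ t → Xt t = X t := fun t ht => by simp only [hXt, max_eq_left ht]
  have hXt_ev : Xt =ᶠ[atTop] X := (eventually_ge_atTop 0).mono hXt_eq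
  set P : s → ℝ → Matrix (Fin n) (Fin n) ℂ := fun i t => aeval (Xt t) (p i) with hP
  have hKt : Tendsto (fun t => gramDefect (P · t)) atTop (𝓝 0) :=
    hKlim.congr' (hXt_ev.mono fun t ht => by simp only [hP, ht])
  have hYt : Tendsto (fun t => Xt t - lin (P · t) lam) atTop (𝓝 0) :=
    hYlim.congr' (hXt_ev.mono fun t ht => by simp only [hP, ht, Pi.sub_apply, id])
  have hbdd : ∀ i, P i =O[atTop] fun _ => (1 : ℝ) := by
    intro i
    obtain ⟨C, hC⟩ := (isCompact_closedBall (0 : Matrix (Fin n) (Fin n) ℂ)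
      (n * b)).exists_bound_of_continuousOn (hcontp i).continuousOn
    refine IsBigO.of_bound C (Eventually.of_forall fun t => ?_)
    rw [norm_one, mul_one]
    exact hC _ (mem_closedBall_zero_iff.2
      (norm_le_of_mem_matricesIn hb (hsol.mem _ (le_max_right _ _))))
  have hNN : NearNormal atTop lam Xt P (fun t => ‖gramDefect (P · t)‖) :=
    NearNormal.of_tendsto_gramDefect (fun t => hres _ (hqX _ (le_max_right _ _)))
      (fun t i => (commute_aeval (Commute.refl _) (p i)).eq) hbdd ((isLittleO_one_iff ℝ).2 hYt)
      (tendsto_zero_iff_norm_tendsto_zero.1 hKt)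
  have hmemt : ∀ t, Xt t ∈ matricesIn n 0 b := fun t => hsol.mem _ (le_max_right _ _)
  have hlam : ∀ i, ‖lam i‖ ∈ Icc 0 b := fun i =>
    ⟨norm_nonneg _, norm_root_charpoly_le hb hT (hroot _ i.2)⟩
  obtain ⟨c, hc, hlyap⟩ := hNN.exists_trace_phi_le Subtype.val_injective hmemt hlam hφ
  obtain ⟨C, hC, hbig⟩ := hNN.trace_gramDefect_isBigO.exists_pos
  have hderivX : ∀ t, 0 < t →
      HasDerivAt Xt (phi φ₁ φ₂ (Xt t) * Xt t - Xt t * phi φ₁ φ₂ (Xt t)) t := by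
    intro t ht
    rw [hXt_eq t ht.le]
    exact (hX' t ht.le).congr_of_eventuallyEq ((lt_mem_nhds ht).mono fun s hs => hXt_eq s hs.le)
  have hderivP : ∀ i t, 0 < t →
      HasDerivAt (P i) (phi φ₁ φ₂ (Xt t) * P i t - P i t * phi φ₁ φ₂ (Xt t)) t := fun i t ht =>
    hasDerivAt_aeval_commutator (hderivX t ht) (p i)
  set W : ℝ → ℝ := fun t => (gramDefect (P · t)).trace.re with hW
  set W' : ℝ → ℝ := fun t => 2 * ∑ i, (star (P i t) *
    (phi φ₁ φ₂ (Xt t) * P i t - P i t * phi φ₁ φ₂ (Xt t))).trace.re with hW'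
  have hderivW : ∀ t, 0 < t → HasDerivAt W (W' t) t := by
    intro t ht
    have h1 : ∀ i, HasDerivAt (fun t => (star (P i t) * P i t).trace.re)
        (2 * (star (P i t) * (phi φ₁ φ₂ (Xt t) * P i t - P i t * phi φ₁ φ₂ (Xt t))).trace.re) t := by
      intro i
      have h2 := hderivP i t ht
      refine (hasDerivAt_trace_re ((HasDerivAt.star h2).mul h2)).congr_deriv ?_
      have h3 : ∀ M : Matrix (Fin n) (Fin n) ℂ,
          (star M * P i t).trace.re = (star (P i t) * M).trace.re := by
        intro M
        have h4 : star M * P i t = (star (P i t) * M)ᴴ := by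
          rw [← star_eq_conjTranspose, star_mul, star_star]
        rw [h4, trace_conjTranspose, Complex.star_def, Complex.conj_re]
      rw [trace_add, Complex.add_re, h3]
      ring
    have h2 := HasDerivAt.fun_sum (u := Finset.univ) fun i _ => h1 i
    -- W is the sum of the squared norms of the idempotents minus n; its derivative is the trace
    -- estimated by the Lyapunov bound.
    have h3 : W = fun t => ∑ i, (star (P i t) * P i t).trace.re - n := by
      funext t
      simp only [hW, gramDefect, trace_sub, trace_sum, trace_one, Complex.sub_re, Complex.re_sum,
        Fintype.card_fin, Complex.natCast_re]
    rw [h3]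
    simp only [hW', Finset.mul_sum]
    exact h2.sub_const _
  have hW0 : Tendsto W atTop (𝓝 0) := by
    have : Continuous fun M : Matrix (Fin n) (Fin n) ℂ => M.trace.re :=
      Complex.continuous_re.comp (Continuous.matrix_trace continuous_id)
    have h1 := (this.tendsto 0).comp hKt
    rw [trace_zero, Complex.zero_re] at h1
    exact h1
  have hPlim : ∀ i, ∃ Q, Tendsto (P i) atTop (𝓝 Q) := by
    intro i
    have hO : (fun t => phi φ₁ φ₂ (Xt t) * P i t - P i t * phi φ₁ φ₂ (Xt t)) =O[atTop]
        fun t => ‖gramDefect (P · t)‖ := by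
      refine ((hNN.phi_commutator_near Subtype.val_injective hmemt hlam hφ.contDiffOn₁
        hφ.contDiffOn₂ i).isBigO.add (blk_isBigO hNN.bdd _ NearNormal.gramDefect_isBigO)).congr_left
        fun t => sub_add_cancel _ _
    obtain ⟨D, hD, hDb⟩ := hO.exists_pos
    obtain ⟨t₀, ht₀⟩ := eventually_atTop.1
      (((hlyap.and hbig.bound).and hDb.bound).and (eventually_gt_atTop 0))
    refine exists_tendsto_of_lyapunov (W := W) (W' := W') (κ := fun t => ‖gramDefect (P · t)‖)
      (t₀ := t₀) (c := 2 * c) (C := C) (D := D) (by positivity) hC hD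
      (fun t ht => hderivW t (ht₀ t ht).2) (fun t ht => ?_) (fun t ht => ?_) hW0
      (fun t ht => hderivP i t (ht₀ t ht).2) (fun t ht => ?_)
    · have := (ht₀ t ht).1.1.1
      simp only [hW']
      linarith
    · have := (ht₀ t ht).1.1.2
      rw [Real.norm_eq_abs, norm_pow, norm_norm] at this
      exact (le_abs_self _).trans this
    · have := (ht₀ t ht).1.2
      rwa [norm_norm] at this
  choose Q hQ using hPlim
  have hlinlim : Tendsto (fun t => lin (P · t) lam) atTop (𝓝 (lin Q lam)) :=
    tendsto_finsetSum _ fun i _ => (hQ i).const_smul _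
  have hXlim : Tendsto X atTop (𝓝 (lin Q lam)) := by
    have h1 := hYt.add hlinlim
    rw [zero_add] at h1
    exact (h1.congr fun t => sub_add_cancel _ _).congr' hXt_ev
  refine ⟨lin Q lam, ⟨?_⟩, hXlim⟩
  have h2 : Continuous fun Z : Matrix (Fin n) (Fin n) ℂ => star Z * Z - Z * star Z := by fun_prop
  exact sub_eq_zero.1 (tendsto_nhds_unique ((h2.tendsto _).comp hXlim) hNlim)

lemma isGlobalSolution_const_of_isEmpty {b : ℝ} (φ₁ φ₂ : ℝ → ℝ) {T : Matrix (Fin 0) (Fin 0) ℂ}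
    (hT : T ∈ matricesIn 0 0 b) : IsGlobalSolution 0 b φ₁ φ₂ T fun _ => T where
  initial := rfl
  mem _ _ := hT
  deriv t _ := by
    rw [Subsingleton.elim (phi φ₁ φ₂ T * T - T * phi φ₁ φ₂ T) 0]
    exact hasDerivWithinAt_const t _ T

end FlowConvergence

lemma nonneg_of_mem_matricesIn {n : ℕ} [NeZero n] {b : ℝ} {T : Matrix (Fin n) (Fin n) ℂ}
    (hT : T ∈ matricesIn n 0 b) : 0 ≤ b := by
  have h1 : (isHermitian_abs T).eigenvalues 0 ∈ spectrum ℝ (CFC.abs T) := by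
    rw [(isHermitian_abs T).spectrum_real_eq_range_eigenvalues]
    exact ⟨0, rfl⟩
  exact (hT h1).1.trans (hT h1).2

end MatrixFlow

end

theorem mainTheorem4 (n : ℕ) (b : ℝ) (φ₁ φ₂ : ℝ → ℝ)
    (hφ : MatrixFlow.CondC1 0 b φ₁ φ₂)
    (T : Matrix (Fin n) (Fin n) ℂ) (hT : T ∈ MatrixFlow.matricesIn n 0 b)
    (h :
      (MatrixFlow.algMult T = MatrixFlow.geomMult T ∧
        ContDiffOn ℝ ((n - 1 - MatrixFlow.geomMult T : ℕ) : WithTop ℕ∞) φ₁ (Set.Icc 0 b) ∧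
        ContDiffOn ℝ ((n - 1 - MatrixFlow.geomMult T : ℕ) : WithTop ℕ∞) φ₂ (Set.Icc 0 b)) ∨
      (MatrixFlow.algMult T = MatrixFlow.geomMult T + 1 ∧
        (∀ x ∈ Set.Icc 0 b, φ₂ x = 0) ∧
        ContDiffOn ℝ ((n - 1 - MatrixFlow.geomMult T : ℕ) : WithTop ℕ∞) φ₁ (Set.Icc 0 b))) :
    ∃ X : ℝ → Matrix (Fin n) (Fin n) ℂ,
      MatrixFlow.IsGlobalSolution 0 b φ₁ φ₂ T X ∧
      (∀ X' : ℝ → Matrix (Fin n) (Fin n) ℂ,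
        MatrixFlow.IsGlobalSolution 0 b φ₁ φ₂ T X' → Set.EqOn X' X (Set.Ici 0)) ∧
      ∃ N : Matrix (Fin n) (Fin n) ℂ,
        IsStarNormal N ∧ Filter.Tendsto X Filter.atTop (𝓝 N) := by
  -- For n = 0 the interval may be empty; for n > 0 a singular value of T forces 0 ≤ b.
  rcases Nat.eq_zero_or_pos n with rfl | hn
  · exact ⟨fun _ => T, MatrixFlow.isGlobalSolution_const_of_isEmpty φ₁ φ₂ hT,
      fun X' _ t _ => Subsingleton.elim _ _, T, ⟨Subsingleton.elim _ _⟩, tendsto_const_nhds⟩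
  · have : NeZero n := ⟨hn.ne'⟩
    have hb := MatrixFlow.nonneg_of_mem_matricesIn hT
    obtain ⟨X, hsol, huniq, hX, hanti⟩ := MatrixFlow.exists_flow hb hφ.toCondCL hT
    exact ⟨X, hsol, huniq, MatrixFlow.exists_tendsto_flow hb hφ hT hsol hX hanti⟩
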